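/- Let $\mathbb K=\mathbb R$ or $\mathbb C$. Let $V$ be the super vector space with even basis $x^0,x^1,x^2,\dots$ and odd basis $\theta^1,\theta^2,\dots$, let $y_0,y_1,\dots$ (even) and $\eta_1,\eta_2,\dots$ (odd) be the coordinate functionals in $V^*=\mathrm{Hom}(V,\mathbb K)$ (topologized by pointwise convergence, $\mathbb K$ discrete), and let $\widetilde V=V\oplus\mathbb K^{0|1}$ with $\theta^0$ a basis of $\mathbb K^{0|1}$. Let $\mathbb K[[\widetilde V,\hbar]]$ be the completion of the polynomial superalgebra in $x^a,\theta^a,\hbar$ for the degree with $\deg x^a=\deg\theta^a=1$, $\deg\hbar=2$, and let $\widehat{\mathcal W}_\hbar(\widetilde V)$ be the completion, for pointwise convergence of operators on $\mathbb K[[\widetilde V,\hbar]]$, of the algebra of differential operators generated by $\hbar,x^a,\theta^a,\hbar\partial_{x^a},\hbar\partial_{\theta^a}$; it is graded with $\deg(\hbar\partial)=1$. Write $[\cdot,\cdot]$ for the super-commutator. A *super quantum Airy structure* on $V$ is an even (parity-preserving) continuous linear map $L:V^*\to\widehat{\mathcal W}_\hbar(\widetilde V)$ such that (1) the left ideal $\mathfrak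 L\subseteq\widehat{\mathcal W}_\hbar(\widetilde V)$ generated by $L(V^*)$ satisfies $[\mathfrak L,\mathfrak L]\subseteq\hbar\,\mathfrak L$, and (2) the part of degree $\le 1$ of $L(y_i)$ is $\hbar\partial_{x^i}$ and that of $L(\eta_j)$ is $\hbar\partial_{\theta^j}$. For $m\ge1$ put $b_m=\sqrt\hbar\,\partial_{x^m}$, $b_{-m}=\frac m{\sqrt\hbar}x^m$, $\psi_m=\sqrt\hbar\,\partial_{\theta^m}$, $\psi_{-m}=\frac1{\sqrt\hbar}\theta^m$, and put $b_0=\sqrt\hbar\,\partial_{x^0}$, $\psi_0=\frac1{\sqrt{2\hbar}}(\theta^0+\hbar\partial_{\theta^0})$. Let $:\;:$ denote normal ordering: for the $b$'s, negative indices to the left; $:\psi_r\psi_s:\,=\psi_r\psi_s$ if $r\le s$ and $-\psi_s\psi_r$ if $r>s$. For an integer $N\ge0$ and $i\ge0$, $j\ge1$ put $$H_i=\hbar\frac{\partial}{\partial x^i}+\frac\hbar2\sum_{k\in\mathbb Z}:b_kb_{i+N-1-k}:+\frac\hbar2\sum_{k\in\mathbb Z}\Big(k+\frac{i+N-1}2\Big):\psi_{-k}\psi_{i+N-1+k}:,$$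 $$F_j=\hbar\frac{\partial}{\partial\theta^j}+\hbar\sum_{k\in\mathbb Z}b_{j+N-1-k}\psi_k .$$ **Proposition.** The modes represent the super Heisenberg algebra: $[b_m,b_n]=m\,\delta_{m,-n}$, $\{\psi_m,\psi_n\}=\delta_{m,-n}$, $[b_m,\psi_n]=0$ for all $m,n\in\mathbb Z$. The sums defining $H_i$ and $F_j$ converge pointwise, $H_i,F_j\in\widehat{\mathcal W}_\hbar(\widetilde V)$, and each $F_j$ involves the extra variable $\theta^0$, in the sense that $\{\theta^0,F_j\}\neq0$. Moreover: 1. Let $N\ge1$, let $D_0,\dots,D_{N-1}\in\mathbb K$ be arbitrary, and put $\widetilde H_i=H_i+\hbar D_i\,\delta_{i\le N-1}$ for $i\ge0$. There is a unique super quantum Airy structure $H$ on $V$ with $H(y_i)=\widetilde H_i$ ($i\ge0$) and $H(\eta_j)=F_j$ ($j\ge1$). These operators represent a subalgebra of the super Virasoro algebra in the Ramond sector (the one spanned by $L_m$, $m\ge N-1$, and $G_n$, $n\ge N$): $$[\widetilde H_m,\widetilde H_n]=\hbar(m-n)\widetilde H_{m+n+N-1},\qquad [\widetilde H_m,F_n]=\hbar\Big(\frac{m-N+1}2-n\Big)F_{m+n+N-1},\qquad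 \{F_m,F_n\}=2\hbar\,\widetilde H_{m+n+N-1}$$ for all admissible indices ($\ge0$ for $\widetilde H$, $\ge1$ for $F$). 2. Let $N\ge0$, let $D_0,\dots,D_N,C_0\in\mathbb K$ be arbitrary, and put $\widetilde H_i=H_i+\hbar D_i\,\delta_{i\le N}$ for $i\ge1$. There is a unique super quantum Airy structure $H$ on $V$ with $H(y_i)=\widetilde H_i$, $H(\eta_i)=F_i$ ($i\ge1$) and $$H(y_0)=\hbar\frac{\partial}{\partial x^0}+\frac{\hbar^2}2C_0\frac{\partial^2}{\partial(x^0)^2}+\hbar D_0 .$$ These operators satisfy the displayed relations for all indices $\ge1$ (those of the Ramond subalgebra spanned by $L_m$, $G_m$, $m\ge N$), together with $[H(y_0),H(y_i)]=[H(y_0),H(\eta_i)]=0$ for $i\ge1$. -/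

import Mathlib

noncomputable section

namespace SuperAiry

/-- A monomial `ħ ^ h * x ^ α * θ_{s₁} ⋯ θ_{sₙ}` (`s₁ < ⋯ < sₙ`) in `ħ`, the even variables `x i`
(`i : E`) and the odd variables `θ j` (`j : O`). -/
@[ext] structure Mono (E O : Type*) where
  h : ℕ
  x : E →₀ ℕ
  θ : Finset O

/-- A copy of a type, carrying the discrete topology. -/
def Discrete (α : Type*) : Type _ := α

instance (α : Type*) : TopologicalSpace (Discrete α) := ⊥

instance (α : Type*) : DiscreteTopology (Discrete α) := ⟨rfl⟩

instance (α : Type*) [AddCommGroup α] : AddCommGroup (Discrete α) :=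
  inferInstanceAs (AddCommGroup α)

variable {E O : Type*}

/-- The degree: `deg ħ = 2`, `deg x = deg θ = 1`. -/
def Mono.deg (m : Mono E O) : ℕ := 2 * m.h + m.x.sum (fun _ n => n) + m.θ.card

/-- The space `𝕜[[V, ħ]]`: families of coefficients, indexed by monomials, with finitely many
nonzero coefficients in each degree. It is the completion of the polynomial superalgebra
`𝕜[V, ħ]` with respect to the ideal of positive degree elements, where `V` has the
even basis `x i` (`i : E`) and the odd basis `θ j` (`j : O`). -/
@[ext] structure Series (𝕜 : Type*) (E O : Type*) [Zero 𝕜] where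
  coeff : Mono E O → 𝕜
  finite' : ∀ d : ℕ, {m | m.deg = d ∧ coeff m ≠ 0}.Finite

namespace Series

variable {𝕜 : Type*} [Field 𝕜]

theorem coeff_injective :
    Function.Injective (coeff : Series 𝕜 E O → Mono E O → 𝕜) := fun _ _ h => Series.ext h

instance : Zero (Series 𝕜 E O) := ⟨⟨0, fun d => by simp⟩⟩

instance : Add (Series 𝕜 E O) := ⟨fun f g => ⟨f.coeff + g.coeff, fun d =>
  ((f.finite' d).union (g.finite' d)).subset (by
    rintro m ⟨hm, h⟩
    by_contra hc
    simp only [Set.mem_union, Set.mem_ofPred_eq, not_or, not_and, not_not] at hc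
    exact h (by simp [hc.1 hm, hc.2 hm]))⟩⟩

instance : Neg (Series 𝕜 E O) := ⟨fun f => ⟨-f.coeff, fun d => by simpa using f.finite' d⟩⟩

instance : Sub (Series 𝕜 E O) := ⟨fun f g => ⟨f.coeff - g.coeff, fun d =>
  ((f.finite' d).union (g.finite' d)).subset (by
    rintro m ⟨hm, h⟩
    by_contra hc
    simp only [Set.mem_union, Set.mem_ofPred_eq, not_or, not_and, not_not] at hc
    exact h (by simp [hc.1 hm, hc.2 hm]))⟩⟩

instance {S : Type*} [SMulZeroClass S 𝕜] : SMul S (Series 𝕜 E O) :=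
  ⟨fun c f => ⟨c • f.coeff, fun d => (f.finite' d).subset (by
    rintro m ⟨hm, h⟩
    exact ⟨hm, fun h0 => h (by simp [h0])⟩)⟩⟩

instance : AddCommGroup (Series 𝕜 E O) :=
  coeff_injective.addCommGroup coeff rfl (fun _ _ => rfl) (fun _ => rfl) (fun _ _ => rfl)
    (fun _ _ => rfl) (fun _ _ => rfl)

/-- The coefficients, as an additive map. -/
def coeffHom : Series 𝕜 E O →+ (Mono E O → 𝕜) where
  toFun := coeff
  map_zero' := rfl
  map_add' _ _ := rfl

instance : Module 𝕜 (Series 𝕜 E O) :=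
  coeff_injective.module 𝕜 coeffHom (fun _ _ => rfl)

@[simp] theorem coeff_zero (m : Mono E O) : (0 : Series 𝕜 E O).coeff m = 0 := rfl

@[simp] theorem coeff_add (f g : Series 𝕜 E O) (m : Mono E O) :
    (f + g).coeff m = f.coeff m + g.coeff m := rfl

@[simp] theorem coeff_smul (c : 𝕜) (f : Series 𝕜 E O) (m : Mono E O) :
    (c • f).coeff m = c * f.coeff m := rfl

/-- The homogeneous component of degree `d` of a series. -/
def comp (d : ℕ) : Series 𝕜 E O →ₗ[𝕜] Series 𝕜 E O where
  toFun f := ⟨fun m => if m.deg = d then f.coeff m else 0, fun d' =>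
    (f.finite' d').subset (by
      rintro m ⟨hm, h⟩
      refine ⟨hm, fun h0 => h ?_⟩
      simp [h0])⟩
  map_add' f g := by ext m; by_cases h : m.deg = d <;> simp [h]
  map_smul' c f := by ext m; by_cases h : m.deg = d <;> simp [h]

theorem coeff_comp (d : ℕ) (f : Series 𝕜 E O) (m : Mono E O) :
    (comp d f).coeff m = if m.deg = d then f.coeff m else 0 := rfl

/-- The homogeneous component of degree `d`, as a map to a discrete space. -/
def dcomp (d : ℕ) : Series 𝕜 E O →+ Discrete (Series 𝕜 E O) := (comp d).toAddMonoidHom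

/-- The adic topology of `𝕜[[V, ħ]]`: convergence means that every homogeneous component is
eventually constant. -/
instance : TopologicalSpace (Series 𝕜 E O) :=
  TopologicalSpace.induced (fun f (d : ℕ) => dcomp d f) Pi.topologicalSpace

theorem continuous_dcomp (d : ℕ) : Continuous (dcomp d : Series 𝕜 E O → _) :=
  (continuous_apply (A := fun _ : ℕ => Discrete (Series 𝕜 E O)) d).comp
    (continuous_induced_dom (f := fun (f : Series 𝕜 E O) (d : ℕ) => dcomp d f))

theorem continuous_of_dcomp {X : Type*} [TopologicalSpace X] {u : X → Series 𝕜 E O}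
    (hu : ∀ d, Continuous (fun t => dcomp d (u t))) : Continuous u :=
  continuous_induced_rng.2 (continuous_pi hu)

instance : ContinuousAdd (Series 𝕜 E O) where
  continuous_add := continuous_of_dcomp fun d => by
    simp only [map_add]
    exact ((continuous_dcomp d).comp continuous_fst).add
      ((continuous_dcomp d).comp continuous_snd)

/-- A map is continuous if each component of the image depends on one component only. -/
theorem continuous_of_factor (u : Series 𝕜 E O → Series 𝕜 E O)
    (hu : ∀ d, ∃ d', ∀ f, comp d (u f) = comp d (u (comp d' f))) : Continuous u := by
  refine continuous_of_dcomp fun d => ?_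
  obtain ⟨d', hd'⟩ := hu d
  have h : Continuous (fun f : Discrete (Series 𝕜 E O) => dcomp d (u f)) :=
    continuous_of_discreteTopology
  exact (h.comp (continuous_dcomp d')).congr fun f => (hd' f).symm

end Series

/-- All `𝕜`-linear operators on `𝕜[[V, ħ]]`. -/
abbrev Op (𝕜 : Type*) (E O : Type*) [Field 𝕜] : Type _ := Module.End 𝕜 (Series 𝕜 E O)

namespace Op

variable {𝕜 : Type*} [Field 𝕜]

/-- The topology of pointwise convergence on operators. -/
instance : TopologicalSpace (Op 𝕜 E O) :=
  TopologicalSpace.induced (fun T (f : Series 𝕜 E O) => T f) Pi.topologicalSpace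

theorem continuous_eval (f : Series 𝕜 E O) : Continuous (fun T : Op 𝕜 E O => T f) :=
  (continuous_apply f).comp continuous_induced_dom

theorem continuous_of_eval {X : Type*} [TopologicalSpace X] {u : X → Op 𝕜 E O}
    (hu : ∀ f, Continuous (fun t => u t f)) : Continuous u :=
  continuous_induced_rng.2 (continuous_pi hu)

instance : ContinuousAdd (Op 𝕜 E O) where
  continuous_add := continuous_of_eval fun f =>
    ((continuous_eval f).comp continuous_fst).add ((continuous_eval f).comp continuous_snd)

/-- Auxiliary: the operator `f ↦ (m ↦ c m * f (g m))`. All basic operators are of this form. -/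
def pull (c : Mono E O → 𝕜) (g : Mono E O → Mono E O) (hinj : Set.InjOn g {m | c m ≠ 0})
    (hdeg : ∀ d, ∃ d', ∀ m, c m ≠ 0 → m.deg = d → (g m).deg = d') : Op 𝕜 E O where
  toFun f := ⟨fun m => c m * f.coeff (g m), fun d => by
    obtain ⟨d', hd'⟩ := hdeg d
    refine Set.Finite.of_injOn (f := g) (t := {m | m.deg = d' ∧ f.coeff m ≠ 0}) ?_
      (hinj.mono ?_) (f.finite' d')
    · rintro m ⟨hm, h⟩
      exact ⟨hd' m (left_ne_zero_of_mul h) hm, right_ne_zero_of_mul h⟩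
    · rintro m ⟨-, h⟩
      exact left_ne_zero_of_mul h⟩
  map_add' f f' := by ext m; simp [mul_add]
  map_smul' a f := by ext m; simp [mul_left_comm]

theorem continuous_pull (c : Mono E O → 𝕜) (g : Mono E O → Mono E O)
    (hinj : Set.InjOn g {m | c m ≠ 0})
    (hdeg : ∀ d, ∃ d', ∀ m, c m ≠ 0 → m.deg = d → (g m).deg = d') :
    Continuous (pull c g hinj hdeg) := by
  refine Series.continuous_of_factor _ fun d => ?_
  obtain ⟨d', hd'⟩ := hdeg d
  refine ⟨d', fun f => ?_⟩
  ext m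
  simp only [Series.coeff_comp, pull, LinearMap.coe_mk, AddHom.coe_mk]
  by_cases hm : m.deg = d
  · by_cases hc : c m = 0
    · simp [hc]
    · simp [hm, hd' m hc hm]
  · simp [hm]

theorem sum_add_single (α : E →₀ ℕ) (i : E) :
    (α + Finsupp.single i 1).sum (fun _ n => n) = α.sum (fun _ n => n) + 1 := by
  classical
  rw [Finsupp.sum_add_index' (fun _ => rfl) (fun _ _ _ => rfl), Finsupp.sum_single_index rfl]

theorem sub_single_add {α : E →₀ ℕ} {i : E} (h : α i ≠ 0) :
    α - Finsupp.single i 1 + Finsupp.single i 1 = α :=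
  tsub_add_cancel_of_le (Finsupp.single_le_iff.2 (Nat.one_le_iff_ne_zero.2 h))

/-- Multiplication by `ħ`. -/
def hbar : Op 𝕜 E O :=
  pull (fun m => if m.h = 0 then 0 else 1) (fun m => { m with h := m.h - 1 })
    (by
      intro m hm m' hm' h
      have h1 : m.h ≠ 0 := by simpa using hm
      have h2 : m'.h ≠ 0 := by simpa using hm'
      simp only [Mono.mk.injEq] at h
      exact Mono.ext (by omega) h.2.1 h.2.2)
    (fun d => ⟨d - 2, fun m hm hd => by
      have h1 : m.h ≠ 0 := by simpa using hm
      simp only [Mono.deg] at hd ⊢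
      omega⟩)

/-- Multiplication by the even variable `x i`. -/
def mulX (i : E) : Op 𝕜 E O :=
  pull (fun m => if m.x i = 0 then 0 else 1) (fun m => { m with x := m.x - Finsupp.single i 1 })
    (by
      intro m hm m' hm' h
      have h1 : m.x i ≠ 0 := by simpa using hm
      have h2 : m'.x i ≠ 0 := by simpa using hm'
      simp only [Mono.mk.injEq] at h
      refine Mono.ext h.1 ?_ h.2.2
      rw [← sub_single_add h1, ← sub_single_add h2, h.2.1])
    (fun d => ⟨d - 1, fun m hm hd => by
      have h1 : m.x i ≠ 0 := by simpa using hm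
      have h2 := sum_add_single (m.x - Finsupp.single i 1) i
      rw [sub_single_add h1] at h2
      simp only [Mono.deg] at hd ⊢
      omega⟩)

/-- The partial derivative `∂ / ∂x i`. -/
def dX (i : E) : Op 𝕜 E O :=
  pull (fun m => (m.x i : 𝕜) + 1) (fun m => { m with x := m.x + Finsupp.single i 1 })
    (by
      intro m _ m' _ h
      simp only [Mono.mk.injEq, add_left_inj] at h
      exact Mono.ext h.1 h.2.1 h.2.2)
    (fun d => ⟨d + 1, fun m _ hd => by
      simp only [Mono.deg, sum_add_single] at hd ⊢
      omega⟩)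

/-- The parity involution, acting as `(-1) ^ n` on monomials with `n` odd variables. -/
def parity : Op 𝕜 E O :=
  pull (fun m => (-1) ^ m.θ.card) id (Set.injOn_id _) (fun d => ⟨d, fun _ _ h => h⟩)

/-- The even part of an operator. -/
def evenPart (T : Op 𝕜 E O) : Op 𝕜 E O := (2⁻¹ : 𝕜) • (T + parity * T * parity)

/-- The odd part of an operator. -/
def oddPart (T : Op 𝕜 E O) : Op 𝕜 E O := (2⁻¹ : 𝕜) • (T - parity * T * parity)

/-- An operator is even if it preserves parity. -/
def IsEven (T : Op 𝕜 E O) : Prop := oddPart T = 0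

/-- An operator is odd if it reverses parity. -/
def IsOdd (T : Op 𝕜 E O) : Prop := evenPart T = 0

/-- The super-commutator: the bilinear extension of `[S, T] = S T - (-1) ^ (|S| |T|) T S`. -/
def scomm (S T : Op 𝕜 E O) : Op 𝕜 E O :=
  (evenPart S * evenPart T - evenPart T * evenPart S) +
  (evenPart S * oddPart T - oddPart T * evenPart S) +
  (oddPart S * evenPart T - evenPart T * oddPart S) +
  (oddPart S * oddPart T + oddPart T * oddPart S)

/-- The component of degree `e` of an operator, which maps elements of degree `d` to elements
of degree `d + e`. -/
def degPart (e : ℕ) (T : Op 𝕜 E O) : Op 𝕜 E O where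
  toFun f := ⟨fun m => if e ≤ m.deg then (T (Series.comp (m.deg - e) f)).coeff m else 0, fun d => by
    refine ((T (Series.comp (d - e) f)).finite' d).subset ?_
    rintro m ⟨rfl, h⟩
    refine ⟨rfl, fun h0 => h ?_⟩
    simp [h0]⟩
  map_add' f g := by ext m; by_cases h : e ≤ m.deg <;> simp [h]
  map_smul' c f := by ext m; by_cases h : e ≤ m.deg <;> simp [h]

variable [LinearOrder O]

/-- The sign picked up by moving `θ j` into its place in the ordered product of the `θ s`,
`s ∈ S`. -/
def sign (j : O) (S : Finset O) : 𝕜 := (-1) ^ (S.filter (· < j)).card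

/-- Left multiplication by the odd variable `θ j`. -/
def mulθ (j : O) : Op 𝕜 E O :=
  pull (fun m => if j ∈ m.θ then sign j m.θ else 0) (fun m => { m with θ := m.θ.erase j })
    (by
      intro m hm m' hm' h
      have h1 : j ∈ m.θ := by by_contra hc; simp [hc] at hm
      have h2 : j ∈ m'.θ := by by_contra hc; simp [hc] at hm'
      simp only [Mono.mk.injEq] at h
      refine Mono.ext h.1 h.2.1 ?_
      rw [← Finset.insert_erase h1, ← Finset.insert_erase h2, h.2.2])
    (fun d => ⟨d - 1, fun m hm hd => by
      have h1 : j ∈ m.θ := by by_contra hc; simp [hc] at hm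
      have h2 := Finset.card_erase_add_one h1
      simp only [Mono.deg] at hd ⊢
      omega⟩)

/-- The left derivative `∂ / ∂θ j`. -/
def dθ (j : O) : Op 𝕜 E O :=
  pull (fun m => if j ∈ m.θ then 0 else sign j m.θ) (fun m => { m with θ := insert j m.θ })
    (by
      intro m hm m' hm' h
      have h1 : j ∉ m.θ := by intro hc; simp [hc] at hm
      have h2 : j ∉ m'.θ := by intro hc; simp [hc] at hm'
      simp only [Mono.mk.injEq] at h
      refine Mono.ext h.1 h.2.1 ?_
      rw [← Finset.erase_insert h1, ← Finset.erase_insert h2, h.2.2])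
    (fun d => ⟨d + 1, fun m hm hd => by
      have h1 : j ∉ m.θ := by intro hc; simp [hc] at hm
      have h2 := Finset.card_insert_of_notMem h1
      simp only [Mono.deg] at hd ⊢
      omega⟩)

end Op

open Op

section Weyl

variable (𝕜 : Type*) [Field 𝕜] (E O : Type*) [LinearOrder O]

/-- The generators `ħ`, `x i`, `ħ ∂ / ∂x i`, `θ j`, `ħ ∂ / ∂θ j`. -/
def weylGenerators : Set (Op 𝕜 E O) :=
  {hbar} ∪ Set.range mulX ∪ Set.range (fun i => hbar * dX i) ∪
    Set.range mulθ ∪ Set.range (fun j => hbar * dθ j)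

/-- The algebra of polynomial differential operators generated by `ħ`, the variables and
`ħ` times the derivatives. -/
def weyl : Subalgebra 𝕜 (Op 𝕜 E O) := Algebra.adjoin 𝕜 (weylGenerators 𝕜 E O)

variable {𝕜 E O}

theorem continuous_of_mem_weyl {T : Op 𝕜 E O} (hT : T ∈ weyl 𝕜 E O) : Continuous T := by
  induction hT using Algebra.adjoin_induction with
  | mem T h =>
    have hh : Continuous (hbar : Op 𝕜 E O) := continuous_pull _ _ _ _
    rcases h with (((rfl | ⟨i, rfl⟩) | ⟨i, rfl⟩) | ⟨j, rfl⟩) | ⟨j, rfl⟩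
    · exact hh
    · exact continuous_pull _ _ _ _
    · exact hh.comp (continuous_pull _ _ _ _ : Continuous (dX i : Op 𝕜 E O))
    · exact continuous_pull _ _ _ _
    · exact hh.comp (continuous_pull _ _ _ _ : Continuous (dθ j : Op 𝕜 E O))
  | algebraMap r =>
    refine Series.continuous_of_factor _ fun d => ⟨d, fun f => ?_⟩
    ext m
    by_cases hm : m.deg = d <;> simp [Series.coeff_comp, Algebra.algebraMap_eq_smul_one, hm]
  | add S T _ _ hS hT => exact hS.add hT
  | mul S T _ _ hS hT => exact hS.comp hT

variable (𝕜 E O)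

/-- The completed Weyl algebra: the closure of the polynomial differential operators in the
topology of pointwise convergence on `𝕜[[V, ħ]]`. As `𝕜[[V, ħ]]` is complete, this is
the completion. Its elements are the formal sums
`∑_J a_J (ħ ∂)^J` with `a_J ∈ 𝕜[[V, ħ]]` arbitrary. -/
def weylHat : Subalgebra 𝕜 (Op 𝕜 E O) where
  carrier := closure (weyl 𝕜 E O : Set (Op 𝕜 E O))
  algebraMap_mem' r := subset_closure ((weyl 𝕜 E O).algebraMap_mem r)
  add_mem' hS hT := map_mem_closure₂ continuous_add hS hT fun _ h _ h' => add_mem h h'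
  mul_mem' {S T} hS hT := by
    have h1 : ∀ a ∈ weyl 𝕜 E O, a * T ∈ closure (weyl 𝕜 E O : Set (Op 𝕜 E O)) := fun a ha =>
      map_mem_closure (f := fun R => a * R)
        (continuous_of_eval fun f => (continuous_of_mem_weyl ha).comp (continuous_eval f))
        hT fun b hb => mul_mem ha hb
    have h2 := map_mem_closure (f := fun R => R * T)
      (t := closure (weyl 𝕜 E O : Set (Op 𝕜 E O)))
      (continuous_of_eval fun f => continuous_eval (T f)) hS fun a ha => h1 a ha
    rwa [closure_closure] at h2

end Weyl

section Airy

variable (𝕜 : Type*) [Field 𝕜] (E O : Type*)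

/-- The super vector space with even basis `x i` (`i : E`) and odd basis `θ j` (`j : O`). -/
abbrev SVect : Type _ := (E →₀ 𝕜) × (O →₀ 𝕜)

variable {𝕜 E O}

/-- The coordinate functional `y i` dual to the even basis vector `x i`. -/
def yDual (i : E) : Module.Dual 𝕜 (SVect 𝕜 E O) := Finsupp.lapply i ∘ₗ LinearMap.fst 𝕜 _ _

/-- The coordinate functional `η j` dual to the odd basis vector `θ j`. -/
def ηDual (j : O) : Module.Dual 𝕜 (SVect 𝕜 E O) := Finsupp.lapply j ∘ₗ LinearMap.snd 𝕜 _ _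

/-- A functional, as a map with values in the discrete space `𝕜`. -/
def dualEval (φ : Module.Dual 𝕜 (SVect 𝕜 E O)) : SVect 𝕜 E O → Discrete 𝕜 := fun v => φ v

/-- The topology of pointwise convergence on the full dual `V*`, for discrete `𝕜`. -/
abbrev dualTopology : TopologicalSpace (Module.Dual 𝕜 (SVect 𝕜 E O)) :=
  TopologicalSpace.induced dualEval Pi.topologicalSpace

/-- Super quantum Airy structures on the super vector space `V` with even basis indexed by `E` and
odd basis indexed by `O`. The larger space `V ⊕ 𝕜^{0|1}` has odd basis
indexed by `WithBot O`, the additional odd variable being `θ ⊥`. -/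
structure IsSuperQuantumAiryStructure [LinearOrder O]
    (L : Module.Dual 𝕜 (SVect 𝕜 E O) →ₗ[𝕜] weylHat 𝕜 E (WithBot O)) : Prop where
  /-- `L` preserves parity; even functionals vanish on odd vectors and vice versa. -/
  even : ∀ φ : Module.Dual 𝕜 (SVect 𝕜 E O), (∀ w, φ (0, w) = 0) → IsEven (L φ).1
  odd : ∀ φ : Module.Dual 𝕜 (SVect 𝕜 E O), (∀ v, φ (v, 0) = 0) → IsOdd (L φ).1
  continuous : @Continuous _ _ dualTopology inferInstance L
  /-- The left ideal `I` generated by the image of `L` satisfies `[I, I] ⊆ ħ I`. -/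
  involutive : ∀ S ∈ Ideal.span (Set.range L), ∀ T ∈ Ideal.span (Set.range L),
    ∃ U ∈ Ideal.span (Set.range L), scomm S.1 T.1 = hbar * U.1
  /-- The part of degree at most one of `L (y i)` is `ħ ∂ / ∂x i`, and similarly for `η j`. -/
  linear_even : ∀ i : E, degPart 0 (L (yDual i)).1 + degPart 1 (L (yDual i)).1 = hbar * dX i
  linear_odd : ∀ j : O,
    degPart 0 (L (ηDual j)).1 + degPart 1 (L (ηDual j)).1 = hbar * dθ (j : WithBot O)

end Airy

section Twisted

variable (𝕜 : Type*) [RCLike 𝕜]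

/-- Operators in the even variables `x^0, x^1, …` and the odd variables `θ^0, θ^1, …`. The odd
variables other than `θ^0` are indexed by positive integers, and `θ^0` is the extra variable. -/
abbrev TOp : Type _ := Op 𝕜 ℕ (WithBot ℕ+)

/-- The index of the variable `θ^m`. -/
def thetaIdx : ℕ → WithBot ℕ+
  | 0 => ⊥
  | m + 1 => (m.succPNat : WithBot ℕ+)

/-- The rescaled bosonic mode `√ħ b_m`, where `b_m = √ħ ∂ / ∂x^m` for `m ≥ 0` and
`b_{-m} = (m / √ħ) x^m` for `m ≥ 1`. -/
def bMode (m : ℤ) : TOp 𝕜 :=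
  if 0 ≤ m then hbar * dX m.toNat else ((-m : ℤ) : 𝕜) • mulX (-m).toNat

/-- The rescaled fermionic mode `√ħ ψ_m`, where `ψ_m = √ħ ∂ / ∂θ^m` and
`ψ_{-m} = (1 / √ħ) θ^m` for `m ≥ 1`, and `ψ_0 = (θ^0 + ħ ∂ / ∂θ^0) / √(2ħ)`. -/
def ψMode (m : ℤ) : TOp 𝕜 :=
  if 0 < m then hbar * dθ (thetaIdx m.toNat)
  else if m < 0 then mulθ (thetaIdx (-m).toNat)
  else (((√2)⁻¹ : ℝ) : 𝕜) • (mulθ (thetaIdx 0) + hbar * dθ (thetaIdx 0))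

/-- `ħ :b_j b_k:`, with modes of negative index on the left. -/
def bNormal (j k : ℤ) : TOp 𝕜 := if j ≤ k then bMode 𝕜 j * bMode 𝕜 k else bMode 𝕜 k * bMode 𝕜 j

/-- `ħ :ψ_r ψ_s:`, equal to `ħ ψ_r ψ_s` for `r ≤ s` and to `-ħ ψ_s ψ_r` for `r > s`. -/
def ψNormal (r s : ℤ) : TOp 𝕜 :=
  if r ≤ s then ψMode 𝕜 r * ψMode 𝕜 s else -(ψMode 𝕜 s * ψMode 𝕜 r)

/-- The terms of `ħ ∑_j :b_j b_{m-j}:`. -/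
def bosonTerm (m j : ℤ) : TOp 𝕜 := bNormal 𝕜 j (m - j)

/-- The terms of `ħ ∑_j (j + m / 2) :ψ_{-j} ψ_{m+j}:`. -/
def fermionTerm (m j : ℤ) : TOp 𝕜 := ((j : 𝕜) + (m : 𝕜) / 2) • ψNormal 𝕜 (-j) (m + j)

/-- The terms of `ħ ∑_k b_{m-k} ψ_k`. -/
def mixedTerm (m k : ℤ) : TOp 𝕜 := bMode 𝕜 (m - k) * ψMode 𝕜 k

/-- The operator
`H_i = ħ ∂ / ∂x^i + (ħ/2) ∑_j :b_j b_{i+N-1-j}: + (ħ/2) ∑_j (j + (i+N-1)/2) :ψ_{-j} ψ_{i+N-1+j}:`,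
the sums converging in the topology of pointwise convergence. -/
def HOp (N : ℤ) (i : ℕ) : TOp 𝕜 :=
  hbar * dX i + (2⁻¹ : 𝕜) • (∑' j : ℤ, bosonTerm 𝕜 (i + N - 1) j) +
    (2⁻¹ : 𝕜) • (∑' j : ℤ, fermionTerm 𝕜 (i + N - 1) j)

/-- The operator `F_j = ħ ∂ / ∂θ^j + ħ ∑_k b_{j+N-1-k} ψ_k`. -/
def FOp (N : ℤ) (j : ℕ) : TOp 𝕜 :=
  hbar * dθ (thetaIdx j) + ∑' k : ℤ, mixedTerm 𝕜 (j + N - 1) k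

variable {𝕜}

/-- The relations of the subalgebra of the super Virasoro algebra in the Ramond sector spanned
by `L_m` (`m ≥ a + N - 1`) and `G_n` (`n ≥ N`), for `H_i = ħ L_{i+N-1}` (`i ≥ a`) and
`F_j = ħ G_{j+N-1}` (`j ≥ 1`). -/
structure RamondRelations (N : ℤ) (a : ℕ) (H F : ℕ → TOp 𝕜) : Prop where
  HH : ∀ m n k : ℕ, a ≤ m → a ≤ n → (k : ℤ) = m + n + N - 1 →
    scomm (H m) (H n) = ((m : 𝕜) - n) • (hbar * H k)
  HF : ∀ m n k : ℕ, a ≤ m → 1 ≤ n → (k : ℤ) = m + n + N - 1 →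
    scomm (H m) (F n) = (((m : 𝕜) - N + 1) / 2 - n) • (hbar * F k)
  FF : ∀ m n k : ℕ, 1 ≤ m → 1 ≤ n → (k : ℤ) = m + n + N - 1 →
    scomm (F m) (F n) = (2 : 𝕜) • (hbar * H k)

end Twisted

end SuperAiry

end

noncomputable section

namespace SuperAiry

open Topology

/-! ## Topology and summation -/

section

variable {E O : Type*} {𝕜 : Type*} [Field 𝕜]

namespace Series

/-! Add 1 to the bosonic mode `b_{N-1}`, all modes being rescaled by √ħ. Up to constants, H_i and
F_j are then the quadratic super Virasoro expressions of index i+N-1 and j+N-1 in the shifted modes,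
since the linear terms ħ∂ are the cross terms of this dilaton shift. Only one or two terms of each
infinite sum fail to (anti)commute with a given mode. Bracketing with a mode therefore gives a
multiple of a single mode, as in `HOp_shiftedMode`, `HOp_ψMode`, `FOp_shiftedMode` and `FOp_ψMode`.

Let X be the difference of the two sides of a Ramond relation. By the Jacobi identity and these
formulas, X commutes with every x^i, and commutes or anticommutes with every ψ_k according to its
parity. Normal ordering makes H_i and F_j annihilate the vacuum when their Virasoro index is
non-negative, so X annihilates it too; this is where a central term is excluded. The vacuum is
cyclic for ħ, the x^i and the ψ_k, so X kills all monomials. An operator of the completed Weyl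
algebra does not lower the order of vanishing, hence is determined by its values on monomials, and X
= 0 (`eq_zero_of_commute`, `Filtered.eq_zero`). The constants ħD_i are central. They could enter a
relation only on its right side, and there either the coefficient vanishes or the index is too
large.

A functional on V is an infinite combination of coordinate functionals, so the Airy structure has to
be L(φ) = ∑ φ(e_k) A_k. The sum converges because only finitely many A_k act non-trivially on a
given monomial, and continuity leaves no other choice for L. For involutivity, brackets of such
infinite sums must again be ħ times a value of L. Reading off the coefficients of ħ∂_k gives a
continuous left inverse of L, so the image of L is closed. Division by ħ is a continuous left
inverse of ħ, so ħ times the image is closed as well, and relations between the A_k pass to the sums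
(`exists_scomm_airyMap`). The Leibniz rule carries them on to the left ideal, because all
super-commutators in the completed Weyl algebra are divisible by ħ
(`exists_scomm_eq_of_mem_weylHat`, `involutive_of_bracket`). -/

theorem comp_eq_zero_iff {d : ℕ} {f : Series 𝕜 E O} :
    comp d f = 0 ↔ ∀ m : Mono E O, m.deg = d → f.coeff m = 0 := by
  constructor
  · intro h m hm
    have := congrArg (fun g => g.coeff m) h
    simpa [coeff_comp, hm] using this
  · intro h
    ext m
    by_cases hm : m.deg = d <;> simp [coeff_comp, hm, h]

theorem coeff_eq_of_comp_eq {f g : Series 𝕜 E O} {m : Mono E O}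
    (h : comp m.deg f = comp m.deg g) : f.coeff m = g.coeff m := by
  simpa [coeff_comp] using congrArg (fun g => g.coeff m) h

@[simp] theorem coeff_neg (f : Series 𝕜 E O) (m : Mono E O) : (-f).coeff m = -f.coeff m := rfl

@[simp] theorem coeff_sub (f g : Series 𝕜 E O) (m : Mono E O) :
    (f - g).coeff m = f.coeff m - g.coeff m := rfl

@[simp] theorem coeff_sum {ι : Type*} (s : Finset ι) (f : ι → Series 𝕜 E O) (m : Mono E O) :
    (∑ i ∈ s, f i).coeff m = ∑ i ∈ s, (f i).coeff m := by
  have h := congrFun (map_sum (coeffHom : Series 𝕜 E O →+ _) f s) m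
  rwa [Finset.sum_apply] at h

instance : ContinuousNeg (Series 𝕜 E O) where
  continuous_neg := continuous_of_dcomp fun d => by
    simp only [map_neg]
    exact (continuous_of_discreteTopology (f := fun x : Discrete (Series 𝕜 E O) => -x)).comp
      (continuous_dcomp d)

instance : IsTopologicalAddGroup (Series 𝕜 E O) where

instance : ContinuousConstSMul 𝕜 (Series 𝕜 E O) where
  continuous_const_smul c := continuous_of_factor _ fun d => ⟨d, fun f => by
    ext m
    by_cases hm : m.deg = d <;> simp [coeff_comp, hm]⟩

instance : T2Space (Series 𝕜 E O) :=
  T2Space.of_injective_continuous (f := fun (f : Series 𝕜 E O) (d : ℕ) => dcomp d f)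
    (fun f g h => by
      ext m
      exact coeff_eq_of_comp_eq (congrFun h m.deg)) continuous_induced_dom

/-- The coefficient of a monomial, as a map to a discrete space. -/
def dcoeff (m : Mono E O) (f : Series 𝕜 E O) : Discrete 𝕜 := f.coeff m

theorem continuous_dcoeff (m : Mono E O) : Continuous (dcoeff m : Series 𝕜 E O → _) := by
  have h : Continuous (fun f : Discrete (Series 𝕜 E O) => dcoeff m f) :=
    continuous_of_discreteTopology
  refine (h.comp (continuous_dcomp m.deg)).congr fun f => ?_
  change (comp m.deg f).coeff m = f.coeff m
  simp [coeff_comp]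

theorem isClosed_coeff_eq_zero (m : Mono E O) : IsClosed {f : Series 𝕜 E O | f.coeff m = 0} :=
  (isClosed_discrete ({(0 : 𝕜)} : Set (Discrete 𝕜))).preimage (continuous_dcoeff m)

open Classical in
/-- A monomial, as a series. -/
def mono (μ : Mono E O) : Series 𝕜 E O :=
  ⟨fun m => if m = μ then 1 else 0, fun d => (Set.finite_singleton μ).subset (by
    rintro m ⟨-, h⟩
    by_contra hc
    exact h (if_neg hc))⟩

open Classical in
theorem coeff_mono (μ m : Mono E O) :
    (mono μ : Series 𝕜 E O).coeff m = if m = μ then 1 else 0 := rfl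

/-- The component of degree `d` is a linear combination of monomials. -/
theorem comp_mem_span (d : ℕ) (f : Series 𝕜 E O) :
    comp d f ∈ Submodule.span 𝕜 (Set.range (mono : Mono E O → Series 𝕜 E O)) := by
  classical
  have h : comp d f = ∑ m ∈ (f.finite' d).toFinset, f.coeff m • mono m := by
    ext m
    simp only [coeff_comp, coeff_sum, coeff_smul, coeff_mono, mul_ite, mul_one, mul_zero,
      Finset.sum_ite_eq, Set.Finite.mem_toFinset, Set.mem_ofPred_eq]
    by_cases h1 : m.deg = d <;> by_cases h2 : f.coeff m = 0 <;> simp [h1, h2]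
  rw [h]
  exact Submodule.sum_mem _ fun m _ => Submodule.smul_mem _ _ (Submodule.subset_span ⟨m, rfl⟩)

theorem comp_comp (d d' : ℕ) (f : Series 𝕜 E O) :
    comp d (comp d' f) = if d = d' then comp d f else 0 := by
  ext m
  by_cases h : m.deg = d
  · subst h
    by_cases h' : m.deg = d' <;> simp [coeff_comp, h']
  · by_cases h' : d = d'
    · subst h'
      simp [coeff_comp, h]
    · simp [coeff_comp, h, h']

end Series

open Series

/-! ### Locally finite families and filtered operators. -/

namespace Op

theorem isInducing_eval :
    IsInducing (fun (T : Op 𝕜 E O) (f : Series 𝕜 E O) => T f) := ⟨rfl⟩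

instance : ContinuousNeg (Op 𝕜 E O) where
  continuous_neg := continuous_of_eval fun f => (continuous_eval f).neg

instance : IsTopologicalAddGroup (Op 𝕜 E O) where

instance : ContinuousConstSMul 𝕜 (Op 𝕜 E O) where
  continuous_const_smul c := continuous_of_eval fun f => (continuous_eval f).const_smul c

instance : T2Space (Op 𝕜 E O) :=
  T2Space.of_injective_continuous (f := fun (T : Op 𝕜 E O) (f : Series 𝕜 E O) => T f)
    (fun _ _ h => LinearMap.ext fun f => congrFun h f) continuous_induced_dom

theorem continuous_mul_right (S : Op 𝕜 E O) : Continuous (fun T : Op 𝕜 E O => T * S) :=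
  continuous_of_eval fun f => continuous_eval (S f)

/-- Composing on the right respects pointwise convergence for any operator, but composing on the
left needs a continuous one. This asymmetry is why elements of the completed Weyl algebra must first
be shown to be continuous. -/
theorem continuous_mul_left {S : Op 𝕜 E O} (hS : Continuous S) :
    Continuous (fun T : Op 𝕜 E O => S * T) :=
  continuous_of_eval fun f => hS.comp (continuous_eval f)

/-- A family of operators is locally finite if, after application to a series, only finitely
many members contribute to each degree. -/
def LocFin {ι : Type*} (A : ι → Op 𝕜 E O) : Prop :=
  ∀ (f : Series 𝕜 E O) (d : ℕ), {i | comp d (A i f) ≠ 0}.Finite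

theorem LocFin.smul {ι : Type*} {A : ι → Op 𝕜 E O} (hA : LocFin A) (c : ι → 𝕜) :
    LocFin fun i => c i • A i := fun f d => (hA f d).subset fun i hi h => hi (by
  simp only [LinearMap.smul_apply, map_smul, h, smul_zero])

/-- Every coefficient of the candidate limit is a finite sum. In degree `d` the partial sums are
constant once they contain the finitely many contributing indices, which is convergence in the adic
topology. -/
theorem LocFin.summable {ι : Type*} {A : ι → Op 𝕜 E O} (hA : LocFin A) : Summable A := by
  have hfin : ∀ f m, (Function.support fun i => (A i f).coeff m).Finite := fun f m =>
    (hA f m.deg).subset fun i hi h => hi (comp_eq_zero_iff.1 h m rfl)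
  let T : Op 𝕜 E O :=
    { toFun := fun f => ⟨fun m => ∑ᶠ i, (A i f).coeff m, fun d => by
        refine ((hA f d).biUnion fun i _ => (A i f).finite' d).subset ?_
        rintro m ⟨hm, h⟩
        obtain ⟨i, hi⟩ := not_forall.1 fun h0 => h (finsum_eq_zero_of_forall_eq_zero h0)
        simp only [Set.mem_iUnion]
        exact ⟨i, fun h0 => hi (comp_eq_zero_iff.1 h0 m hm), hm, hi⟩⟩
      map_add' := fun f g => by
        ext m
        simp only [map_add, coeff_add]
        exact finsum_add_distrib (hfin f m) (hfin g m)
      map_smul' := fun c f => by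
        ext m
        simp only [map_smul, coeff_smul, RingHom.id_apply]
        exact (mul_finsum' _ _ (hfin f m)).symm }
  refine ⟨T, ?_⟩
  rw [HasSum, isInducing_eval.tendsto_nhds_iff, tendsto_pi_nhds]
  intro f
  have hi : IsInducing (fun (f : Series 𝕜 E O) (d : ℕ) => dcomp d f) := ⟨rfl⟩
  rw [hi.tendsto_nhds_iff, tendsto_pi_nhds]
  intro d
  refine tendsto_nhds_of_eventually_eq ?_
  simp only [SummationFilter.unconditional_filter]
  filter_upwards [Filter.eventually_ge_atTop (hA f d).toFinset] with s hs
  change comp d ((∑ i ∈ s, A i) f) = comp d (T f)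
  ext m
  simp only [coeff_comp]
  split_ifs with hm
  · rw [LinearMap.sum_apply, coeff_sum]
    refine (finsum_eq_sum_of_support_subset _ fun i hi => hs ?_).symm
    rw [Set.Finite.mem_toFinset]
    exact fun h => hi (comp_eq_zero_iff.1 h m hm)
  · rfl

/-- An operator is filtered if it does not lower the order of vanishing. -/
def Filtered (T : Op 𝕜 E O) : Prop :=
  ∀ (d : ℕ) (f : Series 𝕜 E O), (∀ m : Mono E O, m.deg ≤ d → f.coeff m = 0) →
    ∀ m : Mono E O, m.deg ≤ d → (T f).coeff m = 0

/-- A series minus its truncation vanishes through degree `d`, hence so does the image. Questions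
about `T f` thereby reduce to finite combinations of monomials. -/
theorem Filtered.coeff_eq {T : Op 𝕜 E O} (hT : Filtered T) {d : ℕ} (f : Series 𝕜 E O)
    {m : Mono E O} (hm : m.deg ≤ d) :
    (T f).coeff m = (T (∑ e ∈ Finset.range (d + 1), comp e f)).coeff m := by
  rw [← sub_eq_zero, ← coeff_sub, ← map_sub]
  refine hT d _ (fun m hm => ?_) m hm
  simp [coeff_comp, hm]

theorem Filtered.continuous {T : Op 𝕜 E O} (hT : Filtered T) : Continuous T := by
  refine continuous_of_dcomp fun d => ?_
  have h : ∀ f, dcomp d (T f) = ∑ e ∈ Finset.range (d + 1), dcomp d (T (comp e f)) := by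
    intro f
    rw [← map_sum, ← map_sum]
    change comp d _ = comp d _
    ext m
    simp only [coeff_comp]
    split_ifs with hm
    · exact hT.coeff_eq f hm.le
    · rfl
  refine Continuous.congr ?_ fun f => (h f).symm
  refine continuous_finsetSum _ fun e _ => ?_
  have h : Continuous (fun f : Discrete (Series 𝕜 E O) => dcomp d (T f)) :=
    continuous_of_discreteTopology
  exact h.comp (continuous_dcomp e)

/-- The property is an intersection of conditions that one coefficient of `T f` vanish, each closed
for pointwise convergence. It therefore passes from polynomial operators to the completion. -/
theorem isClosed_filtered : IsClosed {T : Op 𝕜 E O | Filtered T} := by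
  have h : {T : Op 𝕜 E O | Filtered T} = ⋂ (d : ℕ) (f : Series 𝕜 E O)
      (_ : ∀ m : Mono E O, m.deg ≤ d → f.coeff m = 0) (m : Mono E O) (_ : m.deg ≤ d),
      {T | (T f).coeff m = 0} := by
    ext T
    simp [Filtered]
  rw [h]
  refine isClosed_iInter fun d => isClosed_iInter fun f => isClosed_iInter fun _ =>
    isClosed_iInter fun m => isClosed_iInter fun _ => ?_
  exact (isClosed_coeff_eq_zero m).preimage (continuous_eval f)

/-- A derivative lowers the degree by 1, but the factor ħ raises it by 2, so every generator raises
the degree. -/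
theorem filtered_of_mem_weylHat [LinearOrder O] {T : Op 𝕜 E O} (hT : T ∈ weylHat 𝕜 E O) :
    Filtered T := by
  refine closure_minimal (s := (weyl 𝕜 E O : Set (Op 𝕜 E O))) ?_ isClosed_filtered hT
  intro T hT
  have hx : ∀ i, (hbar * dX i : Op 𝕜 E O).Filtered := by
    intro i d f hf m hm
    simp only [hbar, dX, pull, Module.End.mul_apply, LinearMap.coe_mk, AddHom.coe_mk]
    by_cases h : m.h = 0
    · simp [h]
    · rw [hf]
      · simp
      · have := sum_add_single m.x i
        simp only [Mono.deg] at hm ⊢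
        omega
  have hθ : ∀ i, (hbar * dθ i : Op 𝕜 E O).Filtered := by
    intro i d f hf m hm
    simp only [hbar, dθ, pull, Module.End.mul_apply, LinearMap.coe_mk, AddHom.coe_mk]
    by_cases h : m.h = 0
    · simp [h]
    · rw [hf]
      · simp
      · have := Finset.card_insert_le i m.θ
        simp only [Mono.deg] at hm ⊢
        omega
  induction hT using Algebra.adjoin_induction with
  | mem T h =>
    rcases h with (((rfl | ⟨i, rfl⟩) | ⟨i, rfl⟩) | ⟨j, rfl⟩) | ⟨j, rfl⟩
    · intro d f hf m hm
      simp only [hbar, pull, LinearMap.coe_mk, AddHom.coe_mk]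
      rw [hf _ (by simp only [Mono.deg] at hm ⊢; omega), mul_zero]
    · intro d f hf m hm
      simp only [mulX, pull, LinearMap.coe_mk, AddHom.coe_mk]
      by_cases h : m.x i = 0
      · simp [h]
      · have h2 := sum_add_single (m.x - Finsupp.single i 1) i
        rw [sub_single_add h] at h2
        rw [hf _ (by simp only [Mono.deg] at hm ⊢; omega), mul_zero]
    · exact hx i
    · intro d f hf m hm
      simp only [mulθ, pull, LinearMap.coe_mk, AddHom.coe_mk]
      have := Finset.card_erase_le (s := m.θ) (a := j)
      rw [hf _ (by simp only [Mono.deg] at hm ⊢; omega), mul_zero]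
    · exact hθ j
  | algebraMap r =>
    intro d f hf m hm
    simp [Algebra.algebraMap_eq_smul_one, hf m hm]
  | add S T _ _ hS hT =>
    intro d f hf m hm
    simp [hS d f hf m hm, hT d f hf m hm]
  | mul S T _ _ hS hT => exact fun d f hf => hS d _ (hT d f hf)

/-- A filtered operator which kills all monomials vanishes. -/
theorem Filtered.eq_zero {T : Op 𝕜 E O} (hT : Filtered T) (h : ∀ μ, T (mono μ) = 0) : T = 0 := by
  ext f m
  have h' : ∀ e, T (comp e f) = 0 := fun e =>
    (Submodule.span_le (p := LinearMap.ker T)).2 (by rintro _ ⟨μ, rfl⟩; exact h μ)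
      (comp_mem_span e f)
  rw [hT.coeff_eq f le_rfl, map_sum]
  simp [h']

/-- The component of degree `d` of `A i f` only sees the truncation of `f` through degree `d`, and
this is a finite combination of monomials. -/
theorem LocFin.of_mono {ι : Type*} {A : ι → Op 𝕜 E O} (hA : ∀ i, Filtered (A i))
    (h : ∀ μ, {i | A i (mono μ) ≠ 0}.Finite) : LocFin A := by
  have h1 : ∀ g ∈ Submodule.span 𝕜 (Set.range (mono : Mono E O → Series 𝕜 E O)),
      {i | A i g ≠ 0}.Finite := by
    intro g hg
    induction hg using Submodule.span_induction with
    | mem g hg => obtain ⟨μ, rfl⟩ := hg; exact h μ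
    | zero => simp
    | add f g _ _ hf hg =>
      refine (hf.union hg).subset fun i hi => ?_
      by_contra hc
      simp only [Set.mem_union, Set.mem_ofPred_eq, not_or, not_not] at hc
      exact hi (by simp [hc.1, hc.2])
    | smul c f _ hf => exact hf.subset fun i hi h0 => hi (by simp [h0])
  intro f d
  refine (h1 (∑ e ∈ Finset.range (d + 1), comp e f)
    (Submodule.sum_mem _ fun e _ => comp_mem_span e f)).subset fun i hi h0 => hi ?_
  rw [comp_eq_zero_iff]
  intro m hm
  rw [(hA i).coeff_eq f hm.le, h0, coeff_zero]

end Op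

end

/-! ## Canonical commutation relations and parity -/

section

open Series

variable {E O : Type*} {𝕜 : Type*} [Field 𝕜]

namespace Op

/-! ### Relations among ħ, the even variables and parity. -/

section Even

theorem coeff_hbar (f : Series 𝕜 E O) (m : Mono E O) :
    (hbar f).coeff m = if m.h = 0 then 0 else f.coeff { m with h := m.h - 1 } := by
  simp [hbar, pull]

theorem coeff_mulX (i : E) (f : Series 𝕜 E O) (m : Mono E O) : (mulX i f).coeff m =
    if m.x i = 0 then 0 else f.coeff { m with x := m.x - Finsupp.single i 1 } := by
  simp [mulX, pull]

theorem coeff_dX (i : E) (f : Series 𝕜 E O) (m : Mono E O) : (dX i f).coeff m =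
    (m.x i + 1) * f.coeff { m with x := m.x + Finsupp.single i 1 } := rfl

theorem coeff_parity (f : Series 𝕜 E O) (m : Mono E O) :
    (parity f).coeff m = (-1) ^ m.θ.card * f.coeff m := rfl

theorem hbar_mul_mulX (i : E) : (hbar * mulX i : Op 𝕜 E O) = mulX i * hbar := by
  ext f m
  simp only [Module.End.mul_apply, coeff_hbar, coeff_mulX]
  split_ifs <;> rfl

theorem hbar_mul_dX (i : E) : (hbar * dX i : Op 𝕜 E O) = dX i * hbar := by
  ext f m
  simp only [Module.End.mul_apply, coeff_hbar, coeff_dX]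
  split_ifs <;> simp

theorem parity_mul_parity : (parity * parity : Op 𝕜 E O) = 1 := by
  ext f m
  simp [coeff_parity, ← mul_assoc, ← pow_add, ← two_mul]

theorem parity_mul_hbar : (parity * hbar : Op 𝕜 E O) = hbar * parity := by
  ext f m
  simp only [Module.End.mul_apply, coeff_hbar, coeff_parity]
  split_ifs <;> simp

theorem parity_mul_mulX (i : E) : (parity * mulX i : Op 𝕜 E O) = mulX i * parity := by
  ext f m
  simp only [Module.End.mul_apply, coeff_mulX, coeff_parity]
  split_ifs <;> simp

theorem parity_mul_dX (i : E) : (parity * dX i : Op 𝕜 E O) = dX i * parity := by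
  ext f m
  simp only [Module.End.mul_apply, coeff_dX, coeff_parity]
  ring

theorem mulX_mul_mulX (i j : E) : (mulX i * mulX j : Op 𝕜 E O) = mulX j * mulX i := by
  classical
  rcases eq_or_ne i j with rfl | hij
  · rfl
  ext f m
  simp only [Module.End.mul_apply, coeff_mulX, Finsupp.tsub_apply, Finsupp.single_apply, hij,
    hij.symm, if_false, Nat.sub_zero]
  rw [tsub_right_comm]
  split_ifs <;> rfl

theorem dX_mul_dX (i j : E) : (dX i * dX j : Op 𝕜 E O) = dX j * dX i := by
  classical
  rcases eq_or_ne i j with rfl | hij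
  · rfl
  ext f m
  simp only [Module.End.mul_apply, coeff_dX, Finsupp.add_apply, Finsupp.single_apply, hij,
    hij.symm, if_false, Nat.add_zero]
  rw [add_right_comm]
  ring

theorem dX_mul_mulX_self (i : E) : (dX i * mulX i : Op 𝕜 E O) = mulX i * dX i + 1 := by
  classical
  ext f m
  simp only [Module.End.mul_apply, LinearMap.add_apply, coeff_add, coeff_dX, coeff_mulX,
    Finsupp.add_apply, Finsupp.single_eq_same, Finsupp.tsub_apply, Module.End.one_apply]
  rw [add_tsub_cancel_right, if_neg (Nat.succ_ne_zero _)]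
  split_ifs with h2
  · simp [h2]
  · rw [sub_single_add h2]
    have : ((m.x i - 1 : ℕ) : 𝕜) + 1 = m.x i := by
      exact_mod_cast congrArg (Nat.cast (R := 𝕜)) (Nat.succ_pred h2)
    rw [this]
    ring

theorem dX_mul_mulX {i j : E} (hij : i ≠ j) : (dX i * mulX j : Op 𝕜 E O) = mulX j * dX i := by
  classical
  ext f m
  simp only [Module.End.mul_apply, coeff_dX, coeff_mulX,
    Finsupp.add_apply, Finsupp.single_apply, Finsupp.tsub_apply, hij, hij.symm, if_false,
    Nat.add_zero, Nat.sub_zero]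
  split_ifs with h
  · simp
  · congr 3
    ext k
    simp only [Finsupp.tsub_apply, Finsupp.add_apply, Finsupp.single_apply]
    split_ifs with h1 h2
    · exact absurd (h1.trans h2.symm) hij
    all_goals omega

end Even

/-! ### Relations involving the odd variables, with their signs. -/

section Odd

variable [LinearOrder O]

theorem sign_mul_sign (j : O) (S : Finset O) : (sign j S * sign j S : 𝕜) = 1 := by
  simp [sign, ← pow_add, ← two_mul]

theorem sign_insert {i j : O} {S : Finset O} (hi : i ∉ S) :
    (sign j (insert i S) : 𝕜) = if i < j then -sign j S else sign j S := by
  unfold sign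
  rw [Finset.filter_insert]
  split_ifs
  · rw [Finset.card_insert_of_notMem (by simp [hi]), pow_succ, mul_neg_one]
  · rfl

theorem sign_erase {i j : O} {S : Finset O} (hi : i ∈ S) :
    (sign j (S.erase i) : 𝕜) = if i < j then -sign j S else sign j S := by
  conv_rhs => rw [← Finset.insert_erase hi, sign_insert (Finset.notMem_erase i S)]
  split_ifs <;> simp

theorem coeff_mulθ (j : O) (f : Series 𝕜 E O) (m : Mono E O) : (mulθ j f).coeff m =
    if j ∈ m.θ then sign j m.θ * f.coeff { m with θ := m.θ.erase j } else 0 := by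
  simp [mulθ, pull]

theorem coeff_dθ (j : O) (f : Series 𝕜 E O) (m : Mono E O) : (dθ j f).coeff m =
    if j ∈ m.θ then 0 else sign j m.θ * f.coeff { m with θ := insert j m.θ } := by
  simp [dθ, pull]

theorem hbar_mul_mulθ (j : O) : (hbar * mulθ j : Op 𝕜 E O) = mulθ j * hbar := by
  ext f m
  simp only [Module.End.mul_apply, coeff_hbar, coeff_mulθ]
  split_ifs <;> simp

theorem hbar_mul_dθ (j : O) : (hbar * dθ j : Op 𝕜 E O) = dθ j * hbar := by
  ext f m
  simp only [Module.End.mul_apply, coeff_hbar, coeff_dθ]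
  split_ifs <;> simp

theorem mulX_mul_mulθ (i : E) (j : O) : (mulX i * mulθ j : Op 𝕜 E O) = mulθ j * mulX i := by
  ext f m
  simp only [Module.End.mul_apply, coeff_mulX, coeff_mulθ]
  split_ifs <;> simp

theorem mulX_mul_dθ (i : E) (j : O) : (mulX i * dθ j : Op 𝕜 E O) = dθ j * mulX i := by
  ext f m
  simp only [Module.End.mul_apply, coeff_mulX, coeff_dθ]
  split_ifs <;> simp

theorem dX_mul_mulθ (i : E) (j : O) : (dX i * mulθ j : Op 𝕜 E O) = mulθ j * dX i := by
  ext f m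
  simp only [Module.End.mul_apply, coeff_dX, coeff_mulθ]
  split_ifs
  · ring
  · simp

theorem dX_mul_dθ (i : E) (j : O) : (dX i * dθ j : Op 𝕜 E O) = dθ j * dX i := by
  ext f m
  simp only [Module.End.mul_apply, coeff_dX, coeff_dθ]
  split_ifs
  · simp
  · ring

theorem parity_mul_mulθ (j : O) : (parity * mulθ j : Op 𝕜 E O) = -(mulθ j * parity) := by
  ext f m
  simp only [Module.End.mul_apply, LinearMap.neg_apply, coeff_neg, coeff_mulθ, coeff_parity]
  split_ifs with h
  · rw [← Finset.card_erase_add_one h, pow_succ]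
    ring
  · simp

theorem parity_mul_dθ (j : O) : (parity * dθ j : Op 𝕜 E O) = -(dθ j * parity) := by
  ext f m
  simp only [Module.End.mul_apply, LinearMap.neg_apply, coeff_neg, coeff_dθ, coeff_parity]
  split_ifs with h
  · simp
  · rw [Finset.card_insert_of_notMem h, pow_succ]
    ring

theorem mulθ_mul_mulθ (i j : O) : (mulθ i * mulθ j : Op 𝕜 E O) = -(mulθ j * mulθ i) := by
  ext f m
  simp only [Module.End.mul_apply, LinearMap.neg_apply, coeff_neg, coeff_mulθ,
    Finset.mem_erase]
  rcases eq_or_ne i j with rfl | hij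
  · simp
  by_cases hi : i ∈ m.θ <;> by_cases hj : j ∈ m.θ <;> simp only [hi, hj, hij, hij.symm, if_true,
    if_false, sign_erase, ne_eq, not_false_eq_true, and_true, and_false, mul_zero, neg_zero]
  rw [Finset.erase_right_comm]
  -- Removing one of the two indices flips the sign of the other exactly when the removed index is
  -- the smaller. The two orders of removal thus differ by one sign.
  rcases lt_or_gt_of_ne hij with h | h <;> simp only [h, h.not_gt, if_true, if_false] <;> ring

theorem dθ_mul_dθ (i j : O) : (dθ i * dθ j : Op 𝕜 E O) = -(dθ j * dθ i) := by
  ext f m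
  simp only [Module.End.mul_apply, LinearMap.neg_apply, coeff_neg, coeff_dθ,
    Finset.mem_insert]
  rcases eq_or_ne i j with rfl | hij
  · simp
  by_cases hi : i ∈ m.θ <;> by_cases hj : j ∈ m.θ <;> simp only [hi, hj, hij, hij.symm, if_true,
    if_false, sign_insert, or_true, or_false, mul_zero, neg_zero, not_false_eq_true]
  rw [Finset.insert_comm]
  rcases lt_or_gt_of_ne hij with h | h <;> simp only [h, h.not_gt, if_true, if_false] <;> ring

theorem dθ_mul_mulθ_self (i : O) : (dθ i * mulθ i : Op 𝕜 E O) = -(mulθ i * dθ i) + 1 := by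
  ext f m
  simp only [Module.End.mul_apply, LinearMap.neg_apply, LinearMap.add_apply, coeff_add, coeff_neg,
    coeff_dθ, coeff_mulθ, Finset.mem_insert, Finset.mem_erase, Module.End.one_apply]
  by_cases hi : i ∈ m.θ
  · simp [hi, sign_erase, ← mul_assoc, sign_mul_sign]
  · simp [hi, sign_insert, ← mul_assoc, sign_mul_sign]

theorem dθ_mul_mulθ {i j : O} (hij : i ≠ j) :
    (dθ i * mulθ j : Op 𝕜 E O) = -(mulθ j * dθ i) := by
  ext f m
  simp only [Module.End.mul_apply, LinearMap.neg_apply, coeff_neg,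
    coeff_dθ, coeff_mulθ, Finset.mem_insert, Finset.mem_erase]
  by_cases hi : i ∈ m.θ <;> by_cases hj : j ∈ m.θ <;> simp only [hi, hj, hij, hij.symm, if_true,
    if_false, sign_insert, sign_erase, or_true, or_false, mul_zero, neg_zero, not_false_eq_true,
    and_true, and_false, ne_eq]
  rw [Finset.erase_insert_of_ne hij]
  rcases lt_or_gt_of_ne hij with h | h <;> simp only [h, h.not_gt, if_true, if_false] <;> ring

end Odd

/-! ### The parity automorphism and the super-commutator. -/

section Parity

/-- Conjugation with the parity involution. -/
def conj : Op 𝕜 E O →ₐ[𝕜] Op 𝕜 E O where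
  toFun T := parity * T * parity
  map_one' := by simp [parity_mul_parity]
  map_mul' S T := by
    calc parity * (S * T) * parity = parity * S * 1 * T * parity := by noncomm_ring
      _ = _ := by rw [← parity_mul_parity]; noncomm_ring
  map_zero' := by simp
  map_add' S T := by noncomm_ring
  commutes' r := by
    rw [← Algebra.commutes, mul_assoc, parity_mul_parity, mul_one]

theorem conj_apply (T : Op 𝕜 E O) : conj T = parity * T * parity := rfl

@[simp] theorem conj_conj (T : Op 𝕜 E O) : conj (conj T) = T := by
  calc conj (conj T) = (parity * parity) * T * (parity * parity) := by
        simp only [conj_apply]; noncomm_ring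
    _ = T := by rw [parity_mul_parity, one_mul, mul_one]

theorem continuous_conj : Continuous (conj : Op 𝕜 E O → Op 𝕜 E O) :=
  (continuous_mul_right _).comp (continuous_mul_left (continuous_pull _ _ _ _))

/-- Operators of parity `p`: the even ones for `p = false`, the odd ones for `p = true`. -/
def HasParity (p : Bool) (T : Op 𝕜 E O) : Prop := conj T = if p then -T else T

/-- The power of the parity automorphism given by `p`. -/
def twist (p : Bool) : Op 𝕜 E O →ₐ[𝕜] Op 𝕜 E O := if p then conj else AlgHom.id 𝕜 _

@[simp] theorem twist_true : (twist true : Op 𝕜 E O →ₐ[𝕜] Op 𝕜 E O) = conj := rfl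

@[simp] theorem twist_false (T : Op 𝕜 E O) : twist false T = T := rfl

theorem hasParity_false {T : Op 𝕜 E O} : HasParity false T ↔ conj T = T := by simp [HasParity]

theorem hasParity_true {T : Op 𝕜 E O} : HasParity true T ↔ conj T = -T := by simp [HasParity]

theorem hasParity_false_of_comm {T : Op 𝕜 E O} (h : parity * T = T * parity) :
    HasParity false T := by
  rw [hasParity_false, conj_apply, h, mul_assoc, parity_mul_parity, mul_one]

theorem hasParity_true_of_anticomm {T : Op 𝕜 E O} (h : parity * T = -(T * parity)) :
    HasParity true T := by
  rw [hasParity_true, conj_apply, h, neg_mul, mul_assoc, parity_mul_parity, mul_one]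

theorem hasParity_hbar : HasParity false (hbar : Op 𝕜 E O) :=
  hasParity_false_of_comm parity_mul_hbar

theorem hasParity_mulX (i : E) : HasParity false (mulX i : Op 𝕜 E O) :=
  hasParity_false_of_comm (parity_mul_mulX i)

theorem hasParity_dX (i : E) : HasParity false (dX i : Op 𝕜 E O) :=
  hasParity_false_of_comm (parity_mul_dX i)

theorem HasParity.mul {p q : Bool} {S T : Op 𝕜 E O} (hS : HasParity p S) (hT : HasParity q T) :
    HasParity (p ^^ q) (S * T) := by
  unfold HasParity at *
  rw [map_mul, hS, hT]
  cases p <;> cases q <;> simp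

theorem HasParity.add {p : Bool} {S T : Op 𝕜 E O} (hS : HasParity p S) (hT : HasParity p T) :
    HasParity p (S + T) := by
  unfold HasParity at *
  rw [map_add, hS, hT]
  cases p
  · simp
  · simp [add_comm]

theorem HasParity.smul {p : Bool} {T : Op 𝕜 E O} (hT : HasParity p T) (c : 𝕜) :
    HasParity p (c • T) := by
  unfold HasParity at *
  rw [map_smul, hT]
  cases p <;> simp

theorem HasParity.neg {p : Bool} {T : Op 𝕜 E O} (hT : HasParity p T) :
    HasParity p (-T) := by
  simpa using hT.smul (-1)

theorem hasParity_zero (p : Bool) : HasParity p (0 : Op 𝕜 E O) := by simp [HasParity]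

/-- Conjugation by the parity involution is continuous, so it may be applied term by term. -/
theorem hasParity_of_hasSum {ι : Type*} {p : Bool} {A : ι → Op 𝕜 E O} {T : Op 𝕜 E O}
    (hT : HasSum A T) (hA : ∀ i, HasParity p (A i)) : HasParity p T := by
  have h := hT.map (conj : Op 𝕜 E O →ₐ[𝕜] Op 𝕜 E O) continuous_conj
  have hA' : ⇑(conj : Op 𝕜 E O →ₐ[𝕜] Op 𝕜 E O) ∘ A = fun i => if p then -A i else A i :=
    funext hA
  rw [hA'] at h
  refine h.unique ?_
  cases p
  · exact hT
  · exact hT.neg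

section Odd

variable [LinearOrder O]

theorem hasParity_mulθ (j : O) : HasParity true (mulθ j : Op 𝕜 E O) :=
  hasParity_true_of_anticomm (parity_mul_mulθ j)

theorem hasParity_dθ (j : O) : HasParity true (dθ j : Op 𝕜 E O) :=
  hasParity_true_of_anticomm (parity_mul_dθ j)

end Odd

theorem scomm_add_left (S S' T : Op 𝕜 E O) : scomm (S + S') T = scomm S T + scomm S' T := by
  simp only [scomm, evenPart, oddPart, mul_add, add_mul, smul_add, smul_sub, mul_sub, sub_mul]
  abel

theorem scomm_add_right (S T T' : Op 𝕜 E O) : scomm S (T + T') = scomm S T + scomm S T' := by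
  simp only [scomm, evenPart, oddPart, mul_add, add_mul, smul_add, smul_sub, mul_sub, sub_mul]
  abel

theorem scomm_zero_left (T : Op 𝕜 E O) : scomm 0 T = 0 := by
  simp [scomm, evenPart, oddPart]

theorem scomm_zero_right (T : Op 𝕜 E O) : scomm T 0 = 0 := by
  simp [scomm, evenPart, oddPart]

theorem hasParity_evenPart (T : Op 𝕜 E O) : HasParity false (evenPart T) := by
  rw [hasParity_false, evenPart, ← conj_apply, map_smul, map_add, conj_conj, add_comm]

theorem hasParity_oddPart (T : Op 𝕜 E O) : HasParity true (oddPart T) := by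
  rw [hasParity_true, oddPart, ← conj_apply, map_smul, map_sub, conj_conj, ← smul_neg, neg_sub]

variable [CharZero 𝕜]

theorem evenPart_add_oddPart (T : Op 𝕜 E O) : evenPart T + oddPart T = T := by
  rw [evenPart, oddPart, ← smul_add]
  have : T + parity * T * parity + (T - parity * T * parity) = (2 : 𝕜) • T := by
    rw [two_smul]; abel
  rw [this, smul_smul, inv_mul_cancel₀ two_ne_zero, one_smul]

theorem evenPart_sub_oddPart (T : Op 𝕜 E O) : evenPart T - oddPart T = conj T := by
  rw [evenPart, oddPart, ← smul_sub]
  have : T + parity * T * parity - (T - parity * T * parity) = (2 : 𝕜) • conj T := by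
    rw [two_smul, conj_apply]; abel
  rw [this, smul_smul, inv_mul_cancel₀ two_ne_zero, one_smul]

theorem hasParity_false_iff {T : Op 𝕜 E O} : HasParity false T ↔ IsEven T := by
  rw [hasParity_false, IsEven, oddPart, ← conj_apply]
  rw [smul_eq_zero_iff_right (inv_ne_zero two_ne_zero), sub_eq_zero, eq_comm]

theorem hasParity_true_iff {T : Op 𝕜 E O} : HasParity true T ↔ IsOdd T := by
  rw [hasParity_true, IsOdd, evenPart, ← conj_apply]
  rw [smul_eq_zero_iff_right (inv_ne_zero two_ne_zero), add_eq_zero_iff_neg_eq, eq_comm]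

/-- Conjugation by parity turns S₀ + S₁ into S₀ - S₁, which is the sign rule against an odd
operator. The four-term definition thus collapses to a twisted commutator, for which the Leibniz
rules are formal. -/
theorem scomm_right {p : Bool} {T : Op 𝕜 E O} (hT : HasParity p T) (S : Op 𝕜 E O) :
    scomm S T = S * T - T * twist p S := by
  cases p
  · have h1 : oddPart T = 0 := hasParity_false_iff.1 hT
    have h2 : evenPart T = T := by simpa [h1] using evenPart_add_oddPart T
    conv_rhs => rw [twist_false, ← evenPart_add_oddPart S]
    rw [scomm, h1, h2]
    noncomm_ring
  · have h1 : evenPart T = 0 := hasParity_true_iff.1 hT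
    have h2 : oddPart T = T := by simpa [h1] using evenPart_add_oddPart T
    have h3 : S * T = (evenPart S + oddPart S) * T := by rw [evenPart_add_oddPart]
    rw [twist_true, ← evenPart_sub_oddPart S, h3, scomm, h1, h2]
    noncomm_ring

theorem scomm_left {p : Bool} {S : Op 𝕜 E O} (hS : HasParity p S) (T : Op 𝕜 E O) :
    scomm S T = S * T - twist p T * S := by
  cases p
  · have h1 : oddPart S = 0 := hasParity_false_iff.1 hS
    have h2 : evenPart S = S := by simpa [h1] using evenPart_add_oddPart S
    conv_rhs => rw [twist_false, ← evenPart_add_oddPart T]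
    rw [scomm, h1, h2]
    noncomm_ring
  · have h1 : evenPart S = 0 := hasParity_true_iff.1 hS
    have h2 : oddPart S = S := by simpa [h1] using evenPart_add_oddPart S
    have h3 : S * T = S * (evenPart T + oddPart T) := by rw [evenPart_add_oddPart]
    rw [twist_true, ← evenPart_sub_oddPart T, h3, scomm, h1, h2]
    noncomm_ring

theorem scomm_even_left {S : Op 𝕜 E O} (hS : HasParity false S) (T : Op 𝕜 E O) :
    scomm S T = S * T - T * S := scomm_left hS T

theorem scomm_even_right {T : Op 𝕜 E O} (hT : HasParity false T) (S : Op 𝕜 E O) :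
    scomm S T = S * T - T * S := scomm_right hT S

theorem scomm_odd {S T : Op 𝕜 E O} (hS : HasParity true S) (hT : HasParity true T) :
    scomm S T = S * T + T * S := by
  rw [scomm_left hS, twist_true, hasParity_true.1 hT, neg_mul, sub_neg_eq_add]

end Parity

end Op

end

/-! ## Super-commutators in the Weyl algebra -/

section

open Series

variable {E O : Type*} {𝕜 : Type*} [Field 𝕜]

namespace Op

/-- Division by `ħ`, a left inverse of multiplication by `ħ`. -/
def hdiv : Op 𝕜 E O :=
  pull (fun _ => 1) (fun m => { m with h := m.h + 1 })
    (by
      intro m _ m' _ h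
      simp only [Mono.mk.injEq, add_left_inj] at h
      exact Mono.ext h.1 h.2.1 h.2.2)
    (fun d => ⟨d + 2, fun m _ hd => by
      simp only [Mono.deg] at hd ⊢
      omega⟩)

theorem coeff_hdiv (f : Series 𝕜 E O) (m : Mono E O) :
    (hdiv f).coeff m = f.coeff { m with h := m.h + 1 } := by simp [hdiv, pull]

theorem hdiv_mul_hbar : (hdiv * hbar : Op 𝕜 E O) = 1 := by
  ext f m
  simp [coeff_hdiv, coeff_hbar]

theorem hbar_mul_cancel {S T : Op 𝕜 E O} (h : hbar * S = hbar * T) : S = T := by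
  rw [← one_mul S, ← one_mul T, ← hdiv_mul_hbar, mul_assoc, h, mul_assoc]

/-- Divisibility by `ħ` is a closed condition. -/
theorem isClosed_hbar_mul_hdiv : IsClosed {T : Op 𝕜 E O | hbar * (hdiv * T) = T} :=
  isClosed_eq ((continuous_mul_left (continuous_pull _ _ _ _)).comp
    (continuous_mul_left (continuous_pull _ _ _ _))) continuous_id

/-- The `ħ`-multiples of a closed set of operators form a closed set. -/
theorem isClosed_hbar_mul {K : Set (Op 𝕜 E O)} (hK : IsClosed K) :
    IsClosed {T : Op 𝕜 E O | ∃ U ∈ K, T = hbar * U} := by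
  -- An operator is ħ times an element of `K` exactly when dividing by ħ and multiplying back loses
  -- nothing and the quotient lies in `K`. Both conditions are closed.
  have h : {T : Op 𝕜 E O | ∃ U ∈ K, T = hbar * U} =
      {T | hbar * (hdiv * T) = T} ∩ (fun T => hdiv * T) ⁻¹' K := by
    ext T
    constructor
    · rintro ⟨U, hU, rfl⟩
      have : hdiv * (hbar * U) = U := by rw [← mul_assoc, hdiv_mul_hbar, one_mul]
      exact ⟨by rw [Set.mem_ofPred_eq, this], by rwa [Set.mem_preimage, this]⟩
    · rintro ⟨h1, h2⟩
      exact ⟨_, h2, h1.symm⟩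
  rw [h]
  exact isClosed_hbar_mul_hdiv.inter
    (hK.preimage (continuous_mul_left (continuous_pull _ _ _ _)))

theorem continuous_evenPart : Continuous (evenPart : Op 𝕜 E O → Op 𝕜 E O) := by
  have h : Continuous fun S : Op 𝕜 E O => S + conj S := continuous_id.add continuous_conj
  exact (continuous_const_smul (2⁻¹ : 𝕜)).comp h

theorem continuous_oddPart : Continuous (oddPart : Op 𝕜 E O → Op 𝕜 E O) := by
  have h : Continuous fun S : Op 𝕜 E O => S - conj S := continuous_id.sub continuous_conj
  exact (continuous_const_smul (2⁻¹ : 𝕜)).comp h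

theorem continuous_scomm_left {T : Op 𝕜 E O} (hT : Continuous T) :
    Continuous fun S : Op 𝕜 E O => scomm S T := by
  have hp : Continuous (parity : Op 𝕜 E O) := continuous_pull _ _ _ _
  have hc : Continuous (conj T) := hp.comp (hT.comp hp)
  have h1 : Continuous (evenPart T) := (hT.add hc).const_smul _
  have h2 : Continuous (oddPart T) := (hT.sub hc).const_smul _
  have h3 : Continuous fun S : Op 𝕜 E O => evenPart S := continuous_evenPart
  have h4 : Continuous fun S : Op 𝕜 E O => oddPart S := continuous_oddPart
  have l : ∀ {A : Op 𝕜 E O}, Continuous A → ∀ {u : Op 𝕜 E O → Op 𝕜 E O}, Continuous u →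
    Continuous fun S => A * u S := fun hA _ hu => (continuous_mul_left hA).comp hu
  have r : ∀ {A : Op 𝕜 E O} {u : Op 𝕜 E O → Op 𝕜 E O}, Continuous u →
    Continuous fun S => u S * A := fun hu => (continuous_mul_right _).comp hu
  exact ((((r h3).sub (l h1 h3)).add ((r h3).sub (l h2 h3))).add ((r h4).sub (l h1 h4))).add
    ((r h4).add (l h2 h4))

theorem continuous_scomm_right {S : Op 𝕜 E O} (hS : Continuous S) :
    Continuous fun T : Op 𝕜 E O => scomm S T := by
  have hp : Continuous (parity : Op 𝕜 E O) := continuous_pull _ _ _ _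
  have hc : Continuous (conj S) := hp.comp (hS.comp hp)
  have h1 : Continuous (evenPart S) := (hS.add hc).const_smul _
  have h2 : Continuous (oddPart S) := (hS.sub hc).const_smul _
  have h3 : Continuous fun S : Op 𝕜 E O => evenPart S := continuous_evenPart
  have h4 : Continuous fun S : Op 𝕜 E O => oddPart S := continuous_oddPart
  have l : ∀ {A : Op 𝕜 E O}, Continuous A → ∀ {u : Op 𝕜 E O → Op 𝕜 E O}, Continuous u →
    Continuous fun S => A * u S := fun hA _ hu => (continuous_mul_left hA).comp hu
  have r : ∀ {A : Op 𝕜 E O} {u : Op 𝕜 E O → Op 𝕜 E O}, Continuous u →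
    Continuous fun S => u S * A := fun hu => (continuous_mul_right _).comp hu
  exact ((((l h1 h3).sub (r h3)).add ((l h1 h4).sub (r h4))).add ((l h2 h3).sub (r h3))).add
    ((l h2 h4).add (r h4))

/-! ### Leibniz rules for the super-commutator. -/

section Derivation

variable [CharZero 𝕜]

/-- The twist is an algebra homomorphism, so a twisted commutator with a homogeneous operator is a
twisted derivation. -/
theorem scomm_mul_right {p : Bool} {S : Op 𝕜 E O} (hS : HasParity p S) (T T' : Op 𝕜 E O) :
    scomm S (T * T') = scomm S T * T' + twist p T * scomm S T' := by
  simp only [scomm_left hS, map_mul]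
  noncomm_ring

theorem scomm_mul_left {p : Bool} {T : Op 𝕜 E O} (hT : HasParity p T) (S S' : Op 𝕜 E O) :
    scomm (S * S') T = S * scomm S' T + scomm S T * twist p S' := by
  simp only [scomm_right hT, map_mul]
  noncomm_ring

theorem scomm_algebraMap_right (S : Op 𝕜 E O) (r : 𝕜) : scomm S (algebraMap 𝕜 _ r) = 0 := by
  have h : HasParity false (algebraMap 𝕜 (Op 𝕜 E O) r) :=
    hasParity_false.2 (AlgHom.commutes _ r)
  rw [scomm_even_right h, Algebra.commutes, sub_self]

theorem scomm_algebraMap_left (S : Op 𝕜 E O) (r : 𝕜) : scomm (algebraMap 𝕜 _ r) S = 0 := by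
  have h : HasParity false (algebraMap 𝕜 (Op 𝕜 E O) r) :=
    hasParity_false.2 (AlgHom.commutes _ r)
  rw [scomm_even_left h, Algebra.commutes, sub_self]

theorem scomm_eq_zero_of_commute_left {S T : Op 𝕜 E O} (h : Commute S T) (hS : HasParity false S) :
    scomm S T = 0 := by rw [scomm_even_left hS, h.eq, sub_self]

theorem scomm_eq_zero_of_commute_right {S T : Op 𝕜 E O} (h : Commute S T) (hT : HasParity false T) :
    scomm S T = 0 := by rw [scomm_even_right hT, h.eq, sub_self]

end Derivation

/-! ### Heisenberg relations between the Weyl generators. -/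

section Relations

theorem commute_hbar_mulX (i : E) : Commute (hbar : Op 𝕜 E O) (mulX i) := hbar_mul_mulX i

theorem commute_hbar_dX (i : E) : Commute (hbar : Op 𝕜 E O) (dX i) := hbar_mul_dX i

theorem commute_hbar_hdX (i : E) : Commute (hbar : Op 𝕜 E O) (hbar * dX i) :=
  (Commute.refl _).mul_right (commute_hbar_dX i)

theorem commute_hdX_hdX (i j : E) : Commute (hbar * dX i : Op 𝕜 E O) (hbar * dX j) :=
  ((Commute.refl _).mul_right (commute_hbar_dX j)).mul_left
    ((commute_hbar_dX i).symm.mul_right (dX_mul_dX i j))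

open Classical in
theorem hdX_mul_mulX (i j : E) : (hbar * dX i * mulX j : Op 𝕜 E O) =
    mulX j * (hbar * dX i) + if i = j then hbar else 0 := by
  rw [mul_assoc]
  split_ifs with h
  · subst h
    rw [dX_mul_mulX_self, mul_add, mul_one, ← mul_assoc, hbar_mul_mulX, mul_assoc]
  · rw [dX_mul_mulX h, ← mul_assoc, hbar_mul_mulX, mul_assoc, add_zero]

theorem hasParity_hdX (i : E) : HasParity false (hbar * dX i : Op 𝕜 E O) :=
  hasParity_hbar.mul (hasParity_dX i)

variable [LinearOrder O]

theorem commute_hbar_mulθ (j : O) : Commute (hbar : Op 𝕜 E O) (mulθ j) := hbar_mul_mulθ j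

theorem commute_hbar_dθ (j : O) : Commute (hbar : Op 𝕜 E O) (dθ j) := hbar_mul_dθ j

theorem commute_hbar_hdθ (j : O) : Commute (hbar : Op 𝕜 E O) (hbar * dθ j) :=
  (Commute.refl _).mul_right (commute_hbar_dθ j)

theorem commute_mulX_hdθ (i : E) (j : O) : Commute (mulX i : Op 𝕜 E O) (hbar * dθ j) :=
  (commute_hbar_mulX i).symm.mul_right (mulX_mul_dθ i j)

theorem commute_hdX_mulθ (i : E) (j : O) : Commute (hbar * dX i : Op 𝕜 E O) (mulθ j) :=
  (commute_hbar_mulθ j).mul_left (dX_mul_mulθ i j)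

theorem commute_hdX_hdθ (i : E) (j : O) : Commute (hbar * dX i : Op 𝕜 E O) (hbar * dθ j) :=
  ((Commute.refl _).mul_right (commute_hbar_dθ j)).mul_left
    ((commute_hbar_dX i).symm.mul_right (dX_mul_dθ i j))

theorem hdθ_mul_hdθ (i j : O) : (hbar * dθ i * (hbar * dθ j) : Op 𝕜 E O) =
    -(hbar * dθ j * (hbar * dθ i)) := by
  have h : ∀ i j : O, (hbar * dθ i * (hbar * dθ j) : Op 𝕜 E O) = hbar * hbar * (dθ i * dθ j) := by
    intro i j
    rw [mul_assoc, ← mul_assoc (dθ i), ← hbar_mul_dθ]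
    simp only [mul_assoc]
  rw [h, h, dθ_mul_dθ, mul_neg]

theorem hdθ_mul_mulθ (i j : O) : (hbar * dθ i * mulθ j : Op 𝕜 E O) =
    -(mulθ j * (hbar * dθ i)) + if i = j then hbar else 0 := by
  rw [mul_assoc]
  split_ifs with h
  · subst h
    rw [dθ_mul_mulθ_self, mul_add, mul_one, mul_neg, ← mul_assoc, hbar_mul_mulθ, mul_assoc]
  · rw [dθ_mul_mulθ h, mul_neg, ← mul_assoc, hbar_mul_mulθ, mul_assoc, add_zero]

theorem hasParity_hdθ (j : O) : HasParity true (hbar * dθ j : Op 𝕜 E O) :=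
  hasParity_hbar.mul (hasParity_dθ j)

end Relations

variable [LinearOrder O]

theorem exists_hasParity_of_mem_weylGenerators {g : Op 𝕜 E O} (hg : g ∈ weylGenerators 𝕜 E O) :
    ∃ p, HasParity p g := by
  rcases hg with (((rfl | ⟨i, rfl⟩) | ⟨i, rfl⟩) | ⟨j, rfl⟩) | ⟨j, rfl⟩
  exacts [⟨_, hasParity_hbar⟩, ⟨_, hasParity_mulX i⟩, ⟨_, hasParity_hdX i⟩, ⟨_, hasParity_mulθ j⟩,
    ⟨_, hasParity_hdθ j⟩]

theorem hbar_mem_weyl : hbar ∈ weyl 𝕜 E O := Algebra.subset_adjoin (by simp [weylGenerators])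

theorem mulX_mem_weyl (i : E) : mulX i ∈ weyl 𝕜 E O :=
  Algebra.subset_adjoin (by simp [weylGenerators])

theorem hdX_mem_weyl (i : E) : hbar * dX i ∈ weyl 𝕜 E O :=
  Algebra.subset_adjoin (by simp [weylGenerators])

theorem mulθ_mem_weyl (j : O) : mulθ j ∈ weyl 𝕜 E O :=
  Algebra.subset_adjoin (by simp [weylGenerators])

theorem hdθ_mem_weyl (j : O) : hbar * dθ j ∈ weyl 𝕜 E O :=
  Algebra.subset_adjoin (by simp [weylGenerators])

theorem weyl_le_weylHat : weyl 𝕜 E O ≤ weylHat 𝕜 E O := fun _ h => subset_closure h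

theorem isClosed_weylHat : IsClosed (weylHat 𝕜 E O : Set (Op 𝕜 E O)) := isClosed_closure

theorem continuous_of_mem_weylHat {T : Op 𝕜 E O} (hT : T ∈ weylHat 𝕜 E O) : Continuous T :=
  (filtered_of_mem_weylHat hT).continuous

theorem mem_weylHat_of_hasSum {ι : Type*} {A : ι → Op 𝕜 E O} {T : Op 𝕜 E O} (hT : HasSum A T)
    (hA : ∀ i, A i ∈ weylHat 𝕜 E O) : T ∈ weylHat 𝕜 E O :=
  isClosed_weylHat.mem_of_tendsto hT (Filter.Eventually.of_forall fun _ => sum_mem fun i _ => hA i)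

theorem commute_hbar_of_mem_weylHat {T : Op 𝕜 E O} (hT : T ∈ weylHat 𝕜 E O) : Commute hbar T := by
  have hc : IsClosed {T : Op 𝕜 E O | hbar * T = T * hbar} :=
    isClosed_eq (continuous_mul_left (continuous_pull _ _ _ _)) (continuous_mul_right _)
  refine closure_minimal (s := (weyl 𝕜 E O : Set (Op 𝕜 E O))) (fun T hT => ?_) hc hT
  change Commute hbar T
  induction hT using Algebra.adjoin_induction with
  | mem g hg =>
    rcases hg with (((rfl | ⟨i, rfl⟩) | ⟨i, rfl⟩) | ⟨j, rfl⟩) | ⟨j, rfl⟩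
    exacts [Commute.refl _, commute_hbar_mulX i, commute_hbar_hdX i, commute_hbar_mulθ j,
      commute_hbar_hdθ j]
  | algebraMap r => exact (Algebra.commutes r _).symm
  | add S T _ _ hS hT => exact hS.add_right hT
  | mul S T _ _ hS hT => exact hS.mul_right hT

theorem conj_mem_weyl {T : Op 𝕜 E O} (hT : T ∈ weyl 𝕜 E O) : conj T ∈ weyl 𝕜 E O := by
  induction hT using Algebra.adjoin_induction with
  | mem g hg =>
    obtain ⟨p, hp⟩ := exists_hasParity_of_mem_weylGenerators hg
    have hg' : g ∈ weyl 𝕜 E O := Algebra.subset_adjoin hg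
    rw [hp]
    split_ifs
    · exact neg_mem hg'
    · exact hg'
  | algebraMap r => rw [AlgHom.commutes]; exact (weyl 𝕜 E O).algebraMap_mem r
  | add S T _ _ hS hT => rw [map_add]; exact add_mem hS hT
  | mul S T _ _ hS hT => rw [map_mul]; exact mul_mem hS hT

theorem conj_mem_weylHat {T : Op 𝕜 E O} (hT : T ∈ weylHat 𝕜 E O) : conj T ∈ weylHat 𝕜 E O :=
  map_mem_closure continuous_conj hT fun _ h => conj_mem_weyl h

theorem twist_mem_weyl (p : Bool) {T : Op 𝕜 E O} (hT : T ∈ weyl 𝕜 E O) :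
    twist p T ∈ weyl 𝕜 E O := by
  cases p
  exacts [hT, conj_mem_weyl hT]

theorem twist_mem_weylHat (p : Bool) {T : Op 𝕜 E O} (hT : T ∈ weylHat 𝕜 E O) :
    twist p T ∈ weylHat 𝕜 E O := by
  cases p
  exacts [hT, conj_mem_weylHat hT]

theorem evenPart_mem_weyl {T : Op 𝕜 E O} (hT : T ∈ weyl 𝕜 E O) : evenPart T ∈ weyl 𝕜 E O :=
  (weyl 𝕜 E O).smul_mem (add_mem hT (conj_mem_weyl hT)) _

theorem oddPart_mem_weyl {T : Op 𝕜 E O} (hT : T ∈ weyl 𝕜 E O) : oddPart T ∈ weyl 𝕜 E O :=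
  (weyl 𝕜 E O).smul_mem (sub_mem hT (conj_mem_weyl hT)) _

variable [CharZero 𝕜]

/-- The super-commutator of two generators is a multiple of `ħ`. -/
theorem exists_scomm_generators {S T : Op 𝕜 E O} (hS : S ∈ weylGenerators 𝕜 E O)
    (hT : T ∈ weylGenerators 𝕜 E O) : ∃ c : 𝕜, scomm S T = c • hbar := by
  classical
  have key : ∀ {X : Op 𝕜 E O}, X = 0 → ∃ c : 𝕜, X = c • hbar := fun h => ⟨0, by rw [h, zero_smul]⟩
  have key' : ∀ (c : 𝕜) (p : Prop) [Decidable p] {X : Op 𝕜 E O},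
      X = c • (if p then hbar else 0) → ∃ c : 𝕜, X = c • hbar := by
    rintro c p _ X rfl
    split_ifs
    · exact ⟨c, rfl⟩
    · exact ⟨0, by simp⟩
  rcases hT with (((rfl | ⟨i, rfl⟩) | ⟨i, rfl⟩) | ⟨i, rfl⟩) | ⟨i, rfl⟩
  · exact key (scomm_eq_zero_of_commute_right (commute_hbar_of_mem_weylHat
      (weyl_le_weylHat (Algebra.subset_adjoin hS))).symm hasParity_hbar)
  all_goals rcases hS with (((rfl | ⟨j, rfl⟩) | ⟨j, rfl⟩) | ⟨j, rfl⟩) | ⟨j, rfl⟩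
  · exact key (scomm_eq_zero_of_commute_left (commute_hbar_mulX i) hasParity_hbar)
  · exact key (scomm_eq_zero_of_commute_left (mulX_mul_mulX j i) (hasParity_mulX j))
  · refine key' 1 (j = i) ?_
    rw [scomm_even_left (hasParity_hdX j), hdX_mul_mulX, one_smul, add_sub_cancel_left]
  · exact key (scomm_eq_zero_of_commute_right (mulX_mul_mulθ i j).symm (hasParity_mulX i))
  · exact key (scomm_eq_zero_of_commute_right (commute_mulX_hdθ i j).symm (hasParity_mulX i))
  · exact key (scomm_eq_zero_of_commute_left (commute_hbar_hdX i) hasParity_hbar)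
  · refine key' (-1) (i = j) ?_
    rw [scomm_even_left (hasParity_mulX j), hdX_mul_mulX, neg_smul, one_smul, sub_add_cancel_left]
  · exact key (scomm_eq_zero_of_commute_left (commute_hdX_hdX j i) (hasParity_hdX j))
  · exact key (scomm_eq_zero_of_commute_right (commute_hdX_mulθ i j).symm (hasParity_hdX i))
  · exact key (scomm_eq_zero_of_commute_right (commute_hdX_hdθ i j).symm (hasParity_hdX i))
  · exact key (scomm_eq_zero_of_commute_left (commute_hbar_mulθ i) hasParity_hbar)
  · exact key (scomm_eq_zero_of_commute_left (mulX_mul_mulθ j i) (hasParity_mulX j))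
  · exact key (scomm_eq_zero_of_commute_left (commute_hdX_mulθ j i) (hasParity_hdX j))
  · refine key ?_
    rw [scomm_odd (hasParity_mulθ j) (hasParity_mulθ i), mulθ_mul_mulθ, neg_add_cancel]
  · refine key' 1 (j = i) ?_
    rw [scomm_odd (hasParity_hdθ j) (hasParity_mulθ i), hdθ_mul_mulθ, one_smul]
    abel
  · exact key (scomm_eq_zero_of_commute_left (commute_hbar_hdθ i) hasParity_hbar)
  · exact key (scomm_eq_zero_of_commute_left (commute_mulX_hdθ j i) (hasParity_mulX j))
  · exact key (scomm_eq_zero_of_commute_left (commute_hdX_hdθ j i) (hasParity_hdX j))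
  · refine key' 1 (i = j) ?_
    rw [scomm_odd (hasParity_mulθ j) (hasParity_hdθ i), hdθ_mul_mulθ, one_smul]
    abel
  · refine key ?_
    rw [scomm_odd (hasParity_hdθ j) (hasParity_hdθ i), hdθ_mul_hdθ, neg_add_cancel]

/-- The Leibniz rules propagate divisibility by ħ from the generators, but each needs one
homogeneous argument. Hence the order: a generator against any `T`, then any `S` against a
homogeneous `T`, and finally `T` split into its even and odd parts. -/
theorem exists_scomm_eq_of_mem_weyl {S T : Op 𝕜 E O} (hS : S ∈ weyl 𝕜 E O)
    (hT : T ∈ weyl 𝕜 E O) : ∃ U ∈ weyl 𝕜 E O, scomm S T = hbar * U := by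
  have hc : ∀ {X : Op 𝕜 E O}, X ∈ weyl 𝕜 E O → X * hbar = hbar * X := fun hX =>
    (commute_hbar_of_mem_weylHat (weyl_le_weylHat hX)).symm
  have hgen : ∀ g ∈ weylGenerators 𝕜 E O, ∀ T ∈ weyl 𝕜 E O,
      ∃ U ∈ weyl 𝕜 E O, scomm g T = hbar * U := by
    intro g hg T hT
    obtain ⟨p, hp⟩ := exists_hasParity_of_mem_weylGenerators hg
    induction hT using Algebra.adjoin_induction with
    | mem T hT =>
      obtain ⟨c, h⟩ := exists_scomm_generators hg hT
      exact ⟨algebraMap 𝕜 _ c, (weyl 𝕜 E O).algebraMap_mem c, by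
        rw [h, Algebra.algebraMap_eq_smul_one, mul_smul_comm, mul_one]⟩
    | algebraMap r => exact ⟨0, zero_mem _, by rw [scomm_algebraMap_right, mul_zero]⟩
    | add T T' _ _ h h' =>
      obtain ⟨U, hU, h⟩ := h
      obtain ⟨U', hU', h'⟩ := h'
      exact ⟨U + U', add_mem hU hU', by rw [scomm_add_right, h, h', mul_add]⟩
    | mul T T' hT hT' h h' =>
      obtain ⟨U, hU, h⟩ := h
      obtain ⟨U', hU', h'⟩ := h'
      refine ⟨U * T' + twist p T * U', add_mem (mul_mem hU hT')
        (mul_mem (twist_mem_weyl p hT) hU'), ?_⟩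
      rw [scomm_mul_right hp, h, h', ← mul_assoc (twist p T), hc (twist_mem_weyl p hT)]
      noncomm_ring
  have hhom : ∀ (p : Bool) {T : Op 𝕜 E O}, HasParity p T → T ∈ weyl 𝕜 E O →
      ∃ U ∈ weyl 𝕜 E O, scomm S T = hbar * U := by
    intro p T hp hT
    induction hS using Algebra.adjoin_induction with
    | mem S hS => exact hgen S hS T hT
    | algebraMap r => exact ⟨0, zero_mem _, by rw [scomm_algebraMap_left, mul_zero]⟩
    | add S S' _ _ h h' =>
      obtain ⟨U, hU, h⟩ := h
      obtain ⟨U', hU', h'⟩ := h'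
      exact ⟨U + U', add_mem hU hU', by rw [scomm_add_left, h, h', mul_add]⟩
    | mul S S' hS hS' h h' =>
      obtain ⟨U, hU, h⟩ := h
      obtain ⟨U', hU', h'⟩ := h'
      refine ⟨S * U' + U * twist p S', add_mem (mul_mem hS hU')
        (mul_mem hU (twist_mem_weyl p hS')), ?_⟩
      rw [scomm_mul_left hp, h, h', ← mul_assoc, hc hS]
      noncomm_ring
  obtain ⟨U, hU, h⟩ := hhom false (hasParity_evenPart T) (evenPart_mem_weyl hT)
  obtain ⟨U', hU', h'⟩ := hhom true (hasParity_oddPart T) (oddPart_mem_weyl hT)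
  exact ⟨U + U', add_mem hU hU', by
    rw [← evenPart_add_oddPart T, scomm_add_right, h, h', mul_add]⟩

/-- Super-commutators in the completed Weyl algebra are divisible by `ħ`. -/
theorem exists_scomm_eq_of_mem_weylHat {S T : Op 𝕜 E O} (hS : S ∈ weylHat 𝕜 E O)
    (hT : T ∈ weylHat 𝕜 E O) : ∃ U ∈ weylHat 𝕜 E O, scomm S T = hbar * U := by
  have hK := isClosed_hbar_mul (isClosed_weylHat (𝕜 := 𝕜) (E := E) (O := O))
  -- Density is used in one variable at a time. First `T` becomes polynomial with `S` fixed, `S`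
  -- being continuous as an element of the completion; then `S` becomes polynomial against the
  -- polynomial `T`.
  refine closure_minimal (s := (weyl 𝕜 E O : Set (Op 𝕜 E O))) (fun T hT => ?_)
    (hK.preimage (continuous_scomm_right (continuous_of_mem_weylHat hS))) hT
  refine closure_minimal (s := (weyl 𝕜 E O : Set (Op 𝕜 E O))) (fun S hS => ?_)
    (hK.preimage (continuous_scomm_left (continuous_of_mem_weyl hT))) hS
  obtain ⟨U, hU, h⟩ := exists_scomm_eq_of_mem_weyl hS hT
  exact ⟨U, weyl_le_weylHat hU, h⟩

end Op

end

/-! ## Linear maps on the dual -/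

section

open Series Op

variable {E O : Type*} {𝕜 : Type*} [Field 𝕜]

theorem mem_of_hasSum {M ι : Type*} [AddCommMonoid M] [TopologicalSpace M] {C : AddSubmonoid M}
    (hC : IsClosed (C : Set M)) {A : ι → M} {T : M} (hT : HasSum A T) (hA : ∀ i, A i ∈ C) :
    T ∈ C :=
  hC.mem_of_tendsto hT (Filter.Eventually.of_forall fun _ => sum_mem fun i _ => hA i)

theorem Op.scomm_smul_left (c : 𝕜) (S T : Op 𝕜 E O) : scomm (c • S) T = c • scomm S T := by
  simp only [scomm, evenPart, oddPart, mul_add, add_mul, smul_add, smul_sub, mul_sub, sub_mul,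
    mul_smul_comm, smul_mul_assoc, smul_comm c]

theorem Op.scomm_smul_right (c : 𝕜) (S T : Op 𝕜 E O) : scomm S (c • T) = c • scomm S T := by
  simp only [scomm, evenPart, oddPart, mul_add, add_mul, smul_add, smul_sub, mul_sub, sub_mul,
    mul_smul_comm, smul_mul_assoc, smul_comm c]

/-! ### Coordinate functionals and the pointwise topology of the dual. -/

section Dual

/-- The identity, as a map to the discrete copy. -/
def Discrete.of {α : Type*} [AddCommGroup α] : α →+ Discrete α := AddMonoidHom.id α

/-- The identity, as a map from the discrete copy. -/
def Discrete.val {α : Type*} (a : Discrete α) : α := a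

/-- The basis vectors of the super vector space. -/
def basisVec : E ⊕ O → SVect 𝕜 E O :=
  Sum.elim (fun i => (Finsupp.single i 1, 0)) (fun j => (0, Finsupp.single j 1))

/-- The coordinate functionals. -/
def coordDual : E ⊕ O → Module.Dual 𝕜 (SVect 𝕜 E O) := Sum.elim yDual ηDual

theorem coordDual_basisVec [DecidableEq (E ⊕ O)] (k l : E ⊕ O) :
    (coordDual k (basisVec l) : 𝕜) = if l = k then 1 else 0 := by
  classical
  rcases k with i | i <;> rcases l with j | j <;>
    simp [coordDual, basisVec, yDual, ηDual, Finsupp.single_apply]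

theorem dual_apply_eq_sum (φ : Module.Dual 𝕜 (SVect 𝕜 E O)) (v : SVect 𝕜 E O) :
    φ v = ∑ k ∈ v.1.support.disjSum v.2.support, φ (basisVec k) * coordDual k v := by
  rw [Finset.sum_disjSum]
  have h1 : φ (v.1, 0) = v.1.sum fun i c => c • φ (basisVec (Sum.inl i)) := by
    have h : φ ∘ₗ LinearMap.inl 𝕜 _ _ =
        Finsupp.linearCombination 𝕜 fun i => φ (basisVec (Sum.inl i)) := by
      ext
      simp [basisVec]
    rw [← Finsupp.linearCombination_apply, ← h]
    rfl
  have h2 : φ (0, v.2) = v.2.sum fun i c => c • φ (basisVec (Sum.inr i)) := by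
    have h : φ ∘ₗ LinearMap.inr 𝕜 _ _ =
        Finsupp.linearCombination 𝕜 fun i => φ (basisVec (Sum.inr i)) := by
      ext
      simp [basisVec]
    rw [← Finsupp.linearCombination_apply, ← h]
    rfl
  have h : v = (v.1, 0) + (0, v.2) := by simp
  conv_lhs => rw [h, map_add, h1, h2]
  simp only [Finsupp.sum, smul_eq_mul]
  congr 1 <;> exact Finset.sum_congr rfl fun i _ => mul_comm _ _

theorem dual_ext {φ ψ : Module.Dual 𝕜 (SVect 𝕜 E O)}
    (h : ∀ k, φ (basisVec k) = ψ (basisVec k)) : φ = ψ := by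
  ext v
  · exact h (Sum.inl v)
  · exact h (Sum.inr v)

theorem isInducing_dualEval :
    @IsInducing _ _ dualTopology _ (dualEval : Module.Dual 𝕜 (SVect 𝕜 E O) → _) :=
  @IsInducing.mk _ _ dualTopology _ _ rfl

/-- Vectors have finite support, so the partial sums evaluated at a vector are eventually constant.
This is what makes a continuous linear map determined by its values on coordinates. -/
theorem hasSum_coordDual (φ : Module.Dual 𝕜 (SVect 𝕜 E O)) :
    @HasSum _ _ _ dualTopology (fun k => φ (basisVec k) • coordDual k) φ (.unconditional _) := by
  let _ : TopologicalSpace (Module.Dual 𝕜 (SVect 𝕜 E O)) := dualTopology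
  rw [HasSum, isInducing_dualEval.tendsto_nhds_iff, tendsto_pi_nhds]
  intro v
  refine tendsto_nhds_of_eventually_eq ?_
  simp only [SummationFilter.unconditional_filter]
  filter_upwards [Filter.eventually_ge_atTop (v.1.support.disjSum v.2.support)] with s hs
  change (∑ k ∈ s, φ (basisVec k) • coordDual k) v = φ v
  rw [dual_apply_eq_sum φ v, LinearMap.sum_apply]
  refine (Finset.sum_subset hs fun k _ hk => ?_).symm
  rcases k with i | i
  · rw [Finset.inl_mem_disjSum, Finsupp.notMem_support_iff] at hk
    simp [coordDual, yDual, hk]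
  · rw [Finset.inr_mem_disjSum, Finsupp.notMem_support_iff] at hk
    simp [coordDual, ηDual, hk]

theorem continuous_dual_apply (v : SVect 𝕜 E O) :
    @Continuous _ _ dualTopology _
      (fun φ : Module.Dual 𝕜 (SVect 𝕜 E O) => Discrete.of (φ v)) :=
  let _ : TopologicalSpace (Module.Dual 𝕜 (SVect 𝕜 E O)) := dualTopology
  (continuous_apply (A := fun _ : SVect 𝕜 E O => Discrete 𝕜) v).comp isInducing_dualEval.continuous

end Dual

/-- The monomials of degree one given by the basis vectors. -/
def varMono : E ⊕ O → Mono E (WithBot O) :=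
  Sum.elim (fun i => ⟨0, Finsupp.single i 1, ∅⟩) (fun j => ⟨0, 0, {(j : WithBot O)}⟩)

theorem deg_varMono (k : E ⊕ O) : (varMono k).deg = 1 := by
  rcases k with i | j <;> simp [varMono, Mono.deg]

/-- The coefficient of `ħ ∂_k` in an operator. -/
def symbolCoeff (k : E ⊕ O) : Op 𝕜 E (WithBot O) →ₗ[𝕜] 𝕜 where
  toFun T := (T (mono (varMono k))).coeff ⟨1, 0, ∅⟩
  map_add' _ _ := rfl
  map_smul' _ _ := rfl

theorem continuous_symbolCoeff (k : E ⊕ O) :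
    Continuous (fun T : Op 𝕜 E (WithBot O) => Discrete.of (symbolCoeff k T)) :=
  (continuous_dcoeff _).comp (continuous_eval _)

/-- The linear part of an operator, as a functional. -/
def symbol (T : Op 𝕜 E (WithBot O)) : Module.Dual 𝕜 (SVect 𝕜 E O) :=
  (Finsupp.linearCombination 𝕜 fun i => symbolCoeff (Sum.inl i) T).coprod
    (Finsupp.linearCombination 𝕜 fun j => symbolCoeff (Sum.inr j) T)

theorem symbol_basisVec (T : Op 𝕜 E (WithBot O)) (k : E ⊕ O) :
    symbol T (basisVec k) = symbolCoeff k T := by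
  rcases k with i | i <;> simp [symbol, basisVec]

/-- Evaluated at a vector, the symbol involves finitely many coefficients, each depending
continuously on the operator. The symbol will serve as a continuous left inverse of `airyMap`. -/
theorem continuous_symbol :
    @Continuous _ _ _ dualTopology (symbol : Op 𝕜 E (WithBot O) → Module.Dual 𝕜 (SVect 𝕜 E O)) := by
  let _ : TopologicalSpace (Module.Dual 𝕜 (SVect 𝕜 E O)) := dualTopology
  refine isInducing_dualEval.continuous_iff.2 (continuous_pi fun v => ?_)
  have h : ∀ T : Op 𝕜 E (WithBot O), dualEval (symbol T) v =
      ∑ k ∈ v.1.support.disjSum v.2.support,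
        Discrete.of (symbolCoeff k T * coordDual k v) := by
    intro T
    refine (dual_apply_eq_sum (symbol T) v).trans ?_
    simp only [symbol_basisVec]
    rfl
  refine Continuous.congr ?_ fun T => (h T).symm
  refine continuous_finsetSum _ fun k _ => ?_
  exact (continuous_of_discreteTopology (f := fun c : Discrete 𝕜 =>
    Discrete.of (c.val * coordDual k v))).comp (continuous_symbolCoeff k)

variable [LinearOrder O]

/-- The linear map on the dual with prescribed values on the coordinate functionals. -/
def airyMap (A : E ⊕ O → Op 𝕜 E (WithBot O)) (hA : LocFin A)
    (hmem : ∀ k, A k ∈ weylHat 𝕜 E (WithBot O)) :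
    Module.Dual 𝕜 (SVect 𝕜 E O) →ₗ[𝕜] weylHat 𝕜 E (WithBot O) where
  toFun φ := ⟨∑' k, φ (basisVec k) • A k,
    mem_weylHat_of_hasSum (hA.smul fun k => φ (basisVec k)).summable.hasSum
      fun k => (weylHat 𝕜 E (WithBot O)).smul_mem (hmem k) _⟩
  map_add' φ ψ := Subtype.ext <| by
    have h1 := (hA.smul fun k => φ (basisVec k)).summable
    have h2 := (hA.smul fun k => ψ (basisVec k)).summable
    simp only [LinearMap.add_apply, add_smul]
    exact h1.tsum_add h2
  map_smul' c φ := Subtype.ext <| by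
    have h1 := (hA.smul fun k => φ (basisVec k)).summable
    simp only [LinearMap.smul_apply, smul_eq_mul, mul_smul]
    exact h1.tsum_const_smul c

section AiryMap

variable {A : E ⊕ O → Op 𝕜 E (WithBot O)} (hA : LocFin A)
  (hmem : ∀ k, A k ∈ weylHat 𝕜 E (WithBot O))

theorem hasSum_airyMap (φ : Module.Dual 𝕜 (SVect 𝕜 E O)) :
    HasSum (fun k => φ (basisVec k) • A k) (airyMap A hA hmem φ).1 :=
  (hA.smul fun k => φ (basisVec k)).summable.hasSum

theorem airyMap_coordDual (k : E ⊕ O) : (airyMap A hA hmem (coordDual k)).1 = A k := by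
  classical
  refine (hasSum_airyMap hA hmem (coordDual k)).unique ?_
  convert hasSum_single (f := fun l => (coordDual k (basisVec l) : 𝕜) • A l) k ?_ using 1
  · simp [coordDual_basisVec]
  · intro l hl
    simp [coordDual_basisVec, hl]

/-- By local finiteness, the degree `d` component of the image applied to `f` depends on finitely
many coordinates of the functional. -/
theorem continuous_airyMap : @Continuous _ _ dualTopology inferInstance (airyMap A hA hmem) := by
  let _ : TopologicalSpace (Module.Dual 𝕜 (SVect 𝕜 E O)) := dualTopology
  refine Continuous.subtype_mk (continuous_of_eval fun f => continuous_of_dcomp fun d => ?_) _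
  have h : ∀ φ : Module.Dual 𝕜 (SVect 𝕜 E O), dcomp d ((airyMap A hA hmem φ).1 f) =
      ∑ k ∈ (hA f d).toFinset, dcomp d (φ (basisVec k) • A k f) := by
    intro φ
    let u : Op 𝕜 E (WithBot O) →+ Discrete (Series 𝕜 E (WithBot O)) :=
      (dcomp d).comp (LinearMap.applyₗ f).toAddMonoidHom
    have hu : Continuous u := (continuous_dcomp d).comp (continuous_eval f)
    refine ((hasSum_airyMap hA hmem φ).map u hu).unique (hasSum_sum_of_ne_finset_zero ?_)
    intro k hk
    rw [Set.Finite.mem_toFinset, Set.mem_ofPred_eq, not_not] at hk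
    change comp d (φ (basisVec k) • A k f) = 0
    rw [map_smul, hk, smul_zero]
  refine Continuous.congr ?_ fun φ => (h φ).symm
  refine continuous_finsetSum _ fun k _ => ?_
  exact (continuous_of_discreteTopology (f := fun c : Discrete 𝕜 =>
    dcomp d (c.val • A k f))).comp
    (continuous_dual_apply (basisVec k))

end AiryMap

/-- A continuous linear map is determined by its values on the coordinate functionals. -/
theorem eq_of_coordDual {L L' : Module.Dual 𝕜 (SVect 𝕜 E O) →ₗ[𝕜] weylHat 𝕜 E (WithBot O)}
    (hL : @Continuous _ _ dualTopology inferInstance L)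
    (hL' : @Continuous _ _ dualTopology inferInstance L')
    (h : ∀ k, L (coordDual k) = L' (coordDual k)) : L = L' := by
  let _ : TopologicalSpace (Module.Dual 𝕜 (SVect 𝕜 E O)) := dualTopology
  ext1 φ
  refine ((hasSum_coordDual φ).map L hL).unique ?_
  have : ⇑L ∘ (fun k => φ (basisVec k) • coordDual k) =
      ⇑L' ∘ (fun k => φ (basisVec k) • coordDual k) := by
    funext k
    simp [h]
  rw [this]
  exact (hasSum_coordDual φ).map L' hL'

/-- The derivative `ħ ∂_k`. -/
def hDeriv : E ⊕ O → Op 𝕜 E (WithBot O) :=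
  Sum.elim (fun i => hbar * dX i) (fun j => hbar * dθ (j : WithBot O))

theorem symbolCoeff_hDeriv [DecidableEq (E ⊕ O)] (k l : E ⊕ O) :
    symbolCoeff k (hDeriv l : Op 𝕜 E (WithBot O)) = if k = l then 1 else 0 := by
  classical
  change ((hDeriv l : Op 𝕜 E (WithBot O)) (mono (varMono k))).coeff ⟨1, 0, ∅⟩ = _
  rcases k with i | i <;> rcases l with j | j <;>
    simp [hDeriv, varMono, coeff_hbar, coeff_dX, coeff_dθ, coeff_mono, sign,
      Finsupp.single_left_inj, eq_comm]

/-- The coefficient leads from a variable, of degree 1, to ħ, of degree 2. Only the degree 1 part of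
the operator can contribute to it. -/
theorem symbolCoeff_of_degPart {k l : E ⊕ O} {T : Op 𝕜 E (WithBot O)}
    (h : degPart 0 T + degPart 1 T = hDeriv l) :
    symbolCoeff k T = symbolCoeff k (hDeriv l : Op 𝕜 E (WithBot O)) := by
  rw [← h, map_add]
  have hd : (⟨1, 0, ∅⟩ : Mono E (WithBot O)).deg = 2 := by simp [Mono.deg]
  have h1 : ∀ d, comp d (mono (varMono k) : Series 𝕜 E (WithBot O)) =
      if d = 1 then mono (varMono k) else 0 := by
    classical
    intro d
    ext m
    by_cases hm : m = varMono k
    · subst hm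
      by_cases hd : d = 1 <;> simp [coeff_comp, deg_varMono, hd, eq_comm]
    · by_cases hd : d = 1 <;> simp [coeff_comp, coeff_mono, hd, hm]
  change (T (mono (varMono k))).coeff (⟨1, 0, ∅⟩ : Mono E (WithBot O)) =
    (degPart 0 T (mono (varMono k))).coeff ⟨1, 0, ∅⟩ +
      (degPart 1 T (mono (varMono k))).coeff ⟨1, 0, ∅⟩
  simp [degPart, hd, h1]

/-- The conditions on the values on the coordinate functionals under which they define a super
quantum Airy structure. -/
structure IsAiryFamily (A : E ⊕ O → Op 𝕜 E (WithBot O)) : Prop where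
  mem : ∀ k, A k ∈ weylHat 𝕜 E (WithBot O)
  locFin : LocFin A
  parity : ∀ k, HasParity k.isRight (A k)
  linear : ∀ k, degPart 0 (A k) + degPart 1 (A k) = hDeriv k
  bracket : ∀ k l, ∃ (c : 𝕜) (r : E ⊕ O), scomm (A k) (A l) = c • (hbar * A r)

namespace IsAiryFamily

variable {A : E ⊕ O → Op 𝕜 E (WithBot O)}

/-- The symbol may be taken term by term, and the linear part of `A l` is ħ∂_l. The `k`-th
coefficient of the sum is therefore the `k`-th coordinate of the functional. -/
theorem symbol_airyMap (hA : IsAiryFamily A) (φ : Module.Dual 𝕜 (SVect 𝕜 E O)) :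
    symbol (airyMap A hA.locFin hA.mem φ).1 = φ := by
  classical
  refine dual_ext fun k => ?_
  rw [symbol_basisVec]
  let u : Op 𝕜 E (WithBot O) →+ Discrete 𝕜 := Discrete.of.comp (symbolCoeff k).toAddMonoidHom
  refine ((hasSum_airyMap hA.locFin hA.mem φ).map u (continuous_symbolCoeff k)).unique ?_
  have h : ∀ l, symbolCoeff k (φ (basisVec l) • A l) = if k = l then φ (basisVec k) else 0 := by
    intro l
    rw [map_smul, symbolCoeff_of_degPart (hA.linear l), symbolCoeff_hDeriv]
    split_ifs with h <;> simp [h]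
  have h' : ⇑u ∘ (fun l => φ (basisVec l) • A l) =
      fun l => if l = k then Discrete.of (φ (basisVec k)) else 0 := by
    funext l
    refine (congrArg Discrete.of (h l)).trans ?_
    simp only [apply_ite Discrete.of, map_zero, eq_comm]
  rw [h']
  exact hasSum_ite_eq k _

end IsAiryFamily

end

/-! ## Super quantum Airy structures from families of operators -/

section

open Series Op

variable {E O : Type*} {𝕜 : Type*} [Field 𝕜]

theorem exists_dual_parts (φ : Module.Dual 𝕜 (SVect 𝕜 E O)) :
    ∃ φ₀ φ₁ : Module.Dual 𝕜 (SVect 𝕜 E O), φ = φ₀ + φ₁ ∧ (∀ w, φ₀ (0, w) = 0) ∧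
      ∀ v, φ₁ (v, 0) = 0 := by
  refine ⟨φ ∘ₗ LinearMap.inl 𝕜 _ _ ∘ₗ LinearMap.fst 𝕜 _ _,
    φ ∘ₗ LinearMap.inr 𝕜 _ _ ∘ₗ LinearMap.snd 𝕜 _ _, ?_, fun w => ?_, fun v => ?_⟩
  · ext v
    · simp only [LinearMap.comp_apply, LinearMap.add_apply, LinearMap.inl_apply,
        LinearMap.inr_apply, LinearMap.fst_apply, LinearMap.snd_apply]
      rw [show ((0 : E →₀ 𝕜), (0 : O →₀ 𝕜)) = 0 from rfl, map_zero, add_zero]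
    · simp only [LinearMap.comp_apply, LinearMap.add_apply, LinearMap.inl_apply,
        LinearMap.inr_apply, LinearMap.fst_apply, LinearMap.snd_apply]
      rw [show ((0 : E →₀ 𝕜), (0 : O →₀ 𝕜)) = 0 from rfl, map_zero, zero_add]
  · exact map_zero φ
  · exact map_zero φ

variable [LinearOrder O]

/-! ### Involutivity of the left ideal generated by a parity preserving map. -/

section Ideal

variable {L : Module.Dual 𝕜 (SVect 𝕜 E O) →ₗ[𝕜] weylHat 𝕜 E (WithBot O)}

/-- The left ideal generated by the image of a parity preserving map is stable under the parity
automorphism. -/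
theorem exists_conj_mem_span
    (hev : ∀ φ : Module.Dual 𝕜 (SVect 𝕜 E O), (∀ w, φ (0, w) = 0) → HasParity false (L φ).1)
    (hod : ∀ φ : Module.Dual 𝕜 (SVect 𝕜 E O), (∀ v, φ (v, 0) = 0) → HasParity true (L φ).1)
    {S : weylHat 𝕜 E (WithBot O)} (hS : S ∈ Ideal.span (Set.range L)) (p : Bool) :
    ∃ S' ∈ Ideal.span (Set.range L), S'.1 = twist p S.1 := by
  cases p
  · exact ⟨S, hS, rfl⟩
  induction hS using Submodule.span_induction with
  | mem S hS =>
    obtain ⟨φ, rfl⟩ := hS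
    obtain ⟨φ₀, φ₁, rfl, h₀, h₁⟩ := exists_dual_parts φ
    refine ⟨L (φ₀ - φ₁), Submodule.subset_span ⟨_, rfl⟩, ?_⟩
    rw [map_add, map_sub]
    change (L φ₀).1 - (L φ₁).1 = conj ((L φ₀).1 + (L φ₁).1)
    rw [map_add, hasParity_false.1 (hev φ₀ h₀), hasParity_true.1 (hod φ₁ h₁), sub_eq_add_neg]
  | zero => exact ⟨0, zero_mem _, (map_zero _).symm⟩
  | add S T _ _ hS hT =>
    obtain ⟨S', hS', h⟩ := hS
    obtain ⟨T', hT', h'⟩ := hT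
    refine ⟨S' + T', add_mem hS' hT', ?_⟩
    change S'.1 + T'.1 = twist true (S.1 + T.1)
    rw [h, h', map_add]
  | smul a S _ hS =>
    obtain ⟨S', hS', h⟩ := hS
    refine ⟨⟨_, twist_mem_weylHat true a.2⟩ * S', Ideal.mul_mem_left _ _ hS', ?_⟩
    change twist true a.1 * S'.1 = twist true (a.1 * S.1)
    rw [h, map_mul]

variable [CharZero 𝕜]

/-- The ideal is stable under the parity automorphism, so it contains half the sum and half the
difference of an element and its conjugate. -/
theorem exists_parts_mem_span
    (hev : ∀ φ : Module.Dual 𝕜 (SVect 𝕜 E O), (∀ w, φ (0, w) = 0) → HasParity false (L φ).1)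
    (hod : ∀ φ : Module.Dual 𝕜 (SVect 𝕜 E O), (∀ v, φ (v, 0) = 0) → HasParity true (L φ).1)
    {S : weylHat 𝕜 E (WithBot O)} (hS : S ∈ Ideal.span (Set.range L)) :
    ∃ S₀ ∈ Ideal.span (Set.range L), ∃ S₁ ∈ Ideal.span (Set.range L), S = S₀ + S₁ ∧
      HasParity false S₀.1 ∧ HasParity true S₁.1 := by
  obtain ⟨S', hS', h⟩ := exists_conj_mem_span hev hod hS true
  have hmem : ∀ (c : 𝕜) {T : weylHat 𝕜 E (WithBot O)}, T ∈ Ideal.span (Set.range L) →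
      c • T ∈ Ideal.span (Set.range L) := fun c T hT => by
    rw [Algebra.smul_def]
    exact Ideal.mul_mem_left _ _ hT
  refine ⟨(2⁻¹ : 𝕜) • (S + S'), hmem _ (add_mem hS hS'), (2⁻¹ : 𝕜) • (S - S'),
    hmem _ (sub_mem hS hS'), ?_, ?_, ?_⟩
  · refine Subtype.ext ?_
    change S.1 = (2⁻¹ : 𝕜) • (S.1 + S'.1) + (2⁻¹ : 𝕜) • (S.1 - S'.1)
    rw [h]
    exact (evenPart_add_oddPart S.1).symm
  · change HasParity false ((2⁻¹ : 𝕜) • (S.1 + S'.1))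
    rw [h]
    exact hasParity_evenPart S.1
  · change HasParity true ((2⁻¹ : 𝕜) • (S.1 - S'.1))
    rw [h]
    exact hasParity_oddPart S.1

/-- If the image of a parity preserving map is closed under super-commutators up to `ħ`, then so is
the left ideal that it generates. -/
theorem involutive_of_bracket
    (hev : ∀ φ : Module.Dual 𝕜 (SVect 𝕜 E O), (∀ w, φ (0, w) = 0) → HasParity false (L φ).1)
    (hod : ∀ φ : Module.Dual 𝕜 (SVect 𝕜 E O), (∀ v, φ (v, 0) = 0) → HasParity true (L φ).1)
    (hbr : ∀ φ ψ, ∃ χ, scomm (L φ).1 (L ψ).1 = hbar * (L χ).1)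
    {S T : weylHat 𝕜 E (WithBot O)} (hS : S ∈ Ideal.span (Set.range L))
    (hT : T ∈ Ideal.span (Set.range L)) :
    ∃ U ∈ Ideal.span (Set.range L), scomm S.1 T.1 = hbar * U.1 := by
  have hsum : ∀ {X Y : Op 𝕜 E (WithBot O)},
      (∃ U ∈ Ideal.span (Set.range L), X = hbar * U.1) →
      (∃ U ∈ Ideal.span (Set.range L), Y = hbar * U.1) →
      ∃ U ∈ Ideal.span (Set.range L), X + Y = hbar * U.1 := by
    rintro X Y ⟨U, hU, rfl⟩ ⟨U', hU', rfl⟩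
    exact ⟨U + U', add_mem hU hU', (mul_add _ _ _).symm⟩
  have hleft : ∀ (a : Op 𝕜 E (WithBot O)) (_ : a ∈ weylHat 𝕜 E (WithBot O))
      {X : Op 𝕜 E (WithBot O)},
      (∃ U ∈ Ideal.span (Set.range L), X = hbar * U.1) →
      ∃ U ∈ Ideal.span (Set.range L), a * X = hbar * U.1 := by
    rintro a ha X ⟨U, hU, rfl⟩
    refine ⟨⟨a, ha⟩ * U, Ideal.mul_mem_left _ _ hU, ?_⟩
    change a * (hbar * U.1) = hbar * (a * U.1)
    rw [← mul_assoc, ← (commute_hbar_of_mem_weylHat ha).eq, mul_assoc]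
  -- A super-commutator of coefficients is already ħ times a coefficient, so multiplying it by an
  -- element of the ideal gives ħ times an element of the ideal.
  have hscomm : ∀ {a b c : Op 𝕜 E (WithBot O)}, a ∈ weylHat 𝕜 E (WithBot O) →
      b ∈ weylHat 𝕜 E (WithBot O) → (∃ X ∈ Ideal.span (Set.range L), X.1 = c) →
      ∃ U ∈ Ideal.span (Set.range L), scomm a b * c = hbar * U.1 := by
    rintro a b c ha hb ⟨X, hX, rfl⟩
    obtain ⟨U, hU, h⟩ := exists_scomm_eq_of_mem_weylHat ha hb
    exact ⟨⟨U, hU⟩ * X, Ideal.mul_mem_left _ _ hX, by rw [h, mul_assoc]; rfl⟩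
  have hzero : ∃ U ∈ Ideal.span (Set.range L), (0 : Op 𝕜 E (WithBot O)) = hbar * U.1 :=
    ⟨0, zero_mem _, (mul_zero _).symm⟩
  -- Leibniz in the second argument, the first being a homogeneous generator.
  have key₁ : ∀ (p : Bool) (φ) (_ : HasParity p (L φ).1) {T} (_ : T ∈ Ideal.span (Set.range L)),
      ∃ U ∈ Ideal.span (Set.range L), scomm (L φ).1 T.1 = hbar * U.1 := by
    intro p φ hφ T hT
    induction hT using Submodule.span_induction with
    | mem T hT =>
      obtain ⟨ψ, rfl⟩ := hT
      obtain ⟨χ, h⟩ := hbr φ ψ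
      exact ⟨L χ, Submodule.subset_span ⟨χ, rfl⟩, h⟩
    | zero =>
      rw [show (0 : weylHat 𝕜 E (WithBot O)).1 = 0 from rfl, scomm_zero_right]
      exact hzero
    | add T T' _ _ h h' =>
      rw [show (T + T').1 = T.1 + T'.1 from rfl, scomm_add_right]
      exact hsum h h'
    | smul a T hT h =>
      rw [show (a • T).1 = a.1 * T.1 from rfl, scomm_mul_right hφ]
      exact hsum (hscomm (L φ).2 a.2 ⟨T, hT, rfl⟩) (hleft _ (twist_mem_weylHat p a.2) h)
  -- Leibniz in the first argument against a homogeneous `T`. The term carrying the twisted factor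
  -- stays in the ideal by stability under parity.
  have key₂ : ∀ (p : Bool) {T} (_ : T ∈ Ideal.span (Set.range L)) (_ : HasParity p T.1),
      ∃ U ∈ Ideal.span (Set.range L), scomm S.1 T.1 = hbar * U.1 := by
    intro p T hT hp
    induction hS using Submodule.span_induction with
    | mem S hS =>
      obtain ⟨φ, rfl⟩ := hS
      obtain ⟨φ₀, φ₁, rfl, h₀, h₁⟩ := exists_dual_parts φ
      rw [map_add, show (L φ₀ + L φ₁).1 = (L φ₀).1 + (L φ₁).1 from rfl, scomm_add_left]
      exact hsum (key₁ false φ₀ (hev φ₀ h₀) hT) (key₁ true φ₁ (hod φ₁ h₁) hT)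
    | zero =>
      rw [show (0 : weylHat 𝕜 E (WithBot O)).1 = 0 from rfl, scomm_zero_left]
      exact hzero
    | add S S' _ _ h h' =>
      rw [show (S + S').1 = S.1 + S'.1 from rfl, scomm_add_left]
      exact hsum h h'
    | smul a S hS h =>
      rw [show (a • S).1 = a.1 * S.1 from rfl, scomm_mul_left hp]
      exact hsum (hleft _ a.2 h) (hscomm a.2 T.2 (exists_conj_mem_span hev hod hS p))
  obtain ⟨T₀, hT₀, T₁, hT₁, rfl, h₀, h₁⟩ := exists_parts_mem_span hev hod hT
  rw [show (T₀ + T₁).1 = T₀.1 + T₁.1 from rfl, scomm_add_right]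
  exact hsum (key₂ false hT₀ h₀) (key₂ true hT₁ h₁)

end Ideal

namespace IsAiryFamily

variable {A : E ⊕ O → Op 𝕜 E (WithBot O)}

/-- Since the symbol is a continuous left inverse, the range is the fixed set of a continuous map
into a Hausdorff space. -/
theorem isClosed_range (hA : IsAiryFamily A) :
    IsClosed {U | ∃ φ, (airyMap A hA.locFin hA.mem φ).1 = U} := by
  let _ : TopologicalSpace (Module.Dual 𝕜 (SVect 𝕜 E O)) := dualTopology
  have h : {U | ∃ φ, (airyMap A hA.locFin hA.mem φ).1 = U} =
      {U | (airyMap A hA.locFin hA.mem (symbol U)).1 = U} := by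
    ext U
    constructor
    · rintro ⟨φ, rfl⟩
      rw [Set.mem_ofPred_eq, symbol_airyMap hA]
    · exact fun h => ⟨_, h⟩
  rw [h]
  exact isClosed_eq (continuous_subtype_val.comp
    ((continuous_airyMap hA.locFin hA.mem).comp continuous_symbol)) continuous_id

/-- Both arguments are infinite sums. The bracket is expanded in one and then the other, with every
term in ħ times the range, a subspace closed by `isClosed_range` and `isClosed_hbar_mul`. -/
theorem exists_scomm_airyMap (hA : IsAiryFamily A) (φ ψ : Module.Dual 𝕜 (SVect 𝕜 E O)) :
    ∃ χ, scomm (airyMap A hA.locFin hA.mem φ).1 (airyMap A hA.locFin hA.mem ψ).1 =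
      hbar * (airyMap A hA.locFin hA.mem χ).1 := by
  set L := airyMap A hA.locFin hA.mem with hL
  let K : Submodule 𝕜 (Op 𝕜 E (WithBot O)) :=
    { carrier := {T | ∃ U ∈ {U | ∃ φ, (L φ).1 = U}, T = hbar * U}
      zero_mem' := ⟨0, ⟨0, by rw [map_zero]; rfl⟩, (mul_zero _).symm⟩
      add_mem' := by
        rintro _ _ ⟨_, ⟨φ, rfl⟩, rfl⟩ ⟨_, ⟨ψ, rfl⟩, rfl⟩
        exact ⟨_, ⟨φ + ψ, rfl⟩, by rw [map_add, ← mul_add]; rfl⟩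
      smul_mem' := by
        rintro c _ ⟨_, ⟨φ, rfl⟩, rfl⟩
        exact ⟨_, ⟨c • φ, rfl⟩, by rw [map_smul, ← mul_smul_comm]; rfl⟩ }
  have hK : IsClosed (K : Set (Op 𝕜 E (WithBot O))) := isClosed_hbar_mul hA.isClosed_range
  have hsum := hasSum_airyMap hA.locFin hA.mem
  have h₁ : ∀ k, scomm (A k) (L ψ).1 ∈ K := by
    intro k
    let u : Op 𝕜 E (WithBot O) →+ Op 𝕜 E (WithBot O) :=
      { toFun := fun T => scomm (A k) T
        map_zero' := scomm_zero_right _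
        map_add' := scomm_add_right _ }
    refine mem_of_hasSum (C := K.toAddSubmonoid) hK ((hsum ψ).map u
      (continuous_scomm_right (continuous_of_mem_weylHat (hA.mem k)))) fun l => ?_
    change scomm (A k) (ψ (basisVec l) • A l) ∈ K
    obtain ⟨c, r, h⟩ := hA.bracket k l
    rw [scomm_smul_right, h]
    refine K.smul_mem _ (K.smul_mem _ ⟨_, ⟨coordDual r, rfl⟩, ?_⟩)
    rw [hL, airyMap_coordDual]
  let u : Op 𝕜 E (WithBot O) →+ Op 𝕜 E (WithBot O) :=
    { toFun := fun T => scomm T (L ψ).1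
      map_zero' := scomm_zero_left _
      map_add' := fun S T => scomm_add_left S T _ }
  have h₂ : scomm (L φ).1 (L ψ).1 ∈ K := by
    refine mem_of_hasSum (C := K.toAddSubmonoid) hK ((hsum φ).map u
      (continuous_scomm_left (continuous_of_mem_weylHat (L ψ).2))) fun k => ?_
    change scomm (φ (basisVec k) • A k) (L ψ).1 ∈ K
    rw [scomm_smul_left]
    exact K.smul_mem _ (h₁ k)
  obtain ⟨_, ⟨χ, rfl⟩, h⟩ := h₂
  exact ⟨χ, h⟩

theorem isSuperQuantumAiryStructure [CharZero 𝕜] (hA : IsAiryFamily A) :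
    IsSuperQuantumAiryStructure (airyMap A hA.locFin hA.mem) := by
  have hev : ∀ φ : Module.Dual 𝕜 (SVect 𝕜 E O), (∀ w, φ (0, w) = 0) →
      HasParity false (airyMap A hA.locFin hA.mem φ).1 := by
    intro φ hφ
    refine hasParity_of_hasSum (hasSum_airyMap hA.locFin hA.mem φ) fun k => ?_
    rcases k with i | j
    · exact (hA.parity (Sum.inl i)).smul _
    · rw [basisVec, Sum.elim_inr, hφ, zero_smul]
      exact hasParity_zero _
  have hod : ∀ φ : Module.Dual 𝕜 (SVect 𝕜 E O), (∀ v, φ (v, 0) = 0) →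
      HasParity true (airyMap A hA.locFin hA.mem φ).1 := by
    intro φ hφ
    refine hasParity_of_hasSum (hasSum_airyMap hA.locFin hA.mem φ) fun k => ?_
    rcases k with i | j
    · rw [basisVec, Sum.elim_inl, hφ, zero_smul]
      exact hasParity_zero _
    · exact (hA.parity (Sum.inr j)).smul _
  exact
    { even := fun φ hφ => hasParity_false_iff.1 (hev φ hφ)
      odd := fun φ hφ => hasParity_true_iff.1 (hod φ hφ)
      continuous := continuous_airyMap hA.locFin hA.mem
      involutive := fun S hS T hT =>
        involutive_of_bracket hev hod (exists_scomm_airyMap hA) hS hT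
      linear_even := fun i => by
        have h := airyMap_coordDual hA.locFin hA.mem (Sum.inl i)
        rw [coordDual, Sum.elim_inl] at h
        rw [h]
        exact hA.linear (Sum.inl i)
      linear_odd := fun j => by
        have h := airyMap_coordDual hA.locFin hA.mem (Sum.inr j)
        rw [coordDual, Sum.elim_inr] at h
        rw [h]
        exact hA.linear (Sum.inr j) }

/-- A family with the right properties extends uniquely to a super quantum Airy structure. -/
theorem existsUnique [CharZero 𝕜] (hA : IsAiryFamily A) :
    ∃! L : Module.Dual 𝕜 (SVect 𝕜 E O) →ₗ[𝕜] weylHat 𝕜 E (WithBot O),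
      IsSuperQuantumAiryStructure L ∧ (∀ i : E, (L (yDual i)).1 = A (Sum.inl i)) ∧
        ∀ j : O, (L (ηDual j)).1 = A (Sum.inr j) := by
  refine ⟨airyMap A hA.locFin hA.mem, ⟨hA.isSuperQuantumAiryStructure,
    fun i => airyMap_coordDual hA.locFin hA.mem (Sum.inl i),
    fun j => airyMap_coordDual hA.locFin hA.mem (Sum.inr j)⟩, ?_⟩
  rintro L ⟨hL, hy, hη⟩
  refine eq_of_coordDual hL.continuous (continuous_airyMap hA.locFin hA.mem) fun k =>
    Subtype.ext ?_
  rw [airyMap_coordDual]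
  rcases k with i | j
  exacts [hy i, hη j]

end IsAiryFamily

end

/-! ## Degrees, monomials and modes -/

section

open Series Op

namespace Op

variable {E O : Type*} {𝕜 : Type*} [Field 𝕜]

theorem coeff_degPart (e : ℕ) (T : Op 𝕜 E O) (f : Series 𝕜 E O) (m : Mono E O) :
    (degPart e T f).coeff m = if e ≤ m.deg then (T (comp (m.deg - e) f)).coeff m else 0 := rfl

theorem degPart_add (e : ℕ) (S T : Op 𝕜 E O) : degPart e (S + T) = degPart e S + degPart e T := by
  ext f m
  by_cases h : e ≤ m.deg <;> simp [coeff_degPart, h]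

theorem degPart_smul (e : ℕ) (c : 𝕜) (T : Op 𝕜 E O) : degPart e (c • T) = c • degPart e T := by
  ext f m
  by_cases h : e ≤ m.deg <;> simp [coeff_degPart, h]

/-- In degree `d` the component takes only the value of the operator at one homogeneous component of
`f`, or is zero when `e` exceeds `d`. -/
theorem continuous_degPart (e : ℕ) : Continuous (degPart e : Op 𝕜 E O → Op 𝕜 E O) := by
  refine continuous_of_eval fun f => continuous_of_dcomp fun d => ?_
  by_cases hd : e ≤ d
  · refine ((continuous_dcomp d).comp (continuous_eval (comp (d - e) f))).congr fun T => ?_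
    change comp d (T (comp (d - e) f)) = comp d (degPart e T f)
    ext m
    by_cases hm : m.deg = d
    · subst hm
      simp [coeff_comp, coeff_degPart, hd]
    · simp [coeff_comp, hm]
  · refine continuous_const.congr (f := fun _ => (0 : Discrete (Series 𝕜 E O))) fun T => ?_
    symm
    change comp d (degPart e T f) = 0
    rw [comp_eq_zero_iff]
    rintro m rfl
    rw [coeff_degPart, if_neg hd]

/-- Operators of degree `e`. -/
def Homog (e : ℕ) (T : Op 𝕜 E O) : Prop := degPart e T = T

theorem homog_iff {e : ℕ} {T : Op 𝕜 E O} : Homog e T ↔ ∀ f m,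
    (T f).coeff m = if e ≤ m.deg then (T (comp (m.deg - e) f)).coeff m else 0 := by
  constructor
  · intro h f m
    conv_lhs => rw [← h]
    rfl
  · intro h
    ext f m
    exact (h f m).symm

theorem Homog.add {e : ℕ} {S T : Op 𝕜 E O} (hS : Homog e S) (hT : Homog e T) :
    Homog e (S + T) := by
  unfold Homog at *
  rw [degPart_add, hS, hT]

theorem Homog.smul {e : ℕ} {T : Op 𝕜 E O} (hT : Homog e T) (c : 𝕜) : Homog e (c • T) := by
  unfold Homog at *
  rw [degPart_smul, hT]

theorem homog_zero (e : ℕ) : Homog e (0 : Op 𝕜 E O) := by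
  have h : ((0 : 𝕜) • (0 : Op 𝕜 E O)) = 0 := zero_smul _ _
  rw [Homog, ← h, degPart_smul, zero_smul, h]

theorem Homog.degPart_eq_zero {e e' : ℕ} {T : Op 𝕜 E O} (hT : Homog e T) (h : e ≠ e') :
    degPart e' T = 0 := by
  ext f m
  rw [coeff_degPart]
  split_ifs with h'
  · rw [homog_iff.1 hT]
    split_ifs with h''
    · rw [comp_comp, if_neg (by omega), map_zero]
      rfl
    · rfl
  · rfl

theorem Homog.mul {e e' : ℕ} {S T : Op 𝕜 E O} (hS : Homog e S) (hT : Homog e' T) :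
    Homog (e + e') (S * T) := by
  rw [homog_iff]
  intro f m
  rw [Module.End.mul_apply, Module.End.mul_apply, homog_iff.1 hS]
  by_cases h : e ≤ m.deg
  · rw [if_pos h]
    by_cases h' : e + e' ≤ m.deg
    · rw [if_pos h']
      conv_rhs => rw [homog_iff.1 hS, if_pos h]
      congr 2
      ext n
      simp only [coeff_comp]
      split_ifs with hn
      · rw [homog_iff.1 hT, if_pos (by omega), hn, Nat.sub_sub]
      · rfl
    · rw [if_neg h']
      have : comp (m.deg - e) (T f) = 0 := by
        rw [comp_eq_zero_iff]
        intro n hn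
        rw [homog_iff.1 hT, if_neg (by omega)]
      rw [this, map_zero, coeff_zero]
  · rw [if_neg h, if_neg (by omega)]

theorem homog_of_hasSum {ι : Type*} {e : ℕ} {A : ι → Op 𝕜 E O} {T : Op 𝕜 E O} (hT : HasSum A T)
    (hA : ∀ i, Homog e (A i)) : Homog e T := by
  let u : Op 𝕜 E O →+ Op 𝕜 E O :=
    { toFun := degPart e, map_zero' := homog_zero e, map_add' := degPart_add e }
  have h := hT.map u (continuous_degPart e)
  have hA' : ⇑u ∘ A = A := funext hA
  rw [hA'] at h
  exact h.unique hT

theorem homog_of_coeff {e : ℕ} {T : Op 𝕜 E O} (c : Mono E O → 𝕜) (g : Mono E O → Mono E O)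
    (h : ∀ f m, (T f).coeff m = c m * f.coeff (g m))
    (hdeg : ∀ m, c m ≠ 0 → (g m).deg + e = m.deg) : Homog e T := by
  rw [homog_iff]
  intro f m
  rw [h, h, coeff_comp]
  by_cases hc : c m = 0
  · simp [hc]
  · have := hdeg m hc
    rw [if_pos (by omega), if_pos (by omega)]

theorem homog_hbar : Homog 2 (hbar : Op 𝕜 E O) :=
  homog_of_coeff _ _ (fun _ _ => rfl) fun m hm => by
    have : m.h ≠ 0 := by simpa using hm
    simp only [Mono.deg]
    omega

theorem homog_mulX (i : E) : Homog 1 (mulX i : Op 𝕜 E O) :=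
  homog_of_coeff _ _ (fun _ _ => rfl) fun m hm => by
    have h1 : m.x i ≠ 0 := by simpa using hm
    have h2 := sum_add_single (m.x - Finsupp.single i 1) i
    rw [sub_single_add h1] at h2
    simp only [Mono.deg]
    omega

theorem homog_hdX (i : E) : Homog 1 (hbar * dX i : Op 𝕜 E O) :=
  homog_of_coeff (fun m => if m.h = 0 then 0 else (m.x i + 1))
    (fun m => ⟨m.h - 1, m.x + Finsupp.single i 1, m.θ⟩)
    (fun f m => by
      simp only [Module.End.mul_apply, coeff_hbar, coeff_dX]
      split_ifs <;> simp) fun m hm => by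
    have h1 : m.h ≠ 0 := fun h => hm (if_pos h)
    have h2 := sum_add_single m.x i
    simp only [Mono.deg]
    omega

/-! ### Action of the generators on monomials. -/

theorem hbar_mono (μ : Mono E O) :
    (hbar (mono μ) : Series 𝕜 E O) = mono { μ with h := μ.h + 1 } := by
  classical
  ext m
  rw [coeff_hbar, coeff_mono, coeff_mono]
  by_cases h : m.h = 0
  · rw [if_pos h, if_neg]
    rintro rfl
    exact absurd h (Nat.succ_ne_zero _)
  · rw [if_neg h]
    refine if_congr ?_ rfl rfl
    simp only [Mono.ext_iff]
    exact and_congr_left fun _ => by omega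

theorem mulX_mono (i : E) (μ : Mono E O) :
    (mulX i (mono μ) : Series 𝕜 E O) = mono { μ with x := μ.x + Finsupp.single i 1 } := by
  classical
  ext m
  rw [coeff_mulX, coeff_mono, coeff_mono]
  by_cases h : m.x i = 0
  · rw [if_pos h, if_neg]
    rintro rfl
    simp at h
  · rw [if_neg h]
    refine if_congr ?_ rfl rfl
    simp only [Mono.ext_iff]
    refine and_congr_right fun _ => and_congr_left fun _ => ⟨fun h' => ?_, fun h' => ?_⟩
    · rw [← h', sub_single_add h]
    · rw [h', add_tsub_cancel_right]

theorem dX_mono_eq_zero {i : E} {μ : Mono E O} (h : μ.x i = 0) :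
    (dX i (mono μ) : Series 𝕜 E O) = 0 := by
  ext m
  rw [coeff_dX, coeff_mono, if_neg, mul_zero, coeff_zero]
  rintro rfl
  simp at h

variable [LinearOrder O]

theorem homog_mulθ (j : O) : Homog 1 (mulθ j : Op 𝕜 E O) :=
  homog_of_coeff _ _ (fun _ _ => rfl) fun m hm => by
    have h1 : j ∈ m.θ := by by_contra hc; simp [hc] at hm
    have h2 := Finset.card_erase_add_one h1
    simp only [Mono.deg]
    omega

theorem homog_hdθ (j : O) : Homog 1 (hbar * dθ j : Op 𝕜 E O) :=
  homog_of_coeff (fun m => if m.h = 0 then 0 else if j ∈ m.θ then 0 else sign j m.θ)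
    (fun m => ⟨m.h - 1, m.x, insert j m.θ⟩)
    (fun f m => by
      simp only [Module.End.mul_apply, coeff_hbar, coeff_dθ]
      split_ifs <;> simp) fun m hm => by
    have h1 : m.h ≠ 0 := fun h => hm (if_pos h)
    have h2 : j ∉ m.θ := by intro hc; simp [hc] at hm
    have h3 := Finset.card_insert_of_notMem h2
    simp only [Mono.deg]
    omega

/-- Odd monomials are stored in increasing order, so a variable smaller than all the others goes in
front without a sign. -/
theorem mulθ_mono {j : O} {μ : Mono E O} (h : ∀ k ∈ μ.θ, j < k) :
    (mulθ j (mono μ) : Series 𝕜 E O) = mono { μ with θ := insert j μ.θ } := by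
  have hj : j ∉ μ.θ := fun hj => lt_irrefl _ (h j hj)
  have hs : (sign j (insert j μ.θ) : 𝕜) = 1 := by
    rw [sign_insert hj, if_neg (lt_irrefl _), sign, Finset.filter_eq_empty_iff.2]
    · simp
    · exact fun k hk => (h k hk).not_gt
  ext m
  rw [coeff_mulθ, coeff_mono, coeff_mono]
  by_cases hm : j ∈ m.θ
  · rw [if_pos hm]
    have : ({ m with θ := m.θ.erase j } : Mono E O) = μ ↔
        m = { μ with θ := insert j μ.θ } := by
      simp only [Mono.ext_iff]
      refine and_congr_right fun _ => and_congr_right fun _ => ⟨fun h' => ?_, fun h' => ?_⟩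
      · rw [← h', Finset.insert_erase hm]
      · rw [h', Finset.erase_insert hj]
    by_cases h' : m = { μ with θ := insert j μ.θ }
    · rw [if_pos h', if_pos (this.2 h'), h']
      simp [hs]
    · rw [if_neg h', if_neg (fun h'' => h' (this.1 h'')), mul_zero]
  · rw [if_neg hm, if_neg]
    rintro rfl
    simp at hm

theorem dθ_mono_eq_zero {j : O} {μ : Mono E O} (h : j ∉ μ.θ) :
    (dθ j (mono μ) : Series 𝕜 E O) = 0 := by
  ext m
  rw [coeff_dθ, coeff_mono, coeff_zero]
  split_ifs with h1 h2
  · rfl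
  · subst h2
    simp at h
  · simp

end Op

/-! ### The rescaled Heisenberg modes. -/

section Modes

variable (𝕜 : Type*) [RCLike 𝕜]

theorem thetaIdx_coe (j : ℕ+) : thetaIdx j = (j : WithBot ℕ+) := by
  obtain ⟨n, hn⟩ := Nat.exists_eq_succ_of_ne_zero j.ne_zero
  rw [hn]
  change ((n.succPNat : ℕ+) : WithBot ℕ+) = j
  congr 1
  exact PNat.eq hn.symm

theorem thetaIdx_injective : Function.Injective thetaIdx := by
  intro m n h
  rcases m with _ | m <;> rcases n with _ | n
  · rfl
  · exact absurd h (WithBot.coe_ne_bot).symm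
  · exact absurd h WithBot.coe_ne_bot
  · have h' := WithBot.coe_injective h
    have := congrArg PNat.val h'
    simpa using this

theorem thetaIdx_surjective : Function.Surjective thetaIdx := by
  intro a
  induction a using WithBot.recBotCoe with
  | bot => exact ⟨0, rfl⟩
  | coe j => exact ⟨j, thetaIdx_coe j⟩

variable {𝕜}

theorem bMode_of_nonneg {m : ℤ} (h : 0 ≤ m) : bMode 𝕜 m = hbar * dX m.toNat := if_pos h

theorem bMode_natCast (i : ℕ) : bMode 𝕜 i = hbar * dX i := by
  rw [bMode_of_nonneg (Int.natCast_nonneg i), Int.toNat_natCast]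

theorem bMode_of_neg {m : ℤ} (h : m < 0) :
    bMode 𝕜 m = ((-m : ℤ) : 𝕜) • mulX (-m).toNat := if_neg h.not_ge

theorem ψMode_of_pos {m : ℤ} (h : 0 < m) : ψMode 𝕜 m = hbar * dθ (thetaIdx m.toNat) := if_pos h

theorem ψMode_natCast {j : ℕ} (h : 1 ≤ j) : ψMode 𝕜 j = hbar * dθ (thetaIdx j) := by
  rw [ψMode_of_pos (by omega), Int.toNat_natCast]

theorem ψMode_of_neg {m : ℤ} (h : m < 0) : ψMode 𝕜 m = mulθ (thetaIdx (-m).toNat) := by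
  rw [ψMode, if_neg h.not_gt, if_pos h]

theorem ψMode_zero : ψMode 𝕜 0 =
    (((√2)⁻¹ : ℝ) : 𝕜) • (mulθ (thetaIdx 0) + hbar * dθ (thetaIdx 0)) := by
  simp [ψMode]

theorem bMode_mem_weyl (m : ℤ) : bMode 𝕜 m ∈ weyl 𝕜 ℕ (WithBot ℕ+) := by
  rw [bMode]
  split_ifs
  exacts [hdX_mem_weyl _, (weyl _ _ _).smul_mem (mulX_mem_weyl _) _]

theorem ψMode_mem_weyl (m : ℤ) : ψMode 𝕜 m ∈ weyl 𝕜 ℕ (WithBot ℕ+) := by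
  rw [ψMode]
  split_ifs
  exacts [hdθ_mem_weyl _, mulθ_mem_weyl _,
    (weyl _ _ _).smul_mem (add_mem (mulθ_mem_weyl _) (hdθ_mem_weyl _)) _]

theorem hasParity_bMode (m : ℤ) : HasParity false (bMode 𝕜 m) := by
  rw [bMode]
  split_ifs
  exacts [hasParity_hdX _, (hasParity_mulX _).smul _]

theorem hasParity_ψMode (m : ℤ) : HasParity true (ψMode 𝕜 m) := by
  rw [ψMode]
  split_ifs
  exacts [hasParity_hdθ _, hasParity_mulθ _, ((hasParity_mulθ _).add (hasParity_hdθ _)).smul _]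

theorem homog_bMode (m : ℤ) : Homog 1 (bMode 𝕜 m) := by
  rw [bMode]
  split_ifs
  exacts [homog_hdX _, (homog_mulX _).smul _]

theorem homog_ψMode (m : ℤ) : Homog 1 (ψMode 𝕜 m) := by
  rw [ψMode]
  split_ifs
  exacts [homog_hdθ _, homog_mulθ _, ((homog_mulθ _).add (homog_hdθ _)).smul _]

theorem commute_hbar_bMode (m : ℤ) : Commute hbar (bMode 𝕜 m) :=
  commute_hbar_of_mem_weylHat (weyl_le_weylHat (bMode_mem_weyl m))

theorem commute_hbar_ψMode (m : ℤ) : Commute hbar (ψMode 𝕜 m) :=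
  commute_hbar_of_mem_weylHat (weyl_le_weylHat (ψMode_mem_weyl m))

theorem commute_bMode_mulθ (m : ℤ) (j : WithBot ℕ+) : Commute (bMode 𝕜 m) (mulθ j) := by
  rw [bMode]
  split_ifs
  exacts [commute_hdX_mulθ _ _, Commute.smul_left (mulX_mul_mulθ _ _) _]

theorem commute_bMode_hdθ (m : ℤ) (j : WithBot ℕ+) : Commute (bMode 𝕜 m) (hbar * dθ j) := by
  rw [bMode]
  split_ifs
  exacts [commute_hdX_hdθ _ _, Commute.smul_left (commute_mulX_hdθ _ _) _]

theorem commute_ψMode_mulX (m : ℤ) (i : ℕ) : Commute (ψMode 𝕜 m) (mulX i) := by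
  rw [ψMode]
  split_ifs
  exacts [(commute_mulX_hdθ _ _).symm, (mulX_mul_mulθ _ _).symm, Commute.smul_left
    (Commute.add_left (mulX_mul_mulθ _ _).symm (commute_mulX_hdθ _ _).symm) _]

theorem commute_bMode_ψMode (m n : ℤ) : Commute (bMode 𝕜 m) (ψMode 𝕜 n) := by
  rw [ψMode]
  split_ifs
  exacts [commute_bMode_hdθ _ _, commute_bMode_mulθ _ _, Commute.smul_right
    ((commute_bMode_mulθ _ _).add_right (commute_bMode_hdθ _ _)) _]

/-- The variable x^0 is not proportional to any mode, b_0 being a derivative. Brackets with the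
variables are therefore recorded, and those with negative modes follow by scaling. -/
theorem bMode_mul_mulX (m : ℤ) (i : ℕ) : bMode 𝕜 m * mulX i - mulX i * bMode 𝕜 m =
    if m = i then (1 : 𝕜) • hbar else 0 := by
  rcases le_or_gt 0 m with h | h
  · rw [bMode_of_nonneg h, hdX_mul_mulX, add_sub_cancel_left, one_smul]
    by_cases hm : m = i
    · rw [if_pos (by omega), if_pos hm]
    · rw [if_neg (by omega), if_neg hm]
  · rw [bMode_of_neg h, if_neg (by omega), smul_mul_assoc, mul_smul_comm, mulX_mul_mulX, sub_self]

theorem bMode_mul_bMode (m n : ℤ) : bMode 𝕜 m * bMode 𝕜 n - bMode 𝕜 n * bMode 𝕜 m =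
    if m = -n then ((-n : ℤ) : 𝕜) • hbar else 0 := by
  rcases lt_or_ge n 0 with hn | hn
  · rw [bMode_of_neg hn, mul_smul_comm, smul_mul_assoc, ← smul_sub, bMode_mul_mulX, smul_ite,
      one_smul, smul_zero]
    exact if_congr (by omega) rfl rfl
  · rcases lt_or_ge m 0 with hm | hm
    · have h := bMode_mul_mulX (𝕜 := 𝕜) n (-m).toNat
      rw [bMode_of_neg hm, smul_mul_assoc, mul_smul_comm, ← smul_sub, ← neg_sub (bMode 𝕜 n * _), h]
      by_cases hmn : m = -n
      · subst hmn
        rw [if_pos (by omega), if_pos rfl]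
        simp
      · rw [if_neg (by omega), if_neg hmn, neg_zero, smul_zero]
    · rw [bMode_of_nonneg hm, bMode_of_nonneg hn, (commute_hdX_hdX _ _).eq, sub_self]
      split_ifs with h
      · have : n = 0 := by omega
        simp [this]
      · rfl

theorem sqrt_two_inv_mul_self :
    (((√2)⁻¹ : ℝ) : 𝕜) * (((√2)⁻¹ : ℝ) : 𝕜) = 2⁻¹ := by
  rw [← RCLike.ofReal_mul, ← mul_inv, Real.mul_self_sqrt (by norm_num), RCLike.ofReal_inv,
    RCLike.ofReal_ofNat]

theorem hdθ_mul_mulθ_add (i j : WithBot ℕ+) : hbar * dθ i * mulθ j + mulθ j * (hbar * dθ i) =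
    if i = j then hbar else (0 : TOp 𝕜) := by
  rw [hdθ_mul_mulθ]
  abel

theorem ψMode_mul_mulθ (m : ℤ) (j : ℕ) :
    ψMode 𝕜 m * mulθ (thetaIdx j) + mulθ (thetaIdx j) * ψMode 𝕜 m =
      if m = j then (if j = 0 then (((√2)⁻¹ : ℝ) : 𝕜) else 1) • hbar else 0 := by
  rcases lt_trichotomy m 0 with h | rfl | h
  · rw [ψMode_of_neg h, if_neg (by omega), mulθ_mul_mulθ, neg_add_cancel]
  · rw [ψMode_zero, smul_mul_assoc, mul_smul_comm, ← smul_add, add_mul, mul_add, add_add_add_comm,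
      hdθ_mul_mulθ_add, mulθ_mul_mulθ, neg_add_cancel, zero_add]
    rcases Nat.eq_zero_or_pos j with rfl | hj
    · simp
    · rw [if_neg fun h => hj.ne (thetaIdx_injective h), if_neg (by omega), smul_zero]
  · rw [ψMode_of_pos h, hdθ_mul_mulθ_add]
    by_cases hm : m = j
    · subst hm
      rw [if_pos (by rw [Int.toNat_natCast]), if_pos rfl, if_neg (by omega), one_smul]
    · rw [if_neg fun h' => hm (by have := thetaIdx_injective h'; omega), if_neg hm]

theorem ψMode_mul_hdθ (m : ℤ) (j : ℕ) :
    ψMode 𝕜 m * (hbar * dθ (thetaIdx j)) + hbar * dθ (thetaIdx j) * ψMode 𝕜 m =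
      if m = -j then (if j = 0 then (((√2)⁻¹ : ℝ) : 𝕜) else 1) • hbar else 0 := by
  rcases lt_trichotomy m 0 with h | rfl | h
  · rw [ψMode_of_neg h, add_comm, hdθ_mul_mulθ_add]
    by_cases hm : m = -j
    · subst hm
      rw [if_pos (by simp), if_pos rfl, if_neg (by omega), one_smul]
    · rw [if_neg fun h' => hm (by have := thetaIdx_injective h'; omega), if_neg hm]
  · rw [ψMode_zero, smul_mul_assoc, mul_smul_comm, ← smul_add, add_mul, mul_add, add_add_add_comm,
      hdθ_mul_hdθ, neg_add_cancel, add_zero, add_comm, hdθ_mul_mulθ_add]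
    rcases Nat.eq_zero_or_pos j with rfl | hj
    · simp
    · rw [if_neg fun h => hj.ne' (thetaIdx_injective h), if_neg (by omega), smul_zero]
  · rw [ψMode_of_pos h, if_neg (by omega), hdθ_mul_hdθ, neg_add_cancel]

/-- The anticommutator of θ^0 + ħ∂ with itself is 2ħ, and the two factors 1/√2 in the zero mode
reduce it to ħ. -/
theorem ψMode_mul_ψMode (m n : ℤ) : ψMode 𝕜 m * ψMode 𝕜 n + ψMode 𝕜 n * ψMode 𝕜 m =
    if m = -n then (1 : 𝕜) • hbar else 0 := by
  rcases lt_trichotomy n 0 with h | rfl | h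
  · rw [ψMode_of_neg h, ψMode_mul_mulθ, if_neg (show (-n).toNat ≠ 0 by omega)]
    exact if_congr (by omega) rfl rfl
  · have h1 := ψMode_mul_mulθ (𝕜 := 𝕜) m 0
    have h2 := ψMode_mul_hdθ (𝕜 := 𝕜) m 0
    rw [ψMode_zero, mul_smul_comm, smul_mul_assoc, ← smul_add, add_mul, mul_add, add_add_add_comm,
      h1, h2]
    by_cases hm : m = 0
    · simp only [hm, Nat.cast_zero, neg_zero, if_true]
      rw [← add_smul, smul_smul, mul_add, sqrt_two_inv_mul_self]
      norm_num
    · simp [hm]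
  · have := ψMode_mul_hdθ (𝕜 := 𝕜) m n.toNat
    rw [ψMode_of_pos h, this, if_neg (show n.toNat ≠ 0 by omega)]
    exact if_congr (by omega) rfl rfl

end Modes

end

/-! ## Summability and commutators with the modes -/

section

open Series Op

variable {𝕜 : Type*} [RCLike 𝕜]

/-! ### Summability -/

section Summability

theorem bNormal_mem_weyl (j k : ℤ) : bNormal 𝕜 j k ∈ weyl 𝕜 ℕ (WithBot ℕ+) := by
  rw [bNormal]
  split_ifs <;> exact mul_mem (bMode_mem_weyl _) (bMode_mem_weyl _)

theorem ψNormal_mem_weyl (j k : ℤ) : ψNormal 𝕜 j k ∈ weyl 𝕜 ℕ (WithBot ℕ+) := by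
  rw [ψNormal]
  split_ifs
  exacts [mul_mem (ψMode_mem_weyl _) (ψMode_mem_weyl _),
    neg_mem (mul_mem (ψMode_mem_weyl _) (ψMode_mem_weyl _))]

theorem bosonTerm_mem_weyl (m j : ℤ) : bosonTerm 𝕜 m j ∈ weyl 𝕜 ℕ (WithBot ℕ+) :=
  bNormal_mem_weyl _ _

theorem fermionTerm_mem_weyl (m j : ℤ) : fermionTerm 𝕜 m j ∈ weyl 𝕜 ℕ (WithBot ℕ+) :=
  (weyl _ _ _).smul_mem (ψNormal_mem_weyl _ _) _

theorem mixedTerm_mem_weyl (m j : ℤ) : mixedTerm 𝕜 m j ∈ weyl 𝕜 ℕ (WithBot ℕ+) :=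
  mul_mem (bMode_mem_weyl _) (ψMode_mem_weyl _)

/-- Normal ordering places the mode of larger index on the right, where it acts first. -/
theorem bosonTerm_apply_eq_zero {f : Series 𝕜 ℕ (WithBot ℕ+)} {m j : ℤ}
    (h : bMode 𝕜 (max j (m - j)) f = 0) : bosonTerm 𝕜 m j f = 0 := by
  rw [bosonTerm, bNormal]
  split_ifs with hj
  · rw [max_eq_right hj] at h
    rw [Module.End.mul_apply, h, map_zero]
  · rw [max_eq_left (le_of_not_ge hj)] at h
    rw [Module.End.mul_apply, h, map_zero]

theorem fermionTerm_apply_eq_zero {f : Series 𝕜 ℕ (WithBot ℕ+)} {m j : ℤ}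
    (h : ψMode 𝕜 (max (-j) (m + j)) f = 0) : fermionTerm 𝕜 m j f = 0 := by
  rw [fermionTerm, ψNormal]
  split_ifs with hj
  · rw [max_eq_right hj] at h
    rw [LinearMap.smul_apply, Module.End.mul_apply, h, map_zero, smul_zero]
  · rw [max_eq_left (le_of_not_ge hj)] at h
    rw [LinearMap.smul_apply, LinearMap.neg_apply, Module.End.mul_apply, h, map_zero, neg_zero,
      smul_zero]

/-- Bosonic and fermionic modes commute, so either factor may be made to act first and no ordering
is needed. -/
theorem mixedTerm_apply_eq_zero {f : Series 𝕜 ℕ (WithBot ℕ+)} {m k : ℤ}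
    (h : bMode 𝕜 (m - k) f = 0 ∨ ψMode 𝕜 k f = 0) : mixedTerm 𝕜 m k f = 0 := by
  rw [mixedTerm]
  rcases h with h | h
  · rw [(commute_bMode_ψMode _ _).eq, Module.End.mul_apply, h, map_zero]
  · rw [Module.End.mul_apply, h, map_zero]

/-- All modes of large index kill a given monomial. -/
theorem exists_modes_mono_eq_zero (μ : Mono ℕ (WithBot ℕ+)) : ∃ M : ℤ, 0 ≤ M ∧ ∀ k, M < k →
    bMode 𝕜 k (mono μ) = 0 ∧ ψMode 𝕜 k (mono μ) = 0 := by
  obtain ⟨a, ha⟩ := μ.x.support.finite_toSet.bddAbove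
  obtain ⟨b, hb⟩ := (μ.θ.finite_toSet.preimage thetaIdx_injective.injOn).bddAbove
  refine ⟨max a b, by omega, fun k hk => ⟨?_, ?_⟩⟩
  · rw [bMode_of_nonneg (by omega), Module.End.mul_apply, dX_mono_eq_zero, map_zero]
    by_contra h
    have := ha (Finset.mem_coe.2 (Finsupp.mem_support_iff.2 h))
    omega
  · rw [ψMode_of_pos (by omega), Module.End.mul_apply, dθ_mono_eq_zero, map_zero]
    intro h
    have := hb (show k.toNat ∈ thetaIdx ⁻¹' μ.θ from h)
    omega

theorem Op.filtered_of_mem_weyl {E O : Type*} [LinearOrder O] {T : Op 𝕜 E O}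
    (hT : T ∈ weyl 𝕜 E O) : Filtered T := filtered_of_mem_weylHat (weyl_le_weylHat hT)

variable (𝕜)

theorem summable_bosonTerm (m : ℤ) : Summable (bosonTerm 𝕜 m) := by
  refine (LocFin.of_mono (fun j => filtered_of_mem_weyl (bosonTerm_mem_weyl m j))
    fun μ => ?_).summable
  obtain ⟨M, -, hM⟩ := exists_modes_mono_eq_zero (𝕜 := 𝕜) μ
  -- Outside this interval one of the two indices `j` and `m - j` exceeds `M`.
  refine (Set.finite_Icc (m - M) M).subset fun j hj => ?_
  by_contra hc
  rw [Set.mem_Icc] at hc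
  exact hj (bosonTerm_apply_eq_zero (hM _ (by omega)).1)

theorem summable_fermionTerm (m : ℤ) : Summable (fermionTerm 𝕜 m) := by
  refine (LocFin.of_mono (fun j => filtered_of_mem_weyl (fermionTerm_mem_weyl m j))
    fun μ => ?_).summable
  obtain ⟨M, -, hM⟩ := exists_modes_mono_eq_zero (𝕜 := 𝕜) μ
  refine (Set.finite_Icc (-M) (M - m)).subset fun j hj => ?_
  by_contra hc
  rw [Set.mem_Icc] at hc
  exact hj (fermionTerm_apply_eq_zero (hM _ (by omega)).2)

theorem summable_mixedTerm (m : ℤ) : Summable (mixedTerm 𝕜 m) := by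
  refine (LocFin.of_mono (fun j => filtered_of_mem_weyl (mixedTerm_mem_weyl m j))
    fun μ => ?_).summable
  obtain ⟨M, -, hM⟩ := exists_modes_mono_eq_zero (𝕜 := 𝕜) μ
  refine (Set.finite_Icc (m - M) M).subset fun j hj => ?_
  by_contra hc
  rw [Set.mem_Icc] at hc
  by_cases h : M < j
  · exact hj (mixedTerm_apply_eq_zero (Or.inr (hM _ h).2))
  · exact hj (mixedTerm_apply_eq_zero (Or.inl (hM _ (by omega)).1))

variable {𝕜}

theorem HOp_eq (N : ℤ) (i : ℕ) : HOp 𝕜 N i = bMode 𝕜 i +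
    (2⁻¹ : 𝕜) • (∑' j : ℤ, bosonTerm 𝕜 (i + N - 1) j) +
    (2⁻¹ : 𝕜) • (∑' j : ℤ, fermionTerm 𝕜 (i + N - 1) j) := by
  rw [HOp, bMode_natCast]

theorem FOp_eq (N : ℤ) {j : ℕ} (hj : 1 ≤ j) : FOp 𝕜 N j = ψMode 𝕜 j +
    ∑' k : ℤ, mixedTerm 𝕜 (j + N - 1) k := by
  rw [FOp, ψMode_natCast hj]

theorem HOp_mem_weylHat (N : ℤ) (i : ℕ) : HOp 𝕜 N i ∈ weylHat 𝕜 ℕ (WithBot ℕ+) := by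
  rw [HOp_eq]
  refine add_mem (add_mem (weyl_le_weylHat (bMode_mem_weyl _)) ?_) ?_
  · exact (weylHat _ _ _).smul_mem (mem_weylHat_of_hasSum (summable_bosonTerm 𝕜 _).hasSum
      fun j => weyl_le_weylHat (bosonTerm_mem_weyl _ j)) _
  · exact (weylHat _ _ _).smul_mem (mem_weylHat_of_hasSum (summable_fermionTerm 𝕜 _).hasSum
      fun j => weyl_le_weylHat (fermionTerm_mem_weyl _ j)) _

theorem FOp_mem_weylHat (N : ℤ) (j : ℕ) : FOp 𝕜 N j ∈ weylHat 𝕜 ℕ (WithBot ℕ+) :=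
  add_mem (weyl_le_weylHat (hdθ_mem_weyl _)) (mem_weylHat_of_hasSum (summable_mixedTerm 𝕜 _).hasSum
    fun k => weyl_le_weylHat (mixedTerm_mem_weyl _ k))

theorem hasParity_HOp (N : ℤ) (i : ℕ) : HasParity false (HOp 𝕜 N i) := by
  refine ((hasParity_hdX i).add (HasParity.smul ?_ _)).add (HasParity.smul ?_ _)
  · refine hasParity_of_hasSum (summable_bosonTerm 𝕜 _).hasSum fun j => ?_
    rw [bosonTerm, bNormal]
    split_ifs <;> exact (hasParity_bMode _).mul (hasParity_bMode _)
  · refine hasParity_of_hasSum (summable_fermionTerm 𝕜 _).hasSum fun j => ?_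
    rw [fermionTerm, ψNormal]
    refine HasParity.smul ?_ _
    split_ifs
    exacts [(hasParity_ψMode _).mul (hasParity_ψMode _),
      ((hasParity_ψMode _).mul (hasParity_ψMode _)).neg]

theorem hasParity_FOp (N : ℤ) (j : ℕ) : HasParity true (FOp 𝕜 N j) :=
  (hasParity_hdθ _).add (hasParity_of_hasSum (summable_mixedTerm 𝕜 _).hasSum fun _ =>
    (hasParity_bMode _).mul (hasParity_ψMode _))

theorem exists_HOp_eq_add (N : ℤ) (i : ℕ) :
    ∃ T : TOp 𝕜, Homog 2 T ∧ HOp 𝕜 N i = hbar * dX i + T := by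
  refine ⟨_, Homog.add (Homog.smul ?_ _) (Homog.smul ?_ _), add_assoc _ _ _⟩
  · refine homog_of_hasSum (summable_bosonTerm 𝕜 _).hasSum fun j => ?_
    rw [bosonTerm, bNormal]
    split_ifs <;> exact (homog_bMode _).mul (homog_bMode _)
  · refine homog_of_hasSum (summable_fermionTerm 𝕜 _).hasSum fun j => ?_
    rw [fermionTerm, ψNormal]
    refine Homog.smul ?_ _
    split_ifs
    · exact (homog_ψMode _).mul (homog_ψMode _)
    · rw [← neg_one_smul 𝕜]
      exact ((homog_ψMode _).mul (homog_ψMode _)).smul _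

theorem exists_FOp_eq_add (N : ℤ) (j : ℕ) :
    ∃ T : TOp 𝕜, Homog 2 T ∧ FOp 𝕜 N j = hbar * dθ (thetaIdx j) + T :=
  ⟨_, homog_of_hasSum (summable_mixedTerm 𝕜 _).hasSum fun _ =>
    (homog_bMode _).mul (homog_ψMode _), rfl⟩

theorem apply_eq_zero_of_hasSum {E O ι : Type*} {A : ι → Op 𝕜 E O} {T : Op 𝕜 E O}
    (hT : HasSum A T) {f : Series 𝕜 E O} (hA : ∀ i, A i f = 0) : T f = 0 := by
  have h := hT.map (LinearMap.applyₗ f).toAddMonoidHom (continuous_eval f)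
  have hA' : ⇑(LinearMap.applyₗ (R := 𝕜) (M₂ := Series 𝕜 E O) f).toAddMonoidHom ∘ A =
      fun _ => 0 := funext hA
  rw [hA'] at h
  exact h.unique hasSum_zero

theorem HOp_apply_eq_zero {N : ℤ} {i : ℕ} {f : Series 𝕜 ℕ (WithBot ℕ+)} (h₁ : bMode 𝕜 i f = 0)
    (h₂ : ∀ j, bosonTerm 𝕜 (i + N - 1) j f = 0) (h₃ : ∀ j, fermionTerm 𝕜 (i + N - 1) j f = 0) :
    HOp 𝕜 N i f = 0 := by
  rw [HOp_eq, LinearMap.add_apply, LinearMap.add_apply, LinearMap.smul_apply,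
    LinearMap.smul_apply, h₁, apply_eq_zero_of_hasSum (summable_bosonTerm 𝕜 _).hasSum h₂,
    apply_eq_zero_of_hasSum (summable_fermionTerm 𝕜 _).hasSum h₃, smul_zero, add_zero, add_zero]

theorem FOp_apply_eq_zero {N : ℤ} {j : ℕ} (hj : 1 ≤ j) {f : Series 𝕜 ℕ (WithBot ℕ+)}
    (h₁ : ψMode 𝕜 j f = 0) (h₂ : ∀ k, mixedTerm 𝕜 (j + N - 1) k f = 0) :
    FOp 𝕜 N j f = 0 := by
  rw [FOp_eq N hj, LinearMap.add_apply, h₁,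
    apply_eq_zero_of_hasSum (summable_mixedTerm 𝕜 _).hasSum h₂, add_zero]

theorem finite_HOp_mono (N : ℤ) (μ : Mono ℕ (WithBot ℕ+)) :
    {i | HOp 𝕜 N i (mono μ) ≠ 0}.Finite := by
  obtain ⟨M, hM0, hM⟩ := exists_modes_mono_eq_zero (𝕜 := 𝕜) μ
  -- Above `M` the linear term dies. Once the index sum `i + N - 1` exceeds `2 * M`, every quadratic
  -- term has a mode of index above `M`.
  refine (Set.finite_Iic (max M (2 * M - N + 1)).toNat).subset fun i hi => ?_
  by_contra hc
  rw [Set.mem_Iic] at hc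
  refine hi (HOp_apply_eq_zero (hM _ (by omega)).1 (fun j => ?_) fun j => ?_)
  · exact bosonTerm_apply_eq_zero (hM _ (by omega)).1
  · exact fermionTerm_apply_eq_zero (hM _ (by omega)).2

theorem finite_FOp_mono (N : ℤ) (μ : Mono ℕ (WithBot ℕ+)) :
    {j : ℕ+ | FOp 𝕜 N j (mono μ) ≠ 0}.Finite := by
  obtain ⟨M, hM0, hM⟩ := exists_modes_mono_eq_zero (𝕜 := 𝕜) μ
  refine ((Set.finite_Iic (max M (2 * M - N + 1)).toNat).preimage
    PNat.coe_injective.injOn).subset fun j hj => ?_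
  by_contra hc
  rw [Set.mem_preimage, Set.mem_Iic] at hc
  refine hj (FOp_apply_eq_zero j.pos (hM _ (by omega)).2 fun k => mixedTerm_apply_eq_zero ?_)
  by_cases h : M < k
  · exact Or.inr (hM _ h).2
  · exact Or.inl (hM _ (by omega)).1

/-- The vacuum. -/
def vac : Series 𝕜 ℕ (WithBot ℕ+) := mono ⟨0, 0, ∅⟩

theorem bMode_vac {k : ℤ} (hk : 0 ≤ k) : bMode 𝕜 k vac = 0 := by
  rw [bMode_of_nonneg hk, Module.End.mul_apply, vac, dX_mono_eq_zero (by rfl), map_zero]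

theorem ψMode_vac {k : ℤ} (hk : 0 < k) : ψMode 𝕜 k vac = 0 := by
  rw [ψMode_of_pos hk, Module.End.mul_apply, vac, dθ_mono_eq_zero (Finset.notMem_empty _), map_zero]

/-- Two indices with non-negative sum include a non-negative one, and the larger acts first. The
only term without an annihilating factor is ψ_0 ψ_0 at index zero, whose coefficient `j + m / 2`
vanishes. -/
theorem HOp_vac {N : ℤ} {i : ℕ} (h : 0 ≤ i + N - 1) : HOp 𝕜 N i vac = 0 := by
  refine HOp_apply_eq_zero (bMode_vac (by omega))
    (fun j => bosonTerm_apply_eq_zero (bMode_vac (by omega))) fun j => ?_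
  by_cases hj : 0 < max (-j) (i + N - 1 + j)
  · exact fermionTerm_apply_eq_zero (ψMode_vac hj)
  · have h1 : j = 0 := by omega
    have h2 : i + N - 1 = 0 := by omega
    rw [fermionTerm, h2, h1]
    simp

/-- Fermionic modes of positive index annihilate the vacuum. For `k ≤ 0` the accompanying bosonic
index is non-negative, and b_0 annihilates it as well. -/
theorem FOp_vac {N : ℤ} {j : ℕ} (hj : 1 ≤ j) (h : 0 ≤ j + N - 1) : FOp 𝕜 N j vac = 0 := by
  refine FOp_apply_eq_zero hj (ψMode_vac (by omega)) fun k => mixedTerm_apply_eq_zero ?_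
  by_cases hk : 0 < k
  · exact Or.inr (ψMode_vac hk)
  · exact Or.inl (bMode_vac (by omega))

end Summability

/-! ### Commutators with elementary operators -/

section Brackets

/-- An operator whose only nonzero commutator with the modes is `[b_p, c]`. -/
structure BosonLike (p : ℤ) (a : 𝕜) (c : TOp 𝕜) : Prop where
  boson : ∀ j, bMode 𝕜 j * c - c * bMode 𝕜 j = if j = p then a • hbar else 0
  fermion : ∀ j, Commute (ψMode 𝕜 j) c
  hbar : Commute hbar c
  cont : Continuous c

/-- An operator whose only nonzero super-commutator with the modes is `{ψ_p, c}`. -/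
structure FermionLike (p : ℤ) (a : 𝕜) (c : TOp 𝕜) : Prop where
  boson : ∀ j, Commute (bMode 𝕜 j) c
  fermion : ∀ j, ψMode 𝕜 j * c + c * ψMode 𝕜 j = if j = p then a • Op.hbar else 0
  hbar : Commute Op.hbar c
  cont : Continuous c

theorem bosonLike_bMode (k : ℤ) : BosonLike (-k) ((-k : ℤ) : 𝕜) (bMode 𝕜 k) where
  boson j := bMode_mul_bMode j k
  fermion j := (commute_bMode_ψMode k j).symm
  hbar := commute_hbar_bMode k
  cont := continuous_of_mem_weyl (bMode_mem_weyl k)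

theorem bosonLike_mulX (i : ℕ) : BosonLike i (1 : 𝕜) (mulX i) where
  boson j := bMode_mul_mulX j i
  fermion j := commute_ψMode_mulX j i
  hbar := commute_hbar_mulX i
  cont := continuous_of_mem_weyl (mulX_mem_weyl i)

theorem fermionLike_ψMode (k : ℤ) : FermionLike (-k) (1 : 𝕜) (ψMode 𝕜 k) where
  boson j := commute_bMode_ψMode j k
  fermion j := ψMode_mul_ψMode j k
  hbar := commute_hbar_ψMode k
  cont := continuous_of_mem_weyl (ψMode_mem_weyl k)

/-- Serves to detect the extra variable: θ^0 pairs with ψ_0 alone. -/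
theorem fermionLike_mulθ_zero :
    FermionLike 0 (((√2)⁻¹ : ℝ) : 𝕜) (mulθ (thetaIdx 0)) where
  boson j := commute_bMode_mulθ j _
  fermion j := ψMode_mul_mulθ j 0
  hbar := commute_hbar_mulθ _
  cont := continuous_of_mem_weyl (mulθ_mem_weyl _)

theorem mul_comm_smul_hbar {x : TOp 𝕜} (hx : Commute hbar x) (a : 𝕜) (y : TOp 𝕜) :
    x * (a • (hbar * y)) - a • (hbar * y) * x = a • (hbar * (x * y - y * x)) := by
  rw [mul_smul_comm, smul_mul_assoc, ← smul_sub, ← mul_assoc, ← hx.eq, mul_assoc, mul_assoc,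
    ← mul_sub]

theorem mul_anticomm_smul_hbar {x : TOp 𝕜} (hx : Commute hbar x) (a : 𝕜) (y : TOp 𝕜) :
    x * (a • (hbar * y)) + a • (hbar * y) * x = a • (hbar * (x * y + y * x)) := by
  rw [mul_smul_comm, smul_mul_assoc, ← smul_add, ← mul_assoc, ← hx.eq, mul_assoc, mul_assoc,
    ← mul_add]

namespace BosonLike

variable {p : ℤ} {a : 𝕜} {c : TOp 𝕜}

theorem bMode_mul (hc : BosonLike p a c) (j l : ℤ) :
    bMode 𝕜 j * bMode 𝕜 l * c - c * (bMode 𝕜 j * bMode 𝕜 l) =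
      (if l = p then a • (Op.hbar * bMode 𝕜 j) else 0) +
        (if j = p then a • (Op.hbar * bMode 𝕜 l) else 0) := by
  have h : bMode 𝕜 j * bMode 𝕜 l * c - c * (bMode 𝕜 j * bMode 𝕜 l) =
      bMode 𝕜 j * (bMode 𝕜 l * c - c * bMode 𝕜 l) +
        (bMode 𝕜 j * c - c * bMode 𝕜 j) * bMode 𝕜 l := by noncomm_ring
  rw [h, hc.boson, hc.boson, mul_ite, ite_mul, mul_zero, zero_mul, mul_smul_comm, smul_mul_assoc,
    (commute_hbar_bMode j).eq]

/-- The commutator formula is symmetric in the two modes, so it does not see the normal ordering. -/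
theorem bNormal (hc : BosonLike p a c) (j l : ℤ) :
    bNormal 𝕜 j l * c - c * bNormal 𝕜 j l =
      (if l = p then a • (Op.hbar * bMode 𝕜 j) else 0) +
        (if j = p then a • (Op.hbar * bMode 𝕜 l) else 0) := by
  rw [SuperAiry.bNormal]
  by_cases h : j ≤ l
  · rw [if_pos h, hc.bMode_mul j l]
  · rw [if_neg h, hc.bMode_mul l j, add_comm]

theorem ψNormal (hc : BosonLike p a c) (r s : ℤ) : Commute (ψNormal 𝕜 r s) c := by
  rw [SuperAiry.ψNormal]
  split_ifs
  exacts [(hc.fermion r).mul_left (hc.fermion s), ((hc.fermion s).mul_left (hc.fermion r)).neg_left]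

end BosonLike

namespace FermionLike

variable {p : ℤ} {a : 𝕜} {c : TOp 𝕜}

theorem ψMode_mul (hc : FermionLike p a c) (r s : ℤ) :
    ψMode 𝕜 r * ψMode 𝕜 s * c - c * (ψMode 𝕜 r * ψMode 𝕜 s) =
      (if s = p then a • (Op.hbar * ψMode 𝕜 r) else 0) -
        (if r = p then a • (Op.hbar * ψMode 𝕜 s) else 0) := by
  have h : ψMode 𝕜 r * ψMode 𝕜 s * c - c * (ψMode 𝕜 r * ψMode 𝕜 s) =
      ψMode 𝕜 r * (ψMode 𝕜 s * c + c * ψMode 𝕜 s) -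
        (ψMode 𝕜 r * c + c * ψMode 𝕜 r) * ψMode 𝕜 s := by noncomm_ring
  rw [h, hc.fermion, hc.fermion, mul_ite, ite_mul, mul_zero, zero_mul, mul_smul_comm,
    smul_mul_assoc, (commute_hbar_ψMode r).eq]

theorem ψNormal (hc : FermionLike p a c) (r s : ℤ) :
    ψNormal 𝕜 r s * c - c * ψNormal 𝕜 r s =
      (if s = p then a • (Op.hbar * ψMode 𝕜 r) else 0) -
        (if r = p then a • (Op.hbar * ψMode 𝕜 s) else 0) := by
  rw [SuperAiry.ψNormal]
  by_cases h : r ≤ s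
  · rw [if_pos h, hc.ψMode_mul r s]
  · rw [if_neg h, neg_mul, mul_neg, sub_neg_eq_add, neg_add_eq_sub, ← neg_sub, hc.ψMode_mul s r,
      neg_sub]

theorem bNormal (hc : FermionLike p a c) (j l : ℤ) : Commute (bNormal 𝕜 j l) c := by
  rw [SuperAiry.bNormal]
  split_ifs
  exacts [(hc.boson j).mul_left (hc.boson l), (hc.boson l).mul_left (hc.boson j)]

end FermionLike

/-- The bosonic modes, with the dilaton shift. -/
def shiftedMode (𝕜 : Type*) [RCLike 𝕜] (N k : ℤ) : TOp 𝕜 :=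
  bMode 𝕜 k + if k = N - 1 then 1 else 0

theorem hasSum_commutator {ι : Type*} {A : ι → TOp 𝕜} {T c : TOp 𝕜} (hT : HasSum A T)
    (hc : Continuous c) : HasSum (fun i => A i * c - c * A i) (T * c - c * T) := by
  have h1 := hT.map (AddMonoidHom.mulRight c) (continuous_mul_right c)
  have h2 := hT.map (AddMonoidHom.mulLeft c) (continuous_mul_left hc)
  exact h1.sub h2

theorem hasSum_anticommutator {ι : Type*} {A : ι → TOp 𝕜} {T c : TOp 𝕜} (hT : HasSum A T)
    (hc : Continuous c) : HasSum (fun i => A i * c + c * A i) (T * c + c * T) := by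
  have h1 := hT.map (AddMonoidHom.mulRight c) (continuous_mul_right c)
  have h2 := hT.map (AddMonoidHom.mulLeft c) (continuous_mul_left hc)
  exact h1.add h2

variable {p : ℤ} {a : 𝕜} {c : TOp 𝕜}

theorem HOp_commutator (N : ℤ) (i : ℕ) (c : TOp 𝕜) : HOp 𝕜 N i * c - c * HOp 𝕜 N i =
    (bMode 𝕜 i * c - c * bMode 𝕜 i) + (2⁻¹ : 𝕜) •
      ((∑' j : ℤ, bosonTerm 𝕜 (i + N - 1) j) * c - c * ∑' j : ℤ, bosonTerm 𝕜 (i + N - 1) j) +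
    (2⁻¹ : 𝕜) •
      ((∑' j : ℤ, fermionTerm 𝕜 (i + N - 1) j) * c -
        c * ∑' j : ℤ, fermionTerm 𝕜 (i + N - 1) j) := by
  rw [HOp_eq]
  simp only [add_mul, mul_add, smul_mul_assoc, mul_smul_comm, smul_sub]
  abel

/-- The terms `j = p` and `j = m - p` contribute equally, cancelling the factor 1/2. The linear term
contributes exactly for `i = p`, when the resulting index is `N - 1`; this is the dilaton shift. -/
theorem BosonLike.HOp (hc : BosonLike p a c) (N : ℤ) (i : ℕ) :
    HOp 𝕜 N i * c - c * HOp 𝕜 N i =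
      a • (Op.hbar * shiftedMode 𝕜 N (i + N - 1 - p)) := by
  set m : ℤ := i + N - 1 with hm
  have h1 : (∑' j : ℤ, bosonTerm 𝕜 m j) * c - c * ∑' j : ℤ, bosonTerm 𝕜 m j =
      (2 : 𝕜) • a • (Op.hbar * bMode 𝕜 (m - p)) := by
    refine (hasSum_commutator (summable_bosonTerm 𝕜 m).hasSum hc.cont).unique ?_
    have h : (fun j => bosonTerm 𝕜 m j * c - c * bosonTerm 𝕜 m j) = fun j =>
        (if j = m - p then a • (Op.hbar * bMode 𝕜 (m - p)) else 0) +
          (if j = p then a • (Op.hbar * bMode 𝕜 (m - p)) else 0) := by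
      funext j
      rw [bosonTerm, hc.bNormal]
      congr 1
      · by_cases h : j = m - p
        · rw [if_pos (by omega), if_pos h, h]
        · rw [if_neg (by omega), if_neg h]
      · by_cases h : j = p
        · rw [if_pos h, if_pos h, h]
        · rw [if_neg h, if_neg h]
    rw [h, two_smul]
    exact (hasSum_ite_eq _ _).add (hasSum_ite_eq _ _)
  have h2 : (∑' j : ℤ, fermionTerm 𝕜 m j) * c - c * ∑' j : ℤ, fermionTerm 𝕜 m j = 0 := by
    refine (hasSum_commutator (summable_fermionTerm 𝕜 m).hasSum hc.cont).unique ?_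
    have h : (fun j => fermionTerm 𝕜 m j * c - c * fermionTerm 𝕜 m j) = fun j => 0 := by
      funext j
      rw [fermionTerm, smul_mul_assoc, mul_smul_comm, (hc.ψNormal _ _).eq, sub_self]
    rw [h]
    exact hasSum_zero
  rw [HOp_commutator, ← hm, h1, h2, hc.boson, smul_zero, add_zero, smul_smul,
    inv_mul_cancel₀ two_ne_zero, one_smul, shiftedMode, mul_add, smul_add, add_comm]
  congr 1
  by_cases h : (i : ℤ) = p
  · rw [if_pos h, if_pos (by omega), mul_one]
  · rw [if_neg h, if_neg (by omega), mul_zero, smul_zero]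

/-- The terms `j = p - m` and `j = -p` survive. The sign from exchanging the fermions is cancelled
by the antisymmetry of `j + m / 2` under `j ↦ -m - j`, so they agree and absorb the factor 1/2. -/
theorem FermionLike.HOp (hc : FermionLike p a c) (N : ℤ) (i : ℕ) :
    HOp 𝕜 N i * c - c * HOp 𝕜 N i =
      (a * (p - ((i + N - 1 : ℤ) : 𝕜) / 2)) • (Op.hbar * ψMode 𝕜 (i + N - 1 - p)) := by
  set m : ℤ := i + N - 1 with hm
  have h1 : (∑' j : ℤ, bosonTerm 𝕜 m j) * c - c * ∑' j : ℤ, bosonTerm 𝕜 m j = 0 := by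
    refine (hasSum_commutator (summable_bosonTerm 𝕜 m).hasSum hc.cont).unique ?_
    have h : (fun j => bosonTerm 𝕜 m j * c - c * bosonTerm 𝕜 m j) = fun j => 0 := by
      funext j
      rw [bosonTerm, (hc.bNormal _ _).eq, sub_self]
    rw [h]
    exact hasSum_zero
  have h2 : (∑' j : ℤ, fermionTerm 𝕜 m j) * c - c * ∑' j : ℤ, fermionTerm 𝕜 m j =
      (2 : 𝕜) • (a * (p - (m : 𝕜) / 2)) • (Op.hbar * ψMode 𝕜 (m - p)) := by
    refine (hasSum_commutator (summable_fermionTerm 𝕜 m).hasSum hc.cont).unique ?_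
    have h : (fun j => fermionTerm 𝕜 m j * c - c * fermionTerm 𝕜 m j) = fun j =>
        (if j = p - m then (a * (p - (m : 𝕜) / 2)) • (Op.hbar * ψMode 𝕜 (m - p)) else 0) +
          (if j = -p then (a * (p - (m : 𝕜) / 2)) • (Op.hbar * ψMode 𝕜 (m - p)) else 0) := by
      funext j
      rw [fermionTerm, smul_mul_assoc, mul_smul_comm, ← smul_sub, hc.ψNormal, smul_sub,
        sub_eq_add_neg, ← smul_neg]
      congr 1
      · by_cases h : j = p - m
        · subst h
          rw [if_pos (by omega), if_pos rfl, smul_smul, neg_sub]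
          congr 1
          push_cast
          ring
        · rw [if_neg (by omega), if_neg h, smul_zero]
      · by_cases h : j = -p
        · subst h
          rw [if_pos (by omega), if_pos rfl, ← neg_smul, smul_smul, ← sub_eq_add_neg]
          congr 1
          push_cast
          ring
        · rw [if_neg (by omega), if_neg h, neg_zero, smul_zero]
    rw [h, two_smul]
    exact (hasSum_ite_eq _ _).add (hasSum_ite_eq _ _)
  rw [HOp_commutator, ← hm, h1, h2, (hc.boson i).eq, sub_self, smul_zero, add_zero, zero_add,
    smul_smul, inv_mul_cancel₀ two_ne_zero, one_smul]

theorem BosonLike.FOp (hc : BosonLike p a c) (N : ℤ) {j : ℕ} (hj : 1 ≤ j) :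
    FOp 𝕜 N j * c - c * FOp 𝕜 N j = a • (Op.hbar * ψMode 𝕜 (j + N - 1 - p)) := by
  set m : ℤ := j + N - 1 with hm
  have h1 : (∑' k : ℤ, mixedTerm 𝕜 m k) * c - c * ∑' k : ℤ, mixedTerm 𝕜 m k =
      a • (Op.hbar * ψMode 𝕜 (m - p)) := by
    refine (hasSum_commutator (summable_mixedTerm 𝕜 m).hasSum hc.cont).unique ?_
    have h : (fun k => mixedTerm 𝕜 m k * c - c * mixedTerm 𝕜 m k) = fun k =>
        if k = m - p then a • (Op.hbar * ψMode 𝕜 (m - p)) else 0 := by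
      funext k
      have h : mixedTerm 𝕜 m k * c - c * mixedTerm 𝕜 m k =
          (bMode 𝕜 (m - k) * c - c * bMode 𝕜 (m - k)) * ψMode 𝕜 k := by
        rw [mixedTerm, mul_assoc, (hc.fermion k).eq]
        noncomm_ring
      rw [h, hc.boson]
      by_cases h : k = m - p
      · subst h
        rw [if_pos (by omega), if_pos rfl, smul_mul_assoc]
      · rw [if_neg (by omega), if_neg h, zero_mul]
    rw [h]
    exact hasSum_ite_eq _ _
  rw [FOp_eq N hj, ← hm, add_mul, mul_add, add_sub_add_comm, h1, (hc.fermion j).eq, sub_self,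
    zero_add]

theorem FermionLike.FOp (hc : FermionLike p a c) (N : ℤ) {j : ℕ} (hj : 1 ≤ j) :
    FOp 𝕜 N j * c + c * FOp 𝕜 N j = a • (Op.hbar * shiftedMode 𝕜 N (j + N - 1 - p)) := by
  set m : ℤ := j + N - 1 with hm
  have h1 : (∑' k : ℤ, mixedTerm 𝕜 m k) * c + c * ∑' k : ℤ, mixedTerm 𝕜 m k =
      a • (Op.hbar * bMode 𝕜 (m - p)) := by
    refine (hasSum_anticommutator (summable_mixedTerm 𝕜 m).hasSum hc.cont).unique ?_
    have h : (fun k => mixedTerm 𝕜 m k * c + c * mixedTerm 𝕜 m k) = fun k =>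
        if k = p then a • (Op.hbar * bMode 𝕜 (m - p)) else 0 := by
      funext k
      have h : mixedTerm 𝕜 m k * c + c * mixedTerm 𝕜 m k =
          bMode 𝕜 (m - k) * (ψMode 𝕜 k * c + c * ψMode 𝕜 k) := by
        rw [mixedTerm, ← mul_assoc c, ← (hc.boson _).eq]
        noncomm_ring
      rw [h, hc.fermion]
      by_cases h : k = p
      · subst h
        rw [if_pos rfl, if_pos rfl, mul_smul_comm, (commute_hbar_bMode _).eq]
      · rw [if_neg h, if_neg h, mul_zero]
    rw [h]
    exact hasSum_ite_eq _ _
  rw [FOp_eq N hj, ← hm, add_mul, mul_add, add_add_add_comm, h1, hc.fermion, shiftedMode, mul_add,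
    smul_add, add_comm]
  congr 1
  by_cases h : (j : ℤ) = p
  · rw [if_pos h, if_pos (by omega), mul_one]
  · rw [if_neg h, if_neg (by omega), mul_zero, smul_zero]

theorem mul_shiftedMode_sub (T : TOp 𝕜) (N k : ℤ) :
    T * shiftedMode 𝕜 N k - shiftedMode 𝕜 N k * T = T * bMode 𝕜 k - bMode 𝕜 k * T := by
  rw [shiftedMode]
  split_ifs <;> noncomm_ring

theorem HOp_shiftedMode (N : ℤ) (i : ℕ) (k : ℤ) :
    HOp 𝕜 N i * shiftedMode 𝕜 N k - shiftedMode 𝕜 N k * HOp 𝕜 N i =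
      (-k : 𝕜) • (hbar * shiftedMode 𝕜 N (i + N - 1 + k)) := by
  rw [mul_shiftedMode_sub, (bosonLike_bMode k).HOp, sub_neg_eq_add, Int.cast_neg]

theorem HOp_ψMode (N : ℤ) (i : ℕ) (k : ℤ) :
    HOp 𝕜 N i * ψMode 𝕜 k - ψMode 𝕜 k * HOp 𝕜 N i =
      (-k - ((i + N - 1 : ℤ) : 𝕜) / 2) • (hbar * ψMode 𝕜 (i + N - 1 + k)) := by
  rw [(fermionLike_ψMode k).HOp, sub_neg_eq_add, one_mul, Int.cast_neg]

theorem FOp_shiftedMode (N : ℤ) {j : ℕ} (hj : 1 ≤ j) (k : ℤ) :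
    FOp 𝕜 N j * shiftedMode 𝕜 N k - shiftedMode 𝕜 N k * FOp 𝕜 N j =
      (-k : 𝕜) • (hbar * ψMode 𝕜 (j + N - 1 + k)) := by
  rw [mul_shiftedMode_sub, (bosonLike_bMode k).FOp N hj, sub_neg_eq_add, Int.cast_neg]

theorem FOp_ψMode (N : ℤ) {j : ℕ} (hj : 1 ≤ j) (k : ℤ) :
    FOp 𝕜 N j * ψMode 𝕜 k + ψMode 𝕜 k * FOp 𝕜 N j =
      (1 : 𝕜) • (hbar * shiftedMode 𝕜 N (j + N - 1 + k)) := by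
  rw [(fermionLike_ψMode k).FOp N hj, sub_neg_eq_add]

end Brackets

end

/-! ## The Ramond relations -/

section

open Series Op

variable {𝕜 : Type*} [RCLike 𝕜]

/-- The vacuum is cyclic for the creation operators. -/
theorem eq_zero_of_commute (ε : 𝕜) {X : TOp 𝕜} (hX : X ∈ weylHat 𝕜 ℕ (WithBot ℕ+))
    (hx : ∀ i, X * mulX i - mulX i * X = 0)
    (hψ : ∀ k : ℤ, X * ψMode 𝕜 k = ε • (ψMode 𝕜 k * X)) (hv : X vac = 0) : X = 0 := by
  have hθ : ∀ s : Finset (WithBot ℕ+), X (mono ⟨0, 0, s⟩) = 0 := by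
    intro s
    -- Inserting the variables from the largest to the smallest keeps the new one in front, so no
    -- sign arises.
    induction s using Finset.induction_on_min with
    | empty => exact hv
    | insert a s has ih =>
      obtain ⟨n, rfl⟩ := thetaIdx_surjective a
      have h : ∃ (k : ℤ) (c : 𝕜), (mono ⟨0, 0, insert (thetaIdx n) s⟩ : Series 𝕜 ℕ (WithBot ℕ+)) =
          c • ψMode 𝕜 k (mono ⟨0, 0, s⟩) := by
        have h1 := mulθ_mono (𝕜 := 𝕜) (μ := (⟨0, 0, s⟩ : Mono ℕ (WithBot ℕ+))) has
        rcases Nat.eq_zero_or_pos n with rfl | hn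
        · refine ⟨0, ((((√2)⁻¹ : ℝ) : 𝕜))⁻¹, ?_⟩
          rw [ψMode_zero, LinearMap.smul_apply, smul_smul, inv_mul_cancel₀, one_smul,
            LinearMap.add_apply, h1, Module.End.mul_apply, dθ_mono_eq_zero, map_zero, add_zero]
          · exact fun h => lt_irrefl _ (has _ h)
          · exact left_ne_zero_of_mul (b := (((√2)⁻¹ : ℝ) : 𝕜))
              (by rw [sqrt_two_inv_mul_self]; norm_num)
        · refine ⟨-n, 1, ?_⟩
          rw [ψMode_of_neg (by omega), one_smul, neg_neg, Int.toNat_natCast, h1]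
      obtain ⟨k, c, h⟩ := h
      have h2 := LinearMap.congr_fun (hψ k) (mono ⟨0, 0, s⟩)
      rw [LinearMap.smul_apply, Module.End.mul_apply, Module.End.mul_apply, ih, map_zero,
        smul_zero] at h2
      rw [h, map_smul, h2, smul_zero]
  have hxs : ∀ (x y : ℕ →₀ ℕ) (s : Finset (WithBot ℕ+)), X (mono ⟨0, y, s⟩) = 0 →
      X (mono ⟨0, y + x, s⟩) = 0 := by
    intro x
    induction x using Finsupp.induction_linear with
    | zero => simp
    | add x x' hx hx' =>
      intro y s h
      rw [← add_assoc]
      exact hx' _ _ (hx _ _ h)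
    | single i n =>
      intro y s h
      induction n with
      | zero => simpa using h
      | succ n ih =>
        have h1 := mulX_mono (𝕜 := 𝕜) i (⟨0, y + Finsupp.single i n, s⟩ : Mono ℕ (WithBot ℕ+))
        have h2 := LinearMap.congr_fun (sub_eq_zero.1 (hx i))
          (mono ⟨0, y + Finsupp.single i n, s⟩)
        rw [Module.End.mul_apply, Module.End.mul_apply, ih, map_zero, h1] at h2
        rw [Finsupp.single_add, ← add_assoc]
        exact h2
  refine (filtered_of_mem_weylHat hX).eq_zero fun ⟨h, x, s⟩ => ?_
  induction h with
  | zero => simpa using hxs x 0 s (hθ s)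
  | succ h ih =>
    have h1 := hbar_mono (𝕜 := 𝕜) (⟨h, x, s⟩ : Mono ℕ (WithBot ℕ+))
    have h2 := LinearMap.congr_fun (commute_hbar_of_mem_weylHat hX).eq (mono ⟨h, x, s⟩)
    rw [Module.End.mul_apply, Module.End.mul_apply, ih, map_zero, h1] at h2
    exact h2.symm

theorem commute_hbar_HOp (N : ℤ) (i : ℕ) : Commute hbar (HOp 𝕜 N i) :=
  commute_hbar_of_mem_weylHat (HOp_mem_weylHat N i)

theorem commute_hbar_FOp (N : ℤ) (j : ℕ) : Commute hbar (FOp 𝕜 N j) :=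
  commute_hbar_of_mem_weylHat (FOp_mem_weylHat N j)

theorem hbar_mem_weylHat : (hbar : TOp 𝕜) ∈ weylHat 𝕜 ℕ (WithBot ℕ+) :=
  weyl_le_weylHat hbar_mem_weyl

theorem smul_hbar_mul_commutator {c : TOp 𝕜} (hc : Commute hbar c) (a : 𝕜) (y : TOp 𝕜) :
    a • (hbar * y) * c - c * (a • (hbar * y)) = a • (hbar * (y * c - c * y)) := by
  have h := mul_comm_smul_hbar hc a y
  rw [← neg_sub, h, ← smul_neg, ← mul_neg, neg_sub]

theorem smul_hbar_mul_anticommutator {c : TOp 𝕜} (hc : Commute hbar c) (a : 𝕜) (y : TOp 𝕜) :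
    a • (hbar * y) * c + c * (a • (hbar * y)) = a • (hbar * (y * c + c * y)) := by
  rw [add_comm, mul_anticomm_smul_hbar hc a y, add_comm]

/-- The Jacobi identity and the brackets with x^i and ψ_q show that the difference of the sides
commutes with all of them. Non-negativity of the two Virasoro indices makes it kill the vacuum. -/
theorem HOp_commutator_HOp {N : ℤ} {m n k : ℕ} (hm : 0 ≤ m + N - 1) (hn : 0 ≤ n + N - 1)
    (hk : (k : ℤ) = m + n + N - 1) :
    HOp 𝕜 N m * HOp 𝕜 N n - HOp 𝕜 N n * HOp 𝕜 N m = ((m : 𝕜) - n) • (hbar * HOp 𝕜 N k) := by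
  rw [← sub_eq_zero]
  set X := HOp 𝕜 N m * HOp 𝕜 N n - HOp 𝕜 N n * HOp 𝕜 N m - ((m : 𝕜) - n) • (hbar * HOp 𝕜 N k)
    with hX
  have jac : ∀ c, X * c - c * X =
      HOp 𝕜 N m * (HOp 𝕜 N n * c - c * HOp 𝕜 N n) - (HOp 𝕜 N n * c - c * HOp 𝕜 N n) * HOp 𝕜 N m -
      (HOp 𝕜 N n * (HOp 𝕜 N m * c - c * HOp 𝕜 N m) - (HOp 𝕜 N m * c - c * HOp 𝕜 N m) * HOp 𝕜 N n) -
      (((m : 𝕜) - n) • (hbar * HOp 𝕜 N k) * c - c * (((m : 𝕜) - n) • (hbar * HOp 𝕜 N k))) :=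
    fun c => by rw [hX]; noncomm_ring
  refine eq_zero_of_commute 1 ?_ (fun i => ?_) (fun q => ?_) ?_
  · exact sub_mem (sub_mem (mul_mem (HOp_mem_weylHat _ _) (HOp_mem_weylHat _ _))
      (mul_mem (HOp_mem_weylHat _ _) (HOp_mem_weylHat _ _)))
      ((weylHat _ _ _).smul_mem (mul_mem hbar_mem_weylHat (HOp_mem_weylHat _ _)) _)
  · have hc := bosonLike_mulX (𝕜 := 𝕜) i
    rw [jac, smul_hbar_mul_commutator hc.hbar, hc.HOp, hc.HOp, hc.HOp,
      mul_comm_smul_hbar (commute_hbar_HOp N m), mul_comm_smul_hbar (commute_hbar_HOp N n),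
      HOp_shiftedMode, HOp_shiftedMode,
      show (m : ℤ) + N - 1 + (n + N - 1 - i) = k + N - 1 - i by omega,
      show (n : ℤ) + N - 1 + (m + N - 1 - i) = k + N - 1 - i by omega]
    simp only [mul_smul_comm]
    push_cast
    module
  · have hc := fermionLike_ψMode (𝕜 := 𝕜) q
    -- The coefficient in the bracket of `HOp 𝕜 N k` with a fermionic mode involves `k` itself, so
    -- the index relation is also needed in the field.
    have hk' : (k : 𝕜) = m + n + N - 1 := by exact_mod_cast congrArg (Int.cast (R := 𝕜)) hk
    rw [one_smul, ← sub_eq_zero, jac, smul_hbar_mul_commutator hc.hbar, HOp_ψMode, HOp_ψMode,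
      HOp_ψMode,
      mul_comm_smul_hbar (commute_hbar_HOp N m), mul_comm_smul_hbar (commute_hbar_HOp N n),
      HOp_ψMode, HOp_ψMode,
      show (m : ℤ) + N - 1 + (n + N - 1 + q) = k + N - 1 + q by omega,
      show (n : ℤ) + N - 1 + (m + N - 1 + q) = k + N - 1 + q by omega]
    simp only [mul_smul_comm]
    push_cast
    rw [hk']
    module
  · have hk0 : 0 ≤ (k : ℤ) + N - 1 := by omega
    simp only [hX, LinearMap.sub_apply, LinearMap.smul_apply, Module.End.mul_apply, HOp_vac hm,
      HOp_vac hn, HOp_vac hk0, map_zero, smul_zero, sub_zero]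

/-- Here the difference of the sides is odd: it anticommutes with the ψ_q, whence the sign `-1` and
the super Jacobi identity `jac'`. -/
theorem HOp_commutator_FOp {N : ℤ} {m n k : ℕ} (hm : 0 ≤ m + N - 1) (hn : 1 ≤ n)
    (hN : 0 ≤ N) (hk : (k : ℤ) = m + n + N - 1) :
    HOp 𝕜 N m * FOp 𝕜 N n - FOp 𝕜 N n * HOp 𝕜 N m =
      (((m : 𝕜) - N + 1) / 2 - n) • (hbar * FOp 𝕜 N k) := by
  have hk1 : 1 ≤ k := by omega
  rw [← sub_eq_zero]
  set X := HOp 𝕜 N m * FOp 𝕜 N n - FOp 𝕜 N n * HOp 𝕜 N m -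
    (((m : 𝕜) - N + 1) / 2 - n) • (hbar * FOp 𝕜 N k) with hX
  have jac : ∀ c, X * c - c * X =
      HOp 𝕜 N m * (FOp 𝕜 N n * c - c * FOp 𝕜 N n) - (FOp 𝕜 N n * c - c * FOp 𝕜 N n) * HOp 𝕜 N m -
      (FOp 𝕜 N n * (HOp 𝕜 N m * c - c * HOp 𝕜 N m) - (HOp 𝕜 N m * c - c * HOp 𝕜 N m) * FOp 𝕜 N n) -
      ((((m : 𝕜) - N + 1) / 2 - n) • (hbar * FOp 𝕜 N k) * c -
        c * ((((m : 𝕜) - N + 1) / 2 - n) • (hbar * FOp 𝕜 N k))) :=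
    fun c => by rw [hX]; noncomm_ring
  have jac' : ∀ c, X * c + c * X =
      HOp 𝕜 N m * (FOp 𝕜 N n * c + c * FOp 𝕜 N n) - (FOp 𝕜 N n * c + c * FOp 𝕜 N n) * HOp 𝕜 N m -
      (FOp 𝕜 N n * (HOp 𝕜 N m * c - c * HOp 𝕜 N m) + (HOp 𝕜 N m * c - c * HOp 𝕜 N m) * FOp 𝕜 N n) -
      ((((m : 𝕜) - N + 1) / 2 - n) • (hbar * FOp 𝕜 N k) * c +
        c * ((((m : 𝕜) - N + 1) / 2 - n) • (hbar * FOp 𝕜 N k))) :=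
    fun c => by rw [hX]; noncomm_ring
  refine eq_zero_of_commute (-1) ?_ (fun i => ?_) (fun q => ?_) ?_
  · exact sub_mem (sub_mem (mul_mem (HOp_mem_weylHat _ _) (FOp_mem_weylHat _ _))
      (mul_mem (FOp_mem_weylHat _ _) (HOp_mem_weylHat _ _)))
      ((weylHat _ _ _).smul_mem (mul_mem hbar_mem_weylHat (FOp_mem_weylHat _ _)) _)
  · have hc := bosonLike_mulX (𝕜 := 𝕜) i
    rw [jac, smul_hbar_mul_commutator hc.hbar, hc.FOp N hn, hc.HOp, hc.FOp N hk1,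
      mul_comm_smul_hbar (commute_hbar_HOp N m), mul_comm_smul_hbar (commute_hbar_FOp N n),
      HOp_ψMode, FOp_shiftedMode N hn,
      show (m : ℤ) + N - 1 + (n + N - 1 - i) = k + N - 1 - i by omega,
      show (n : ℤ) + N - 1 + (m + N - 1 - i) = k + N - 1 - i by omega]
    simp only [mul_smul_comm]
    push_cast
    module
  · have hc := fermionLike_ψMode (𝕜 := 𝕜) q
    rw [neg_one_smul, ← sub_eq_zero, sub_neg_eq_add, jac', smul_hbar_mul_anticommutator hc.hbar,
      HOp_ψMode, FOp_ψMode N hn, FOp_ψMode N hk1,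
      mul_comm_smul_hbar (commute_hbar_HOp N m), mul_anticomm_smul_hbar (commute_hbar_FOp N n),
      HOp_shiftedMode, FOp_ψMode N hn,
      show (m : ℤ) + N - 1 + (n + N - 1 + q) = k + N - 1 + q by omega,
      show (n : ℤ) + N - 1 + (m + N - 1 + q) = k + N - 1 + q by omega]
    simp only [mul_smul_comm]
    push_cast
    module
  · have hk0 : 0 ≤ (k : ℤ) + N - 1 := by omega
    have hn0 : 0 ≤ (n : ℤ) + N - 1 := by omega
    simp only [hX, LinearMap.sub_apply, LinearMap.smul_apply, Module.End.mul_apply, HOp_vac hm,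
      FOp_vac hn hn0, FOp_vac hk1 hk0, map_zero, smul_zero, sub_zero]

/-- The difference is even, but its factors are odd. Bracketing a factor with x^i leaves a ψ and
with ψ_q leaves a shifted bosonic mode, hence two forms of the Jacobi identity. -/
theorem FOp_anticommutator_FOp {N : ℤ} {m n k : ℕ} (hm : 1 ≤ m) (hn : 1 ≤ n)
    (hN : 0 ≤ N) (hk : (k : ℤ) = m + n + N - 1) :
    FOp 𝕜 N m * FOp 𝕜 N n + FOp 𝕜 N n * FOp 𝕜 N m = (2 : 𝕜) • (hbar * HOp 𝕜 N k) := by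
  rw [← sub_eq_zero]
  set X := FOp 𝕜 N m * FOp 𝕜 N n + FOp 𝕜 N n * FOp 𝕜 N m - (2 : 𝕜) • (hbar * HOp 𝕜 N k) with hX
  have jac : ∀ c, X * c - c * X =
      FOp 𝕜 N m * (FOp 𝕜 N n * c - c * FOp 𝕜 N n) + (FOp 𝕜 N n * c - c * FOp 𝕜 N n) * FOp 𝕜 N m +
      (FOp 𝕜 N n * (FOp 𝕜 N m * c - c * FOp 𝕜 N m) + (FOp 𝕜 N m * c - c * FOp 𝕜 N m) * FOp 𝕜 N n) -
      ((2 : 𝕜) • (hbar * HOp 𝕜 N k) * c - c * ((2 : 𝕜) • (hbar * HOp 𝕜 N k))) :=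
    fun c => by rw [hX]; noncomm_ring
  have jac' : ∀ c, X * c - c * X =
      FOp 𝕜 N m * (FOp 𝕜 N n * c + c * FOp 𝕜 N n) - (FOp 𝕜 N n * c + c * FOp 𝕜 N n) * FOp 𝕜 N m +
      (FOp 𝕜 N n * (FOp 𝕜 N m * c + c * FOp 𝕜 N m) - (FOp 𝕜 N m * c + c * FOp 𝕜 N m) * FOp 𝕜 N n) -
      ((2 : 𝕜) • (hbar * HOp 𝕜 N k) * c - c * ((2 : 𝕜) • (hbar * HOp 𝕜 N k))) :=
    fun c => by rw [hX]; noncomm_ring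
  refine eq_zero_of_commute 1 ?_ (fun i => ?_) (fun q => ?_) ?_
  · exact sub_mem (add_mem (mul_mem (FOp_mem_weylHat _ _) (FOp_mem_weylHat _ _))
      (mul_mem (FOp_mem_weylHat _ _) (FOp_mem_weylHat _ _)))
      ((weylHat _ _ _).smul_mem (mul_mem hbar_mem_weylHat (HOp_mem_weylHat _ _)) _)
  · have hc := bosonLike_mulX (𝕜 := 𝕜) i
    rw [jac, smul_hbar_mul_commutator hc.hbar, hc.FOp N hn, hc.FOp N hm, hc.HOp,
      mul_anticomm_smul_hbar (commute_hbar_FOp N m), mul_anticomm_smul_hbar (commute_hbar_FOp N n),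
      FOp_ψMode N hm, FOp_ψMode N hn,
      show (m : ℤ) + N - 1 + (n + N - 1 - i) = k + N - 1 - i by omega,
      show (n : ℤ) + N - 1 + (m + N - 1 - i) = k + N - 1 - i by omega]
    simp only [mul_smul_comm]
    module
  · have hc := fermionLike_ψMode (𝕜 := 𝕜) q
    have hk' : (k : 𝕜) = m + n + N - 1 := by exact_mod_cast congrArg (Int.cast (R := 𝕜)) hk
    rw [one_smul, ← sub_eq_zero, jac', smul_hbar_mul_commutator hc.hbar,
      HOp_ψMode, FOp_ψMode N hn, FOp_ψMode N hm,
      mul_comm_smul_hbar (commute_hbar_FOp N m), mul_comm_smul_hbar (commute_hbar_FOp N n),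
      FOp_shiftedMode N hm, FOp_shiftedMode N hn,
      show (m : ℤ) + N - 1 + (n + N - 1 + q) = k + N - 1 + q by omega,
      show (n : ℤ) + N - 1 + (m + N - 1 + q) = k + N - 1 + q by omega]
    simp only [mul_smul_comm]
    push_cast
    rw [hk']
    module
  · have hk0 : 0 ≤ (k : ℤ) + N - 1 := by omega
    have hn0 : 0 ≤ (n : ℤ) + N - 1 := by omega
    have hm0 : 0 ≤ (m : ℤ) + N - 1 := by omega
    simp only [hX, LinearMap.sub_apply, LinearMap.add_apply, LinearMap.smul_apply,
      Module.End.mul_apply, HOp_vac hk0,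
      FOp_vac hn hn0, FOp_vac hm hm0, map_zero, smul_zero, sub_zero, add_zero]

end

/-! ## The two families -/

section

open Series Op

variable {𝕜 : Type*} [RCLike 𝕜]

/-- The bracket is ħ²∂/√2 in the variable of index j+N-1, the shift being absent because `j ≥ 1`.
Multiplication by ħ is injective, and the derivative does not kill its own variable. -/
theorem scomm_mulθ_FOp_ne_zero (N : ℤ) (hN : 0 ≤ N) {j : ℕ} (hj : 1 ≤ j) :
    scomm (mulθ (thetaIdx 0)) (FOp 𝕜 N j) ≠ 0 := by
  have hs : (((√2)⁻¹ : ℝ) : 𝕜) ≠ 0 := left_ne_zero_of_mul (b := (((√2)⁻¹ : ℝ) : 𝕜))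
    (by rw [sqrt_two_inv_mul_self]; norm_num)
  rw [scomm_odd (hasParity_mulθ _) (hasParity_FOp N j), add_comm,
    fermionLike_mulθ_zero.FOp N hj, shiftedMode, if_neg (by omega), add_zero,
    bMode_of_nonneg (by omega), smul_ne_zero_iff_right hs]
  set m := ((j : ℤ) + N - 1 - 0).toNat
  intro h
  have h1 : (dX m : TOp 𝕜) = 0 :=
    hbar_mul_cancel (hbar_mul_cancel (by rw [h, mul_zero, mul_zero]))
  have h2 := congrArg (fun T : TOp 𝕜 =>
    (T (mono ⟨0, Finsupp.single m 1, ∅⟩)).coeff ⟨0, 0, ∅⟩) h1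
  simp [coeff_dX, coeff_mono] at h2

/-- The operators `H_i`, with arbitrary constants added for `i ≤ d`. -/
def HShift (N d : ℤ) (D : ℕ → 𝕜) (i : ℕ) : TOp 𝕜 :=
  HOp 𝕜 N i + (if (i : ℤ) ≤ d then D i • hbar else 0)

section HShift

variable (N d : ℤ) (D : ℕ → 𝕜)

theorem HShift_of_lt {i : ℕ} (h : d < i) : HShift N d D i = HOp 𝕜 N i := by
  rw [HShift, if_neg h.not_ge, add_zero]

theorem HShift_mem_weylHat (i : ℕ) : HShift N d D i ∈ weylHat 𝕜 ℕ (WithBot ℕ+) := by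
  refine add_mem (HOp_mem_weylHat N i) ?_
  split_ifs
  exacts [(weylHat _ _ _).smul_mem hbar_mem_weylHat _, zero_mem _]

theorem hasParity_HShift (i : ℕ) : HasParity false (HShift N d D i) := by
  refine (hasParity_HOp N i).add ?_
  split_ifs
  exacts [hasParity_hbar.smul _, hasParity_zero _]

theorem exists_HShift_eq_add (i : ℕ) :
    ∃ T : TOp 𝕜, Homog 2 T ∧ HShift N d D i = hbar * dX i + T := by
  obtain ⟨T, hT, h⟩ := exists_HOp_eq_add (𝕜 := 𝕜) N i
  refine ⟨T + (if (i : ℤ) ≤ d then D i • hbar else 0), hT.add ?_, by rw [HShift, h, add_assoc]⟩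
  split_ifs
  exacts [homog_hbar.smul _, homog_zero _]

theorem finite_HShift_mono (μ : Mono ℕ (WithBot ℕ+)) :
    {i | HShift N d D i (mono μ) ≠ 0}.Finite := by
  refine ((finite_HOp_mono (𝕜 := 𝕜) N μ).union (Set.finite_Iic d.toNat)).subset fun i hi => ?_
  by_contra hc
  rw [Set.mem_union, not_or, Set.mem_Iic, Set.mem_ofPred_eq, not_not] at hc
  exact hi (by rw [HShift_of_lt N d D (by omega), hc.1])

theorem HShift_commutator (i : ℕ) {T : TOp 𝕜} (hT : Commute hbar T) :
    HShift N d D i * T - T * HShift N d D i = HOp 𝕜 N i * T - T * HOp 𝕜 N i := by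
  rw [HShift, add_mul, mul_add, add_sub_add_comm, add_eq_left]
  split_ifs
  · rw [smul_mul_assoc, mul_smul_comm, hT.eq, sub_self]
  · simp

theorem commute_hbar_HShift (i : ℕ) : Commute hbar (HShift N d D i) :=
  commute_hbar_of_mem_weylHat (HShift_mem_weylHat N d D i)

/-- The constants are central, so they do not affect the left sides. On the right of `HH`, either `m
= n` and the coefficient is zero, or `m + n ≥ 2 * a + 1` and the index lies beyond `d`; on the right
of `FF`, the bounds `m, n ≥ 1` and `a ≤ 1` put it beyond `d`. -/
theorem ramondRelations_HShift {N d : ℤ} {a : ℕ} (hN : 0 ≤ N) (ha : 0 ≤ a + N - 1) (ha' : a ≤ 1)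
    (hd : d ≤ N - 1 + a) : RamondRelations N a (HShift N d D) (FOp 𝕜 N) where
  HH m n k hm hn hk := by
    rw [scomm_even_left (hasParity_HShift N d D m), HShift_commutator N d D m
      (commute_hbar_HShift N d D n), ← neg_sub, HShift_commutator N d D n (commute_hbar_HOp N m),
      neg_sub, HOp_commutator_HOp (by omega) (by omega) hk]
    rcases eq_or_ne m n with rfl | hmn
    · rw [sub_self, zero_smul, zero_smul]
    · rw [HShift_of_lt N d D (by omega)]
  HF m n k hm hn hk := by
    rw [scomm_even_left (hasParity_HShift N d D m), HShift_commutator N d D m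
      (commute_hbar_FOp N n), HOp_commutator_FOp (by omega) hn hN hk]
  FF m n k hm hn hk := by
    rw [scomm_odd (hasParity_FOp N m) (hasParity_FOp N n), FOp_anticommutator_FOp hm hn hN hk,
      HShift_of_lt N d D (by omega)]

end HShift

theorem degPart_add_degPart {E O : Type*} {K : Type*} [Field K] {S T : Op K E O} (hS : Homog 1 S)
    (hT : Homog 2 T) : degPart 0 (S + T) + degPart 1 (S + T) = S := by
  rw [degPart_add, degPart_add, hS.degPart_eq_zero one_ne_zero, hT.degPart_eq_zero two_ne_zero,
    hT.degPart_eq_zero (by norm_num), hS, zero_add, zero_add, add_zero]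

/-- A family of even operators forms an Airy family together with the operators `F_j` if it
satisfies the evident conditions. -/
theorem isAiryFamily_FOp (N : ℤ) {H : ℕ → TOp 𝕜} (hmem : ∀ i, H i ∈ weylHat 𝕜 ℕ (WithBot ℕ+))
    (hpar : ∀ i, HasParity false (H i))
    (hlin : ∀ i, ∃ T : TOp 𝕜, Homog 2 T ∧ H i = hbar * dX i + T)
    (hfin : ∀ μ, {i | H i (mono μ) ≠ 0}.Finite)
    (hHH : ∀ m n, ∃ (c : 𝕜) (k : ℕ), scomm (H m) (H n) = c • (hbar * H k))
    (hHF : ∀ (m : ℕ) (n : ℕ+), ∃ (c : 𝕜) (k : ℕ+),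
      scomm (H m) (FOp 𝕜 N n) = c • (hbar * FOp 𝕜 N k))
    (hFF : ∀ m n : ℕ+, ∃ (c : 𝕜) (k : ℕ), scomm (FOp 𝕜 N m) (FOp 𝕜 N n) = c • (hbar * H k)) :
    IsAiryFamily (Sum.elim H fun j : ℕ+ => FOp 𝕜 N j) where
  mem := by
    rintro (i | j)
    exacts [hmem i, FOp_mem_weylHat N j]
  locFin := by
    refine LocFin.of_mono ?_ fun μ => ?_
    · rintro (i | j)
      exacts [filtered_of_mem_weylHat (hmem i), filtered_of_mem_weylHat (FOp_mem_weylHat N j)]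
    · refine (((hfin μ).image Sum.inl).union
        ((finite_FOp_mono (𝕜 := 𝕜) N μ).image Sum.inr)).subset ?_
      rintro (i | j) h
      exacts [Or.inl ⟨i, h, rfl⟩, Or.inr ⟨j, h, rfl⟩]
  parity := by
    rintro (i | j)
    exacts [hpar i, hasParity_FOp N j]
  linear := by
    rintro (i | j)
    · obtain ⟨T, hT, h⟩ := hlin i
      rw [Sum.elim_inl, h]
      exact degPart_add_degPart (homog_hdX i) hT
    · obtain ⟨T, hT, h⟩ := exists_FOp_eq_add (𝕜 := 𝕜) N j
      rw [Sum.elim_inr, h, thetaIdx_coe]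
      exact degPart_add_degPart (homog_hdθ _) hT
  bracket := by
    rintro (m | m) (n | n)
    · obtain ⟨c, k, h⟩ := hHH m n
      exact ⟨c, Sum.inl k, h⟩
    · obtain ⟨c, k, h⟩ := hHF m n
      exact ⟨c, Sum.inr k, h⟩
    · obtain ⟨c, k, h⟩ := hHF n m
      refine ⟨-c, Sum.inr k, ?_⟩
      simp only [Sum.elim_inl, Sum.elim_inr]
      rw [scomm_even_right (hpar n), ← neg_sub, ← scomm_even_left (hpar n), h, neg_smul]
    · obtain ⟨c, k, h⟩ := hFF m n
      exact ⟨c, Sum.inl k, h⟩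

theorem isAiryFamily_HShift {N : ℤ} (hN : 1 ≤ N) (D : ℕ → 𝕜) :
    IsAiryFamily (Sum.elim (HShift N (N - 1) D) fun j : ℕ+ => FOp 𝕜 N j) := by
  have hR := ramondRelations_HShift (N := N) (d := N - 1) (a := 0) D (by omega) (by omega)
    (by omega) (by omega)
  refine isAiryFamily_FOp N (HShift_mem_weylHat _ _ _) (hasParity_HShift _ _ _)
    (exists_HShift_eq_add _ _ _) (finite_HShift_mono _ _ _) (fun m n => ?_) (fun m n => ?_)
    fun m n => ?_
  · exact ⟨_, _, hR.HH m n ((m : ℤ) + n + N - 1).toNat (by omega) (by omega) (by omega)⟩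
  · have := n.pos
    exact ⟨_, ⟨((m : ℤ) + n + N - 1).toNat, by omega⟩,
      hR.HF m n _ (by omega) (by omega) (by rw [PNat.mk_coe]; omega)⟩
  · have := n.pos
    have := m.pos
    exact ⟨_, _, hR.FF m n ((m : ℤ) + n + N - 1).toNat (by omega) (by omega) (by omega)⟩

/-- The exceptional operator attached to `y_0` in the second family. -/
def HZero (D₀ C₀ : 𝕜) : TOp 𝕜 :=
  hbar * dX 0 + (C₀ / 2) • (hbar * dX 0 * (hbar * dX 0)) + D₀ • hbar

/-- The bracket with b_k carries the factor -k, so b_0, which is ħ∂ in x^0, commutes with the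
operator. The exceptional operator is a polynomial in b_0 and ħ. -/
theorem commute_hdX_zero_HOp (N : ℤ) (i : ℕ) : Commute (hbar * dX 0) (HOp 𝕜 N i) := by
  have h := (bosonLike_bMode (𝕜 := 𝕜) 0).HOp N i
  rw [neg_zero, Int.cast_zero, zero_smul, sub_eq_zero] at h
  have h0 : bMode 𝕜 0 = hbar * dX 0 := bMode_natCast 0
  rw [h0] at h
  exact h.symm

theorem commute_hdX_zero_FOp (N : ℤ) {j : ℕ} (hj : 1 ≤ j) :
    Commute (hbar * dX 0) (FOp 𝕜 N j) := by
  have h := (bosonLike_bMode (𝕜 := 𝕜) 0).FOp N hj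
  rw [neg_zero, Int.cast_zero, zero_smul, sub_eq_zero] at h
  have h0 : bMode 𝕜 0 = hbar * dX 0 := bMode_natCast 0
  rw [h0] at h
  exact h.symm

theorem commute_HZero {D₀ C₀ : 𝕜} {T : TOp 𝕜} (h : Commute (hbar * dX 0) T)
    (h' : Commute hbar T) : Commute (HZero D₀ C₀) T :=
  (h.add_left (Commute.smul_left (h.mul_left h) _)).add_left (Commute.smul_left h' _)

theorem hasParity_HZero (D₀ C₀ : 𝕜) : HasParity false (HZero D₀ C₀) :=
  ((hasParity_hdX 0).add (HasParity.smul ((hasParity_hdX 0).mul (hasParity_hdX 0)) _)).add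
    (hasParity_hbar.smul _)

theorem scomm_HZero_HShift (D₀ C₀ : 𝕜) (N d : ℤ) (D : ℕ → 𝕜) (i : ℕ) :
    scomm (HZero D₀ C₀) (HShift N d D i) = 0 := by
  refine scomm_eq_zero_of_commute_left (commute_HZero ?_ (commute_hbar_HShift _ _ _ _))
    (hasParity_HZero _ _)
  refine (commute_hdX_zero_HOp N i).add_right ?_
  split_ifs
  exacts [Commute.smul_right (commute_hbar_hdX 0).symm _, Commute.zero_right _]

theorem scomm_HZero_FOp (D₀ C₀ : 𝕜) (N : ℤ) {j : ℕ} (hj : 1 ≤ j) :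
    scomm (HZero D₀ C₀) (FOp 𝕜 N j) = 0 :=
  scomm_eq_zero_of_commute_left (commute_HZero (commute_hdX_zero_FOp N hj)
    (commute_hbar_FOp _ _)) (hasParity_HZero _ _)

/-- The even operators of the second family. -/
def HExc (N : ℤ) (D : ℕ → 𝕜) (C₀ : 𝕜) (i : ℕ) : TOp 𝕜 :=
  if i = 0 then HZero (D 0) C₀ else HShift N N D i

theorem HExc_of_pos (N : ℤ) (D : ℕ → 𝕜) (C₀ : 𝕜) {i : ℕ} (hi : 1 ≤ i) :
    HExc N D C₀ i = HShift N N D i := if_neg (by omega)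

theorem isAiryFamily_HExc {N : ℤ} (hN : 0 ≤ N) (D : ℕ → 𝕜) (C₀ : 𝕜) :
    IsAiryFamily (Sum.elim (HExc N D C₀) fun j : ℕ+ => FOp 𝕜 N j) := by
  have hR := ramondRelations_HShift (N := N) (d := N) (a := 1) D (by omega) (by omega)
    (by omega) (by omega)
  have hpar : ∀ i, HasParity false (HExc N D C₀ i) := by
    intro i
    rw [HExc]
    split_ifs
    exacts [hasParity_HZero _ _, hasParity_HShift _ _ _ _]
  refine isAiryFamily_FOp N (fun i => ?_) hpar (fun i => ?_) (fun μ => ?_) (fun m n => ?_)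
    (fun m n => ?_) fun m n => ?_
  · rw [HExc]
    split_ifs
    · exact weyl_le_weylHat (add_mem (add_mem (hdX_mem_weyl 0) ((weyl _ _ _).smul_mem
        (mul_mem (hdX_mem_weyl 0) (hdX_mem_weyl 0)) _)) ((weyl _ _ _).smul_mem hbar_mem_weyl _))
    · exact HShift_mem_weylHat _ _ _ _
  · rcases Nat.eq_zero_or_pos i with rfl | hi
    · exact ⟨_, Homog.add (Homog.smul ((homog_hdX 0).mul (homog_hdX 0)) _) (homog_hbar.smul _),
        add_assoc _ _ _⟩
    · rw [HExc_of_pos N D C₀ hi]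
      exact exists_HShift_eq_add _ _ _ _
  · refine ((finite_HShift_mono N N D μ).union (Set.finite_singleton 0)).subset fun i hi => ?_
    by_cases h : i = 0
    · exact Or.inr h
    · left
      rwa [Set.mem_ofPred_eq, HExc, if_neg h] at hi
  · rcases Nat.eq_zero_or_pos m with rfl | hm <;> rcases Nat.eq_zero_or_pos n with rfl | hn
    · exact ⟨0, 0, by rw [scomm_eq_zero_of_commute_left (Commute.refl _) (hpar 0), zero_smul]⟩
    · refine ⟨0, 0, ?_⟩
      rw [HExc_of_pos N D C₀ hn, zero_smul]
      exact scomm_HZero_HShift _ _ _ _ _ _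
    · refine ⟨0, 0, ?_⟩
      have h := scomm_HZero_HShift (D 0) C₀ N N D m
      rw [scomm_even_left (hasParity_HZero _ _)] at h
      rw [scomm_even_right (hpar 0), HExc_of_pos N D C₀ hm, zero_smul, ← neg_sub]
      exact neg_eq_zero.2 h
    · refine ⟨(m : 𝕜) - n, ((m : ℤ) + n + N - 1).toNat, ?_⟩
      rw [HExc_of_pos N D C₀ hm, HExc_of_pos N D C₀ hn, HExc_of_pos N D C₀ (by omega)]
      exact hR.HH m n _ hm hn (by omega)
  · have := n.pos
    rcases Nat.eq_zero_or_pos m with rfl | hm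
    · exact ⟨0, 1, (scomm_HZero_FOp _ _ _ n.pos).trans (zero_smul _ _).symm⟩
    · rw [HExc_of_pos N D C₀ hm]
      exact ⟨_, ⟨((m : ℤ) + n + N - 1).toNat, by omega⟩,
        hR.HF m n _ hm (by omega) (by rw [PNat.mk_coe]; omega)⟩
  · have := n.pos
    have := m.pos
    -- With `m, n ≥ 1` and `N ≥ 0` this index is at least 1, so the exceptional operator of index 0
    -- never appears on the right.
    refine ⟨2, ((m : ℤ) + n + N - 1).toNat, ?_⟩
    rw [HExc_of_pos N D C₀ (by omega)]
    exact hR.FF m n _ (by omega) (by omega) (by omega)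

theorem scomm_bMode_bMode (m n : ℤ) :
    scomm (bMode 𝕜 m) (bMode 𝕜 n) = if m + n = 0 then (m : 𝕜) • hbar else 0 := by
  rw [scomm_even_left (hasParity_bMode m), bMode_mul_bMode]
  by_cases h : m = -n
  · rw [if_pos h, if_pos (by omega), h]
  · rw [if_neg h, if_neg (by omega)]

theorem scomm_ψMode_ψMode (m n : ℤ) :
    scomm (ψMode 𝕜 m) (ψMode 𝕜 n) = if m + n = 0 then hbar else 0 := by
  rw [scomm_odd (hasParity_ψMode m) (hasParity_ψMode n), ψMode_mul_ψMode, one_smul]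
  exact if_congr (by omega) rfl rfl

theorem scomm_bMode_ψMode (m n : ℤ) : scomm (bMode 𝕜 m) (ψMode 𝕜 n) = 0 :=
  scomm_eq_zero_of_commute_left (commute_bMode_ψMode m n) (hasParity_bMode m)

end

end SuperAiry

end

open SuperAiry SuperAiry.Op in
theorem mainTheorem11 (𝕜 : Type*) [RCLike 𝕜] :
    -- the modes represent the super Heisenberg algebra
    ((∀ m n : ℤ, scomm (bMode 𝕜 m) (bMode 𝕜 n) = if m + n = 0 then (m : 𝕜) • hbar else 0) ∧
      (∀ m n : ℤ, scomm (ψMode 𝕜 m) (ψMode 𝕜 n) = if m + n = 0 then hbar else 0) ∧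
      (∀ m n : ℤ, scomm (bMode 𝕜 m) (ψMode 𝕜 n) = 0)) ∧
    -- the operators are well defined elements of the completed Weyl algebra,
    -- and the odd ones involve the extra variable
    (∀ N : ℤ, 0 ≤ N →
      (∀ i : ℕ, Summable (bosonTerm 𝕜 (i + N - 1)) ∧ Summable (fermionTerm 𝕜 (i + N - 1)) ∧
        HOp 𝕜 N i ∈ weylHat 𝕜 ℕ (WithBot ℕ+)) ∧
      (∀ j : ℕ, 1 ≤ j → Summable (mixedTerm 𝕜 (j + N - 1)) ∧
        FOp 𝕜 N j ∈ weylHat 𝕜 ℕ (WithBot ℕ+) ∧ scomm (mulθ (thetaIdx 0)) (FOp 𝕜 N j) ≠ 0)) ∧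
    -- the first family
    (∀ N : ℤ, 1 ≤ N → ∀ D : ℕ → 𝕜,
      RamondRelations N 0
        (fun i => HOp 𝕜 N i + (if (i : ℤ) ≤ N - 1 then D i • hbar else 0)) (FOp 𝕜 N) ∧
      ∃! L : Module.Dual 𝕜 (SVect 𝕜 ℕ ℕ+) →ₗ[𝕜] weylHat 𝕜 ℕ (WithBot ℕ+),
        IsSuperQuantumAiryStructure L ∧
        (∀ i : ℕ, (L (yDual i)).1 =
          HOp 𝕜 N i + (if (i : ℤ) ≤ N - 1 then D i • hbar else 0)) ∧
        (∀ j : ℕ+, (L (ηDual j)).1 = FOp 𝕜 N j)) ∧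
    -- the second family
    (∀ N : ℤ, 0 ≤ N → ∀ (D : ℕ → 𝕜) (C₀ : 𝕜),
      RamondRelations N 1
        (fun i => HOp 𝕜 N i + (if (i : ℤ) ≤ N then D i • hbar else 0)) (FOp 𝕜 N) ∧
      ∃! L : Module.Dual 𝕜 (SVect 𝕜 ℕ ℕ+) →ₗ[𝕜] weylHat 𝕜 ℕ (WithBot ℕ+),
        IsSuperQuantumAiryStructure L ∧
        (∀ i : ℕ, 1 ≤ i → (L (yDual i)).1 =
          HOp 𝕜 N i + (if (i : ℤ) ≤ N then D i • hbar else 0)) ∧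
        (∀ j : ℕ+, (L (ηDual j)).1 = FOp 𝕜 N j) ∧
        (L (yDual 0)).1 = hbar * dX 0 + (C₀ / 2) • (hbar * dX 0 * (hbar * dX 0)) + D 0 • hbar ∧
        (∀ i : ℕ, 1 ≤ i → scomm (L (yDual 0)).1 (L (yDual i)).1 = 0) ∧
        (∀ j : ℕ+, scomm (L (yDual 0)).1 (L (ηDual j)).1 = 0)) := by
  refine ⟨⟨scomm_bMode_bMode, scomm_ψMode_ψMode, scomm_bMode_ψMode⟩, fun N hN => ⟨fun i =>
    ⟨summable_bosonTerm 𝕜 _, summable_fermionTerm 𝕜 _, HOp_mem_weylHat N i⟩, fun j hj =>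
    ⟨summable_mixedTerm 𝕜 _, FOp_mem_weylHat N j, scomm_mulθ_FOp_ne_zero N hN hj⟩⟩,
    fun N hN D => ⟨ramondRelations_HShift D (by omega) (by omega) (by omega) (by omega),
      (isAiryFamily_HShift hN D).existsUnique⟩,
    fun N hN D C₀ => ⟨ramondRelations_HShift D (by omega) (by omega) (by omega) (by omega), ?_⟩⟩
  obtain ⟨L, ⟨hL, hy, hη⟩, huniq⟩ := (isAiryFamily_HExc hN D C₀).existsUnique
  have hy' : ∀ i, 1 ≤ i → (L (yDual i)).1 = HShift N N D i := fun i hi =>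
    (hy i).trans (HExc_of_pos N D C₀ hi)
  have hy0 : (L (yDual 0)).1 = HZero (D 0) C₀ := hy 0
  refine ⟨L, ⟨hL, hy', hη, hy0, fun i hi => ?_, fun j => ?_⟩, ?_⟩
  · rw [hy0, hy' i hi]
    exact scomm_HZero_HShift _ _ _ _ _ _
  · rw [hy0, hη j]
    exact scomm_HZero_FOp _ _ _ j.pos
  -- The prescribed values at y_0, the other y_i and the η_j together give all values on
  -- coordinates, which determine a continuous map.
  · rintro L' ⟨hL', hy1, hη1, hy2, -, -⟩
    refine huniq L' ⟨hL', fun i => ?_, hη1⟩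
    rcases Nat.eq_zero_or_pos i with rfl | hi
    · exact hy2
    · exact (hy1 i hi).trans (HExc_of_pos N D C₀ hi).symm
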